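/- Let $\Bbbk$ be a commutative ring in which $2$ is invertible. A Lie superalgebra over $\Bbbk$ is a $\mathbb{Z}/2\mathbb{Z}$-graded $\Bbbk$-module with an even $\Bbbk$-bilinear bracket satisfying super-antisymmetry and the super-Jacobi identity; homomorphisms are even $\Bbbk$-linear maps preserving brackets. A central extension of a Lie superalgebra $\mathfrak{g}$ is a surjective homomorphism $\varphi:\mathfrak{E}\to\mathfrak{g}$ with $\ker\varphi$ contained in the centre of $\mathfrak{E}$; a central extension $\psi:\mathfrak{U}\to\mathfrak{g}$ is universal if for every central extension $\varphi:\mathfrak{E}\to\mathfrak{g}$ there is a unique homomorphism $\varphi':\mathfrak{U}\to\mathfrak{E}$ with $\varphi\circ\varphi'=\psi$. Let $R=R_0\oplus R_1$ be a unital associative superalgebra over $\Bbbk$, let $\rho(a)=(-1)^{|a|}a$ for homogeneous $a\in R$, and let ${}^-:R\to R$ be a superinvolution, i.e. an even $\Bbbk$-linear map with $\overline{ab}=(-1)^{|a||b|}\bar b\,\bar a$ for homogeneous $a,b$ and $\bar{\bar a}=a$. Grade the algebra $\mathrm{M}_{m|m}(R)$ of $2m\times 2m$ matrices over $R$ by $|e_{ij}(a)|=|i|+|j|+|a|$,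 where $e_{ij}(a)$ is the matrix with $(i,j)$-entry $a$ and other entries $0$, and $|i|=0$ for $i\leqslant m$, $|i|=1$ for $i>m$. Put $$\begin{pmatrix}A&B\\C&D\end{pmatrix}^{\mathrm{prp}}=\begin{pmatrix}\overline{D}^{\,t}&-\overline{\rho(B)}^{\,t}\\ \overline{\rho(C)}^{\,t}&\overline{A}^{\,t}\end{pmatrix},\qquad \widetilde{\mathfrak{p}}_m(R,{}^-)=\{X\in \mathrm{M}_{m|m}(R)\mid X^{\mathrm{prp}}=-X\},$$ a Lie superalgebra under the super-commutator, and let $\mathfrak{p}_m(R,{}^-)=[\widetilde{\mathfrak{p}}_m(R,{}^-),\widetilde{\mathfrak{p}}_m(R,{}^-)]$. For $a\in R$ and $1\leqslant i\neq j\leqslant m$ put $$t_{ij}(a)=e_{ij}(a)-e_{m+j,m+i}(\bar a),\quad f_{ij}(a)=e_{i,m+j}(a)+e_{j,m+i}(\rho(\bar a)),\quad g_{ij}(a)=e_{m+i,j}(a)-e_{m+j,i}(\rho(\bar a)).$$ Let $\mathfrak{stp}_m(R,{}^-)$ be the Lie superalgebra over $\Bbbk$ generated by homogeneous elements $\mathbf{t}_{ij}(a),\mathbf{f}_{ij}(a),\mathbf{g}_{ij}(a)$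 of parities $|a|,|a|+1,|a|+1$, for homogeneous $a\in R$ and $1\leqslant i\neq j\leqslant m$, subject to the following relations for $a,b\in R$ and $1\leqslant i,j,k,l\leqslant m$: - $\mathbf{t}_{ij},\mathbf{f}_{ij},\mathbf{g}_{ij}$ are $\Bbbk$-linear, $\mathbf{f}_{ij}(\bar a)=\mathbf{f}_{ji}(\rho(a))$ and $\mathbf{g}_{ij}(\bar a)=-\mathbf{g}_{ji}(\rho(a))$ for $i\neq j$; - $[\mathbf{t}_{ij}(a),\mathbf{t}_{jk}(b)]=\mathbf{t}_{ik}(ab)$, $[\mathbf{t}_{ij}(a),\mathbf{f}_{jk}(b)]=\mathbf{f}_{ik}(ab)$, $[\mathbf{g}_{ij}(a),\mathbf{t}_{jk}(b)]=\mathbf{g}_{ik}(ab)$ and $[\mathbf{f}_{ij}(a),\mathbf{g}_{jk}(b)]=\mathbf{t}_{ik}(ab)$ for distinct $i,j,k$; - $[\mathbf{t}_{ij}(a),\mathbf{t}_{kl}(b)]=0$ for $i\neq j\neq k\neq l\neq i$; - $[\mathbf{t}_{ij}(a),\mathbf{f}_{kl}(b)]=0$ for $i\neq j\neq k\neq l\neq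 j$; - $[\mathbf{g}_{ij}(a),\mathbf{t}_{kl}(b)]=0$ for $l\neq k\neq j\neq i\neq k$; - $[\mathbf{f}_{ij}(a),\mathbf{f}_{kl}(b)]=0$ and $[\mathbf{g}_{ij}(a),\mathbf{g}_{kl}(b)]=0$ for $i\neq j$ and $k\neq l$; - $[\mathbf{f}_{ij}(a),\mathbf{g}_{kl}(b)]=0$ for distinct $i,j,k,l$. Suppose $m\geqslant 5$. Then there is a unique homomorphism of Lie superalgebras $\psi:\mathfrak{stp}_m(R,{}^-)\to\mathfrak{p}_m(R,{}^-)$ with $\psi(\mathbf{t}_{ij}(a))=t_{ij}(a)$, $\psi(\mathbf{f}_{ij}(a))=f_{ij}(a)$ and $\psi(\mathbf{g}_{ij}(a))=g_{ij}(a)$ for all $i\neq j$ and homogeneous $a\in R$, and $\psi$ is a universal central extension of $\mathfrak{p}_m(R,{}^-)$. -/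

import Mathlib

universe u v w

/-! ### Lie superalgebras -/

/-- A Lie superalgebra over a commutative ring `k`: a `k`-module with a direct sum decomposition
`L = L₀ ⊕ L₁` and an even `k`-bilinear bracket that is super-antisymmetric and satisfies the
super-Jacobi identity. -/
class LieSuperalgebra (k : Type u) (L : Type v) [CommRing k] [AddCommGroup L] [Module k L] where
  /-- the homogeneous parts -/
  grade : ZMod 2 → Submodule k L
  isCompl_grade : IsCompl (grade 0) (grade 1)
  /-- the super-bracket -/
  bracket : L →ₗ[k] L →ₗ[k] L
  bracket_mem : ∀ {d e : ZMod 2} {x y : L}, x ∈ grade d → y ∈ grade e →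
    bracket x y ∈ grade (d + e)
  bracket_skew : ∀ {d e : ZMod 2} {x y : L}, x ∈ grade d → y ∈ grade e →
    bracket x y = -((-1 : ℤˣ) ^ (d * e) • bracket y x)
  jacobi : ∀ {d e f : ZMod 2} {x y z : L}, x ∈ grade d → y ∈ grade e → z ∈ grade f →
    bracket x (bracket y z) =
      bracket (bracket x y) z + (-1 : ℤˣ) ^ (d * e) • bracket y (bracket x z)

namespace LieSuperalgebra

/-- A homomorphism of Lie superalgebras: an even linear map preserving the brackets. -/
structure Hom (k : Type u) (L : Type v) (L' : Type w) [CommRing k]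
    [AddCommGroup L] [Module k L] [LieSuperalgebra k L]
    [AddCommGroup L'] [Module k L'] [LieSuperalgebra k L'] extends L →ₗ[k] L' where
  map_grade : ∀ (d : ZMod 2) (x : L), x ∈ grade (k := k) d → toFun x ∈ grade (k := k) d
  map_bracket : ∀ x y : L, toFun (bracket (k := k) x y) = bracket (k := k) (toFun x) (toFun y)

instance {k : Type u} {L : Type v} {L' : Type w} [CommRing k]
    [AddCommGroup L] [Module k L] [LieSuperalgebra k L]
    [AddCommGroup L'] [Module k L'] [LieSuperalgebra k L'] : FunLike (Hom k L L') L L' where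
  coe φ := φ.toFun
  coe_injective φ φ' h := by
    cases φ; cases φ'; congr; exact DFunLike.coe_injective h

/-- A central extension of `L`: a surjective homomorphism onto `L` whose kernel lies in the
centre. -/
structure IsCentralExtension {k : Type u} {E : Type v} {L : Type w} [CommRing k]
    [AddCommGroup E] [Module k E] [LieSuperalgebra k E]
    [AddCommGroup L] [Module k L] [LieSuperalgebra k L] (φ : Hom k E L) : Prop where
  surjective : Function.Surjective φ
  central : ∀ x : E, φ x = 0 → ∀ y : E, bracket (k := k) x y = 0

/-- A central extension `ψ : E → L` is universal if for every central extension `φ : E' → L` there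
is a unique homomorphism `θ : E → E'` with `φ ∘ θ = ψ`. -/
structure IsUniversalCentralExtension.{w', u', v₁, v₂} {k : Type u'} {E : Type v₁} {L : Type v₂}
    [CommRing k] [AddCommGroup E] [Module k E] [LieSuperalgebra k E]
    [AddCommGroup L] [Module k L] [LieSuperalgebra k L] (ψ : Hom k E L) : Prop where
  isCentralExtension : IsCentralExtension ψ
  existsUnique_lift : ∀ (E' : Type w') [AddCommGroup E'] [Module k E'] [LieSuperalgebra k E']
    (φ : Hom k E' L), IsCentralExtension φ → ∃! θ : Hom k E E', ∀ x : E, φ (θ x) = ψ x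

section Sub

variable {k : Type u} {L : Type v} [CommRing k] [AddCommGroup L] [Module k L] [LieSuperalgebra k L]

/-- Every element is the sum of its homogeneous components. -/
theorem exists_add (x : L) :
    ∃ x₀ ∈ grade (k := k) (L := L) 0, ∃ x₁ ∈ grade (k := k) (L := L) 1, x₀ + x₁ = x :=
  Submodule.mem_sup.1 ((isCompl_grade (k := k) (L := L)).sup_eq_top ▸ Submodule.mem_top)

variable (k L) in
/-- A Lie sub-superalgebra: a graded submodule that is closed under the bracket. -/
structure Sub extends Submodule k L where
  graded : ∀ x ∈ toSubmodule, ∃ x₀ ∈ toSubmodule, ∃ x₁ ∈ toSubmodule,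
    x₀ ∈ grade (k := k) (L := L) 0 ∧ x₁ ∈ grade (k := k) (L := L) 1 ∧ x₀ + x₁ = x
  bracket_mem' : ∀ x ∈ toSubmodule, ∀ y ∈ toSubmodule, bracket (k := k) x y ∈ toSubmodule

/-- A Lie sub-superalgebra is a Lie superalgebra. -/
noncomputable instance (S : Sub k L) : LieSuperalgebra k S.toSubmodule where
  grade d := (grade (k := k) d).comap S.toSubmodule.subtype
  isCompl_grade := by
    constructor
    · rw [Submodule.disjoint_def]
      intro x h0 h1
      exact Subtype.ext (Submodule.disjoint_def.1 (isCompl_grade (k := k) (L := L)).disjoint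
        _ h0 h1)
    · rw [codisjoint_iff, eq_top_iff]
      rintro ⟨x, hx⟩ -
      obtain ⟨x₀, h0, x₁, h1, g0, g1, rfl⟩ := S.graded x hx
      exact Submodule.mem_sup.2 ⟨⟨x₀, h0⟩, g0, ⟨x₁, h1⟩, g1, rfl⟩
  bracket := LinearMap.mk₂ k
    (fun x y => ⟨bracket (k := k) (x : L) (y : L), S.bracket_mem' _ x.2 _ y.2⟩)
    (fun _ _ _ => Subtype.ext (by simp)) (fun _ _ _ => Subtype.ext (by simp))
    (fun _ _ _ => Subtype.ext (by simp)) (fun _ _ _ => Subtype.ext (by simp))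
  bracket_mem hx hy := bracket_mem (k := k) (L := L) hx hy
  bracket_skew hx hy := Subtype.ext (by
    simpa [Units.smul_def] using bracket_skew (k := k) (L := L) hx hy)
  jacobi hx hy hz := Subtype.ext (by
    simpa [Units.smul_def] using jacobi (k := k) (L := L) hx hy hz)

/-- The derived sub-superalgebra `[S, S]`: the span of all brackets of elements of `S`. -/
def Sub.derived (S : Sub k L) : Sub k L where
  toSubmodule := Submodule.span k {z | ∃ x ∈ S.toSubmodule, ∃ y ∈ S.toSubmodule,
    bracket (k := k) x y = z}
  graded := by
    intro z hz
    induction hz using Submodule.span_induction with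
    | mem z hz =>
      obtain ⟨x, hx, y, hy, rfl⟩ := hz
      obtain ⟨x₀, hx0, x₁, hx1, gx0, gx1, rfl⟩ := S.graded x hx
      obtain ⟨y₀, hy0, y₁, hy1, gy0, gy1, rfl⟩ := S.graded y hy
      refine ⟨_, add_mem (Submodule.subset_span ⟨x₀, hx0, y₀, hy0, rfl⟩)
        (Submodule.subset_span ⟨x₁, hx1, y₁, hy1, rfl⟩), _,
        add_mem (Submodule.subset_span ⟨x₀, hx0, y₁, hy1, rfl⟩)
        (Submodule.subset_span ⟨x₁, hx1, y₀, hy0, rfl⟩), ?_, ?_, ?_⟩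
      · exact add_mem (bracket_mem (k := k) gx0 gy0) (bracket_mem (k := k) gx1 gy1)
      · exact add_mem (bracket_mem (k := k) gx0 gy1) (bracket_mem (k := k) gx1 gy0)
      · simp only [map_add, LinearMap.add_apply]; abel
    | zero => exact ⟨0, zero_mem _, 0, zero_mem _, zero_mem _, zero_mem _, add_zero 0⟩
    | add x y _ _ hx hy =>
      obtain ⟨x₀, hx0, x₁, hx1, gx0, gx1, rfl⟩ := hx
      obtain ⟨y₀, hy0, y₁, hy1, gy0, gy1, rfl⟩ := hy
      exact ⟨_, Submodule.add_mem _ hx0 hy0, _, Submodule.add_mem _ hx1 hy1, add_mem gx0 gy0,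
        add_mem gx1 gy1, by abel⟩
    | smul c x _ hx =>
      obtain ⟨x₀, hx0, x₁, hx1, gx0, gx1, rfl⟩ := hx
      exact ⟨_, Submodule.smul_mem _ c hx0, _, Submodule.smul_mem _ c hx1,
        Submodule.smul_mem _ c gx0, Submodule.smul_mem _ c gx1, by simp⟩
  bracket_mem' := by
    have key : ∀ z ∈ Submodule.span k {z | ∃ x ∈ S.toSubmodule, ∃ y ∈ S.toSubmodule,
        bracket (k := k) x y = z}, z ∈ S.toSubmodule := fun z hz => by
      refine (Submodule.span_le (p := S.toSubmodule)).2 ?_ hz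
      rintro _ ⟨x, hx, y, hy, rfl⟩
      exact S.bracket_mem' x hx y hy
    intro x hx y hy
    exact Submodule.subset_span ⟨x, key x hx, y, key y hy, rfl⟩

end Sub

end LieSuperalgebra

/-! ### The Lie superalgebra of an associative superalgebra -/

section Superalgebra

variable {k : Type u} {A : Type v} [CommRing k] [Ring A] [Algebra k A]
  (ℬ : ZMod 2 → Submodule k A) [GradedAlgebra ℬ]

/-- The `k`-linear sign map `ρ(a) = (-1)^{|a|} a`. -/
noncomputable def parityMap : A →ₗ[k] A :=
  ∑ d : ZMod 2, (-1 : ℤˣ) ^ d • GradedAlgebra.proj ℬ d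

/-- The super-commutator `[a, b] = a b - (-1)^{|a||b|} b a`, extended bilinearly from homogeneous
elements. -/
noncomputable def superCommutator : A →ₗ[k] A →ₗ[k] A :=
  ∑ d : ZMod 2, ∑ e : ZMod 2,
    ((LinearMap.mul k A).compl₁₂ (GradedAlgebra.proj ℬ d) (GradedAlgebra.proj ℬ e) -
      (-1 : ℤˣ) ^ (d * e) •
        (LinearMap.mul k A).flip.compl₁₂ (GradedAlgebra.proj ℬ d) (GradedAlgebra.proj ℬ e))

theorem proj_of_mem {d : ZMod 2} {a : A} (ha : a ∈ ℬ d) (e : ZMod 2) :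
    GradedAlgebra.proj ℬ e a = if e = d then a else 0 := by
  split_ifs with h
  · subst h; simpa using DirectSum.decompose_of_mem_same ℬ ha
  · simpa using DirectSum.decompose_of_mem_ne ℬ ha (Ne.symm h)

theorem parityMap_of_mem {d : ZMod 2} {a : A} (ha : a ∈ ℬ d) :
    parityMap ℬ a = (-1 : ℤˣ) ^ d • a := by
  simp only [parityMap, LinearMap.sum_apply, LinearMap.smul_apply, proj_of_mem ℬ ha]
  simp

theorem superCommutator_of_mem {d e : ZMod 2} {a b : A} (ha : a ∈ ℬ d) (hb : b ∈ ℬ e) :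
    superCommutator ℬ a b = a * b - (-1 : ℤˣ) ^ (d * e) • (b * a) := by
  simp only [superCommutator, LinearMap.sum_apply, LinearMap.sub_apply, LinearMap.smul_apply,
    LinearMap.compl₁₂_apply, LinearMap.flip_apply, LinearMap.mul_apply', proj_of_mem ℬ ha,
    proj_of_mem ℬ hb]
  simp

theorem isCompl_of_gradedAlgebra : IsCompl (ℬ 0) (ℬ 1) :=
  (DirectSum.Decomposition.isInternal ℬ).isCompl (by decide)
    (by ext d; revert d; simp; decide)

/-- An associative superalgebra is a Lie superalgebra under the super-commutator. -/
@[reducible] noncomputable def LieSuperalgebra.ofGradedAlgebra : LieSuperalgebra k A where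
  grade := ℬ
  isCompl_grade := isCompl_of_gradedAlgebra ℬ
  bracket := superCommutator ℬ
  bracket_mem {d e x y} hx hy := by
    rw [superCommutator_of_mem ℬ hx hy]
    refine sub_mem (SetLike.mul_mem_graded hx hy) ?_
    rw [Units.smul_def]
    exact zsmul_mem (add_comm d e ▸ SetLike.mul_mem_graded hy hx) _
  bracket_skew {d e x y} hx hy := by
    rw [superCommutator_of_mem ℬ hx hy, superCommutator_of_mem ℬ hy hx, mul_comm e d]
    rcases Int.units_eq_one_or ((-1 : ℤˣ) ^ (d * e)) with h | h <;> rw [h] <;> simp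
  jacobi {d e f x y z} hx hy hz := by
    have aux : ∀ {d e : ZMod 2} {x y : A}, x ∈ ℬ d → y ∈ ℬ e →
        superCommutator ℬ x y ∈ ℬ (d + e) := fun {d e x y} hx hy => by
      rw [superCommutator_of_mem ℬ hx hy]
      refine sub_mem (SetLike.mul_mem_graded hx hy) ?_
      rw [Units.smul_def]
      exact zsmul_mem (add_comm d e ▸ SetLike.mul_mem_graded hy hx) _
    rw [superCommutator_of_mem ℬ hx (aux hy hz), superCommutator_of_mem ℬ (aux hx hy) hz,
      superCommutator_of_mem ℬ hy (aux hx hz), superCommutator_of_mem ℬ hx hy,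
      superCommutator_of_mem ℬ hy hz, superCommutator_of_mem ℬ hx hz]
    rw [mul_add, add_mul, mul_add, mul_comm e d, uzpow_add, uzpow_add, uzpow_add]
    rcases Int.units_eq_one_or ((-1 : ℤˣ) ^ (d * e)) with h | h <;>
    rcases Int.units_eq_one_or ((-1 : ℤˣ) ^ (d * f)) with h' | h' <;>
    rcases Int.units_eq_one_or ((-1 : ℤˣ) ^ (e * f)) with h'' | h'' <;>
    simp only [h, h', h'', one_smul, mul_one, Units.neg_smul, mul_neg] <;>
    noncomm_ring

end Superalgebra

/-! ### The matrix superalgebra `M_{m|m}(R)` -/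

section Matrix

variable {k : Type u} {R : Type v} [CommRing k] [Ring R] [Algebra k R]

/-- The parity `|i|` of a row or column index of a `2m × 2m` matrix: the first `m` indices are
even, the last `m` are odd. -/
def indexParity {m : ℕ} : Fin m ⊕ Fin m → ZMod 2 := Sum.elim (fun _ => 0) (fun _ => 1)

/-- The algebra of `2m × 2m` matrices over the superalgebra `R` with grading `𝒜`. -/
@[nolint unusedArguments]
def SuperMatrix (_𝒜 : ZMod 2 → Submodule k R) (m : ℕ) : Type v :=
  Matrix (Fin m ⊕ Fin m) (Fin m ⊕ Fin m) R

variable (𝒜 : ZMod 2 → Submodule k R) (m : ℕ)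

instance : Ring (SuperMatrix 𝒜 m) :=
  inferInstanceAs (Ring (Matrix (Fin m ⊕ Fin m) (Fin m ⊕ Fin m) R))

instance : Algebra k (SuperMatrix 𝒜 m) :=
  inferInstanceAs (Algebra k (Matrix (Fin m ⊕ Fin m) (Fin m ⊕ Fin m) R))

/-- A matrix is homogeneous of degree `d` if its `(i,j)`-entry is homogeneous of degree
`|i| + |j| + d`; thus `|e_{ij}(a)| = |i| + |j| + |a|`. -/
def SuperMatrix.grade (d : ZMod 2) : Submodule k (SuperMatrix 𝒜 m) where
  carrier := {X | ∀ i j, X i j ∈ 𝒜 (indexParity i + indexParity j + d)}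
  zero_mem' _ _ := zero_mem _
  add_mem' hX hY i j := add_mem (hX i j) (hY i j)
  smul_mem' c _ hX i j := Submodule.smul_mem _ c (hX i j)

variable [GradedAlgebra 𝒜]

instance : SetLike.GradedMonoid (SuperMatrix.grade 𝒜 m) where
  one_mem i j := by
    change (1 : Matrix (Fin m ⊕ Fin m) (Fin m ⊕ Fin m) R) i j ∈ _
    by_cases h : i = j
    · subst h
      rw [Matrix.one_apply_eq, CharTwo.add_self_eq_zero, add_zero]
      exact SetLike.one_mem_graded 𝒜
    · rw [Matrix.one_apply_ne h]; exact zero_mem _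
  mul_mem d e X Y hX hY i j := by
    change ∑ l, X i l * Y l j ∈ _
    refine sum_mem fun l _ => ?_
    have := SetLike.mul_mem_graded (hX i l) (hY l j)
    convert this using 2
    have h2 := CharTwo.add_self_eq_zero (indexParity l)
    linear_combination -h2

theorem SuperMatrix.isCompl_grade :
    IsCompl (SuperMatrix.grade 𝒜 m 0) (SuperMatrix.grade 𝒜 m 1) := by
  have hc := isCompl_of_gradedAlgebra 𝒜
  have hp : ∀ p : ZMod 2, IsCompl (𝒜 (p + 0)) (𝒜 (p + 1)) := by
    intro p
    obtain rfl | rfl : p = 0 ∨ p = 1 := by revert p; decide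
    · exact hc
    · exact hc.symm
  constructor
  · rw [Submodule.disjoint_def]
    intro X h0 h1
    funext i j
    exact Submodule.disjoint_def.1 (hp _).disjoint (X i j) (h0 i j) (h1 i j)
  · rw [codisjoint_iff, eq_top_iff]
    intro X _
    have : ∀ i j, ∃ y ∈ 𝒜 (indexParity i + indexParity j + 0),
        ∃ z ∈ 𝒜 (indexParity i + indexParity j + 1), y + z = X i j := fun i j =>
      Submodule.mem_sup.1 ((hp (indexParity i + indexParity j)).sup_eq_top ▸ Submodule.mem_top)
    choose Y hY Z hZ h using this
    exact Submodule.mem_sup.2 ⟨Y, hY, Z, hZ, funext fun i => funext fun j => h i j⟩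

/-- With this grading `M_{m|m}(R)` is an associative superalgebra. -/
noncomputable instance : GradedAlgebra (SuperMatrix.grade 𝒜 m) where
  toDecomposition := DirectSum.IsInternal.chooseDecomposition _
    ((DirectSum.isInternal_submodule_iff_isCompl _ (i := 0) (j := 1) (by decide)
      (by ext d; revert d; simp; decide)).2 (SuperMatrix.isCompl_grade 𝒜 m))

noncomputable instance : LieSuperalgebra k (SuperMatrix 𝒜 m) :=
  LieSuperalgebra.ofGradedAlgebra (SuperMatrix.grade 𝒜 m)

end Matrix

/-! ### The generalized periplectic Lie superalgebra -/

section Periplectic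

variable {k : Type u} {R : Type v} [CommRing k] [Ring R] [Algebra k R]

/-- A superinvolution on a superalgebra: an even `k`-linear map `a ↦ ā` with `ā̄ = a` and
`\overline{ab} = (-1)^{|a||b|} b̄ ā` for homogeneous `a`, `b`. -/
structure Superinvolution (𝒜 : ZMod 2 → Submodule k R) extends R →ₗ[k] R where
  map_mem : ∀ {d : ZMod 2} {a : R}, a ∈ 𝒜 d → toFun a ∈ 𝒜 d
  map_mul : ∀ {d e : ZMod 2} {a b : R}, a ∈ 𝒜 d → b ∈ 𝒜 e →
    toFun (a * b) = (-1 : ℤˣ) ^ (d * e) • (toFun b * toFun a)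
  involutive : ∀ a : R, toFun (toFun a) = a

variable {𝒜 : ZMod 2 → Submodule k R} [GradedAlgebra 𝒜]

/-- The periplectic superinvolution on `M_{m|m}(R)`, which sends the block matrix `(A, B; C, D)`
to `(D̄ᵗ, -ρ(B)̄ᵗ; ρ(C)̄ᵗ, Āᵗ)`. -/
noncomputable def prp (σ : Superinvolution 𝒜) (m : ℕ) :
    SuperMatrix 𝒜 m →ₗ[k] SuperMatrix 𝒜 m where
  toFun X :=
    let X' : Matrix (Fin m ⊕ Fin m) (Fin m ⊕ Fin m) R := X
    Matrix.fromBlocks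
      (X'.toBlocks₂₂.map σ.toLinearMap).transpose
      (-((X'.toBlocks₁₂.map (parityMap 𝒜)).map σ.toLinearMap).transpose)
      ((X'.toBlocks₂₁.map (parityMap 𝒜)).map σ.toLinearMap).transpose
      (X'.toBlocks₁₁.map σ.toLinearMap).transpose
  map_add' X Y := by
    funext i j
    rcases i with i | i <;> rcases j with j | j
    · exact map_add σ.toLinearMap _ _
    · exact (congrArg Neg.neg (map_add (σ.toLinearMap ∘ₗ parityMap 𝒜) _ _)).trans (neg_add _ _)
    · exact map_add (σ.toLinearMap ∘ₗ parityMap 𝒜) _ _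
    · exact map_add σ.toLinearMap _ _
  map_smul' c X := by
    funext i j
    rcases i with i | i <;> rcases j with j | j
    · exact map_smul σ.toLinearMap _ _
    · exact (congrArg Neg.neg (map_smul (σ.toLinearMap ∘ₗ parityMap 𝒜) _ _)).trans
        (smul_neg _ _).symm
    · exact map_smul (σ.toLinearMap ∘ₗ parityMap 𝒜) _ _
    · exact map_smul σ.toLinearMap _ _

theorem prp_apply_of_mem (σ : Superinvolution 𝒜) (m : ℕ) {d : ZMod 2} {X : SuperMatrix 𝒜 m}
    (hX : X ∈ SuperMatrix.grade 𝒜 m d) (i j : Fin m ⊕ Fin m) :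
    prp σ m X i j =
      (-1 : ℤˣ) ^ ((indexParity i + indexParity j) * d + indexParity i * (indexParity j + 1)) •
        σ.toLinearMap (X j.swap i.swap) := by
  rcases i with i | i <;> rcases j with j | j
  · have h : prp σ m X (.inl i) (.inl j) = σ.toLinearMap (X (.inr j) (.inr i)) := rfl
    rw [h]
    simp [indexParity]
  · have h : prp σ m X (.inl i) (.inr j) =
      -σ.toLinearMap (parityMap 𝒜 (X (.inl j) (.inr i))) := rfl
    rw [h, parityMap_of_mem 𝒜 (hX _ _)]
    obtain rfl | rfl : d = 0 ∨ d = 1 := by clear hX h; revert d; decide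
    · simp [indexParity]
    · simp [indexParity, CharTwo.add_self_eq_zero]
  · have h : prp σ m X (.inr i) (.inl j) =
      σ.toLinearMap (parityMap 𝒜 (X (.inr j) (.inl i))) := rfl
    rw [h, parityMap_of_mem 𝒜 (hX _ _)]
    obtain rfl | rfl : d = 0 ∨ d = 1 := by clear hX h; revert d; decide
    · simp [indexParity]
    · simp [indexParity, CharTwo.add_self_eq_zero]
  · have h : prp σ m X (.inr i) (.inr j) = σ.toLinearMap (X (.inl j) (.inl i)) := rfl
    rw [h]
    simp [indexParity, CharTwo.add_self_eq_zero]

theorem indexParity_swap {m : ℕ} (i : Fin m ⊕ Fin m) : indexParity i.swap = indexParity i + 1 := by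
  rcases i with i | i
  · simp [indexParity]
  · simp [indexParity, CharTwo.add_self_eq_zero]

theorem prp_mem (σ : Superinvolution 𝒜) (m : ℕ) {d : ZMod 2} {X : SuperMatrix 𝒜 m}
    (hX : X ∈ SuperMatrix.grade 𝒜 m d) : prp σ m X ∈ SuperMatrix.grade 𝒜 m d := by
  intro i j
  rw [prp_apply_of_mem σ m hX, Units.smul_def]
  refine zsmul_mem (σ.map_mem ?_) _
  convert hX j.swap i.swap using 2
  rw [indexParity_swap, indexParity_swap]
  linear_combination -CharTwo.add_self_eq_zero (1 : ZMod 2)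

theorem prp_mul (σ : Superinvolution 𝒜) (m : ℕ) {d e : ZMod 2} {X Y : SuperMatrix 𝒜 m}
    (hX : X ∈ SuperMatrix.grade 𝒜 m d) (hY : Y ∈ SuperMatrix.grade 𝒜 m e) :
    prp σ m (X * Y) = (-1 : ℤˣ) ^ (d * e) • (prp σ m Y * prp σ m X) := by
  funext i j
  rw [prp_apply_of_mem σ m (SetLike.mul_mem_graded hX hY)]
  have h1 : (X * Y) j.swap i.swap = ∑ l, X j.swap l * Y l i.swap := rfl
  have h2 : ((-1 : ℤˣ) ^ (d * e) • (prp σ m Y * prp σ m X)) i j =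
    (-1 : ℤˣ) ^ (d * e) • ∑ l, prp σ m Y i l * prp σ m X l j := rfl
  rw [h1, h2, map_sum, ← Equiv.sum_comp (Equiv.sumComm (Fin m) (Fin m)), Finset.smul_sum,
    Finset.smul_sum]
  refine Finset.sum_congr rfl fun l _ => ?_
  have h3 := σ.map_mul (hX j.swap l.swap) (hY l.swap i.swap)
  rw [prp_apply_of_mem σ m hX, prp_apply_of_mem σ m hY, Equiv.sumComm_apply]
  refine (congrArg _ h3).trans ?_
  rw [smul_mul_smul_comm, smul_smul, smul_smul, ← uzpow_add, ← uzpow_add, ← uzpow_add]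
  congr 2
  simp only [indexParity_swap]
  generalize indexParity i = p
  generalize indexParity j = q
  generalize indexParity l = r
  clear h1 h2 h3 hX hY
  revert p q r d e
  decide

theorem prp_graded (σ : Superinvolution 𝒜) (m : ℕ) {X : SuperMatrix 𝒜 m}
    (hX : prp σ m X = -X) : ∃ Y, prp σ m Y = -Y ∧ ∃ Z, prp σ m Z = -Z ∧
      Y ∈ SuperMatrix.grade 𝒜 m 0 ∧ Z ∈ SuperMatrix.grade 𝒜 m 1 ∧ Y + Z = X := by
  obtain ⟨Y, hY, Z, hZ, rfl⟩ := LieSuperalgebra.exists_add (k := k) X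
  have h' : (prp σ m Y + Y) + (prp σ m Z + Z) = 0 := by
    rw [map_add] at hX
    calc _ = (prp σ m Y + prp σ m Z) + (Y + Z) := by abel
      _ = 0 := by rw [hX]; abel
  have hYm : prp σ m Y + Y ∈ SuperMatrix.grade 𝒜 m 0 := add_mem (prp_mem σ m hY) hY
  have hZm : prp σ m Z + Z ∈ SuperMatrix.grade 𝒜 m 1 := add_mem (prp_mem σ m hZ) hZ
  have hY0 : prp σ m Y + Y = 0 := by
    refine Submodule.disjoint_def.1 (SuperMatrix.isCompl_grade 𝒜 m).disjoint _ hYm ?_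
    rw [eq_neg_of_add_eq_zero_left h']
    exact neg_mem hZm
  have hZ0 : prp σ m Z + Z = 0 := by rwa [hY0, zero_add] at h'
  exact ⟨Y, eq_neg_of_add_eq_zero_left hY0, Z, eq_neg_of_add_eq_zero_left hZ0, hY, hZ, rfl⟩

theorem prp_superCommutator_of_mem (σ : Superinvolution 𝒜) (m : ℕ) {d e : ZMod 2}
    {X Y : SuperMatrix 𝒜 m} (hX : prp σ m X = -X) (hY : prp σ m Y = -Y)
    (gX : X ∈ SuperMatrix.grade 𝒜 m d) (gY : Y ∈ SuperMatrix.grade 𝒜 m e) :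
    prp σ m (superCommutator (SuperMatrix.grade 𝒜 m) X Y) =
      -superCommutator (SuperMatrix.grade 𝒜 m) X Y := by
  rw [superCommutator_of_mem _ gX gY, map_sub, Units.smul_def, map_zsmul, ← Units.smul_def,
    prp_mul σ m gX gY, prp_mul σ m gY gX, hX, hY, mul_comm e d]
  rcases Int.units_eq_one_or ((-1 : ℤˣ) ^ (d * e)) with h | h <;> rw [h] <;> simp
  abel

/-- The Lie superalgebra `{X ∈ M_{m|m}(R) | X^prp = -X}`. -/
noncomputable def periplecticTilde (σ : Superinvolution 𝒜) (m : ℕ) :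
    LieSuperalgebra.Sub k (SuperMatrix 𝒜 m) where
  carrier := {X | prp σ m X = -X}
  zero_mem' := by simp
  add_mem' {X Y} hX hY := by
    rw [Set.mem_ofPred_eq] at *
    rw [map_add, hX, hY, neg_add]
  smul_mem' c X hX := by
    rw [Set.mem_ofPred_eq] at *
    rw [map_smul, hX, smul_neg]
  graded _ hX := prp_graded σ m hX
  bracket_mem' X hX Y hY := by
    obtain ⟨X₀, hX0, X₁, hX1, gX0, gX1, rfl⟩ := prp_graded σ m hX
    obtain ⟨Y₀, hY0, Y₁, hY1, gY0, gY1, rfl⟩ := prp_graded σ m hY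
    change prp σ m (superCommutator (SuperMatrix.grade 𝒜 m) (X₀ + X₁) (Y₀ + Y₁)) =
      -superCommutator (SuperMatrix.grade 𝒜 m) (X₀ + X₁) (Y₀ + Y₁)
    simp only [map_add, LinearMap.add_apply, neg_add,
      prp_superCommutator_of_mem σ m hX0 hY0 gX0 gY0,
      prp_superCommutator_of_mem σ m hX0 hY1 gX0 gY1,
      prp_superCommutator_of_mem σ m hX1 hY0 gX1 gY0,
      prp_superCommutator_of_mem σ m hX1 hY1 gX1 gY1]

/-- The generalized periplectic Lie superalgebra `𝔭_m(R, ⁻)`: the derived sub-superalgebra of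
`{X ∈ M_{m|m}(R) | X^prp = -X}`. -/
noncomputable def periplectic (σ : Superinvolution 𝒜) (m : ℕ) :
    LieSuperalgebra.Sub k (SuperMatrix 𝒜 m) :=
  (periplecticTilde σ m).derived

/-- The matrix `e_{ij}(a)`. -/
def matE (𝒜 : ZMod 2 → Submodule k R) {m : ℕ} (i j : Fin m ⊕ Fin m) (a : R) : SuperMatrix 𝒜 m :=
  Matrix.single i j a

/-- `t_{ij}(a) = e_{ij}(a) - e_{m+j,m+i}(ā)`. -/
def matT (σ : Superinvolution 𝒜) {m : ℕ} (i j : Fin m) (a : R) : SuperMatrix 𝒜 m :=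
  matE 𝒜 (.inl i) (.inl j) a - matE 𝒜 (.inr j) (.inr i) (σ.toLinearMap a)

/-- `f_{ij}(a) = e_{i,m+j}(a) + e_{j,m+i}(ρ(ā))`. -/
noncomputable def matF (σ : Superinvolution 𝒜) {m : ℕ} (i j : Fin m) (a : R) : SuperMatrix 𝒜 m :=
  matE 𝒜 (.inl i) (.inr j) a + matE 𝒜 (.inl j) (.inr i) (parityMap 𝒜 (σ.toLinearMap a))

/-- `g_{ij}(a) = e_{m+i,j}(a) - e_{m+j,i}(ρ(ā))`. -/
noncomputable def matG (σ : Superinvolution 𝒜) {m : ℕ} (i j : Fin m) (a : R) : SuperMatrix 𝒜 m :=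
  matE 𝒜 (.inr i) (.inl j) a - matE 𝒜 (.inr j) (.inl i) (parityMap 𝒜 (σ.toLinearMap a))

end Periplectic

/-! ### Lie superalgebras given by generators and relations -/

section Presentation

variable (k : Type u) {X : Type v} [CommRing k]

/-- The parity of a non-associative word in generators with parities `p`. -/
def wordParity (p : X → ZMod 2) : FreeMagma X → ZMod 2
  | .of x => p x
  | .mul v w => wordParity p v + wordParity p w

/-- The homogeneous parts of the free non-associative superalgebra on generators with
parities `p`. -/
def freeGrade (p : X → ZMod 2) (d : ZMod 2) :
    Submodule k (FreeNonUnitalNonAssocAlgebra k X) where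
  carrier := {x | ∀ w, wordParity p w ≠ d → x.coeff w = 0}
  zero_mem' _ _ := rfl
  add_mem' hx hy w hw := by
    rw [MonoidAlgebra.coeff_add, Finsupp.add_apply, hx w hw, hy w hw, add_zero]
  smul_mem' c x hx w hw := by
    rw [MonoidAlgebra.coeff_smul, Finsupp.smul_apply, hx w hw, smul_zero]

variable {k}

theorem of_mem_freeGrade (p : X → ZMod 2) (x : X) :
    FreeNonUnitalNonAssocAlgebra.of k x ∈ freeGrade k p (p x) := by
  classical
  intro w hw
  change (MonoidAlgebra.single (FreeMagma.of x) (1 : k)).coeff w = 0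
  rw [MonoidAlgebra.coeff_single, Finsupp.single_apply, if_neg]
  rintro rfl
  exact hw rfl

theorem mul_mem_freeGrade {p : X → ZMod 2} {d e : ZMod 2}
    {x y : FreeNonUnitalNonAssocAlgebra k X} (hx : x ∈ freeGrade k p d)
    (hy : y ∈ freeGrade k p e) : x * y ∈ freeGrade k p (d + e) := by
  classical
  intro w hw
  by_contra hne
  obtain ⟨v, hv, v', hv', rfl⟩ := Finset.mem_mul.1
    (MonoidAlgebra.support_coeff_mul_subset x y (Finsupp.mem_support_iff.2 hne))
  have h1 : wordParity p v = d := by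
    by_contra h; exact Finsupp.mem_support_iff.1 hv (hx v h)
  have h2 : wordParity p v' = e := by
    by_contra h; exact Finsupp.mem_support_iff.1 hv' (hy v' h)
  exact hw (congrArg₂ (· + ·) h1 h2)

theorem isCompl_freeGrade (p : X → ZMod 2) :
    IsCompl (freeGrade k p 0) (freeGrade k p 1) := by
  classical
  constructor
  · rw [Submodule.disjoint_def]
    intro x h0 h1
    refine MonoidAlgebra.coeff_injective (Finsupp.ext fun w => ?_)
    by_cases h : wordParity p w = 0
    · exact h1 w (by rw [h]; decide)
    · exact h0 w h
  · rw [codisjoint_iff, eq_top_iff]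
    intro x _
    refine Submodule.mem_sup.2 ⟨.ofCoeff (x.coeff.filter fun w => wordParity p w = 0),
      fun w hw => ?_, .ofCoeff (x.coeff.filter fun w => ¬ wordParity p w = 0), fun w hw => ?_, ?_⟩
    · exact Finsupp.filter_apply_neg _ _ hw
    · refine Finsupp.filter_apply_neg _ _ (not_not.2 ?_)
      generalize wordParity p w = d at hw
      revert d; decide
    · rw [← MonoidAlgebra.ofCoeff_add, Finsupp.filter_add_filter_not]

/-- The smallest two-sided ideal of the free non-associative superalgebra that contains the given
relators together with all instances of super-antisymmetry and of the super-Jacobi identity. -/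
inductive RelIdeal (p : X → ZMod 2) (rel : FreeNonUnitalNonAssocAlgebra k X → Prop) :
    FreeNonUnitalNonAssocAlgebra k X → Prop
  | rel {x} : rel x → RelIdeal p rel x
  | skew {d e : ZMod 2} {x y} : x ∈ freeGrade k p d → y ∈ freeGrade k p e →
      RelIdeal p rel (x * y + (-1 : ℤˣ) ^ (d * e) • (y * x))
  | jacobi {d e f : ZMod 2} {x y z} : x ∈ freeGrade k p d → y ∈ freeGrade k p e →
      z ∈ freeGrade k p f →
      RelIdeal p rel (x * (y * z) - ((x * y) * z + (-1 : ℤˣ) ^ (d * e) • (y * (x * z))))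
  | zero : RelIdeal p rel 0
  | add {x y} : RelIdeal p rel x → RelIdeal p rel y → RelIdeal p rel (x + y)
  | smul (c : k) {x} : RelIdeal p rel x → RelIdeal p rel (c • x)
  | mul_left (y) {x} : RelIdeal p rel x → RelIdeal p rel (y * x)
  | mul_right (y) {x} : RelIdeal p rel x → RelIdeal p rel (x * y)

/-- `RelIdeal` as a submodule. -/
def relSubmodule (p : X → ZMod 2) (rel : FreeNonUnitalNonAssocAlgebra k X → Prop) :
    Submodule k (FreeNonUnitalNonAssocAlgebra k X) where
  carrier := {x | RelIdeal p rel x}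
  zero_mem' := .zero
  add_mem' := .add
  smul_mem' c _ := .smul c

/-- Homogeneous relators. -/
def HomogeneousRel (p : X → ZMod 2) (rel : FreeNonUnitalNonAssocAlgebra k X → Prop) : Prop :=
  ∀ x, rel x → ∃ d, x ∈ freeGrade k p d

/-- The abstract Lie superalgebra with generators `X`, of parities `p`, and (homogeneous)
relators `rel`. -/
@[nolint unusedArguments]
def PresentedLieSuperalgebra (p : X → ZMod 2) (rel : FreeNonUnitalNonAssocAlgebra k X → Prop)
    (_h : HomogeneousRel p rel) : Type (max u v) :=
  FreeNonUnitalNonAssocAlgebra k X ⧸ relSubmodule p rel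

namespace PresentedLieSuperalgebra

variable (p : X → ZMod 2) (rel : FreeNonUnitalNonAssocAlgebra k X → Prop)
  (h : HomogeneousRel p rel)

noncomputable instance : AddCommGroup (PresentedLieSuperalgebra p rel h) :=
  inferInstanceAs (AddCommGroup (FreeNonUnitalNonAssocAlgebra k X ⧸ relSubmodule p rel))

noncomputable instance : Module k (PresentedLieSuperalgebra p rel h) :=
  inferInstanceAs (Module k (FreeNonUnitalNonAssocAlgebra k X ⧸ relSubmodule p rel))

/-- The quotient map from the free non-associative superalgebra. -/
noncomputable def mk : FreeNonUnitalNonAssocAlgebra k X →ₗ[k] PresentedLieSuperalgebra p rel h :=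
  (relSubmodule p rel).mkQ

/-- The generators. -/
noncomputable def gen (x : X) : PresentedLieSuperalgebra p rel h :=
  mk p rel h (FreeNonUnitalNonAssocAlgebra.of k x)

/-- The ideal of relations is graded. -/
theorem graded_relSubmodule (h : HomogeneousRel p rel) {x : FreeNonUnitalNonAssocAlgebra k X}
    (hx : RelIdeal p rel x) :
    ∃ x₀ ∈ relSubmodule p rel, ∃ x₁ ∈ relSubmodule p rel,
      x₀ ∈ freeGrade k p 0 ∧ x₁ ∈ freeGrade k p 1 ∧ x₀ + x₁ = x := by
  have hom : ∀ {d : ZMod 2} {x : FreeNonUnitalNonAssocAlgebra k X}, RelIdeal p rel x →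
      x ∈ freeGrade k p d → ∃ x₀ ∈ relSubmodule p rel, ∃ x₁ ∈ relSubmodule p rel,
      x₀ ∈ freeGrade k p 0 ∧ x₁ ∈ freeGrade k p 1 ∧ x₀ + x₁ = x := by
    intro d x hx hd
    obtain rfl | rfl : d = 0 ∨ d = 1 := by clear hd; revert d; decide
    · exact ⟨x, hx, 0, zero_mem _, hd, zero_mem _, add_zero x⟩
    · exact ⟨0, zero_mem _, x, hx, zero_mem _, hd, zero_add x⟩
  have sgn : ∀ {d : ZMod 2} {x : FreeNonUnitalNonAssocAlgebra k X} (u : ℤˣ),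
      x ∈ freeGrade k p d → u • x ∈ freeGrade k p d := fun u hx => by
    rw [Units.smul_def]; exact zsmul_mem hx _
  have split : ∀ y : FreeNonUnitalNonAssocAlgebra k X, ∃ y₀ ∈ freeGrade k p 0,
      ∃ y₁ ∈ freeGrade k p 1, y₀ + y₁ = y := fun y =>
    Submodule.mem_sup.1 ((isCompl_freeGrade (k := k) p).sup_eq_top ▸ Submodule.mem_top)
  induction hx with
  | rel hx => obtain ⟨d, hd⟩ := h _ hx; exact hom (.rel hx) hd
  | @skew d e x y hx hy =>
    exact hom (.skew hx hy) (add_mem (mul_mem_freeGrade hx hy)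
      (sgn _ (add_comm d e ▸ mul_mem_freeGrade hy hx)))
  | @jacobi d e f x y z hx hy hz =>
    refine hom (d := d + (e + f)) (.jacobi hx hy hz) (sub_mem
      (mul_mem_freeGrade hx (mul_mem_freeGrade hy hz)) (add_mem ?_ (sgn _ ?_)))
    · exact add_assoc d e f ▸ mul_mem_freeGrade (mul_mem_freeGrade hx hy) hz
    · exact add_left_comm d e f ▸ mul_mem_freeGrade hy (mul_mem_freeGrade hx hz)
  | zero => exact hom (d := 0) .zero (zero_mem _)
  | add _ _ hx hy =>
    obtain ⟨x₀, hx0, x₁, hx1, gx0, gx1, rfl⟩ := hx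
    obtain ⟨y₀, hy0, y₁, hy1, gy0, gy1, rfl⟩ := hy
    exact ⟨_, add_mem hx0 hy0, _, add_mem hx1 hy1, add_mem gx0 gy0, add_mem gx1 gy1, by abel⟩
  | smul c _ hx =>
    obtain ⟨x₀, hx0, x₁, hx1, gx0, gx1, rfl⟩ := hx
    exact ⟨_, Submodule.smul_mem _ c hx0, _, Submodule.smul_mem _ c hx1,
      Submodule.smul_mem _ c gx0, Submodule.smul_mem _ c gx1, (smul_add _ _ _).symm⟩
  | mul_left y _ hx =>
    obtain ⟨x₀, hx0, x₁, hx1, gx0, gx1, rfl⟩ := hx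
    obtain ⟨y₀, gy0, y₁, gy1, rfl⟩ := split y
    refine ⟨y₀ * x₀ + y₁ * x₁, RelIdeal.add (.mul_left _ hx0) (.mul_left _ hx1),
      y₀ * x₁ + y₁ * x₀, RelIdeal.add (.mul_left _ hx1) (.mul_left _ hx0),
      add_mem (mul_mem_freeGrade gy0 gx0) (mul_mem_freeGrade gy1 gx1),
      add_mem (mul_mem_freeGrade gy0 gx1) (mul_mem_freeGrade gy1 gx0), ?_⟩
    rw [add_mul, mul_add, mul_add]; abel
  | mul_right y _ hx =>
    obtain ⟨x₀, hx0, x₁, hx1, gx0, gx1, rfl⟩ := hx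
    obtain ⟨y₀, gy0, y₁, gy1, rfl⟩ := split y
    refine ⟨x₀ * y₀ + x₁ * y₁, RelIdeal.add (.mul_right _ hx0) (.mul_right _ hx1),
      x₀ * y₁ + x₁ * y₀, RelIdeal.add (.mul_right _ hx0) (.mul_right _ hx1),
      add_mem (mul_mem_freeGrade gx0 gy0) (mul_mem_freeGrade gx1 gy1),
      add_mem (mul_mem_freeGrade gx0 gy1) (mul_mem_freeGrade gx1 gy0), ?_⟩
    rw [add_mul, mul_add, mul_add]; abel

theorem mk_eq_mk {x y : FreeNonUnitalNonAssocAlgebra k X} :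
    mk p rel h x = mk p rel h y ↔ RelIdeal p rel (x - y) :=
  Submodule.Quotient.eq (relSubmodule p rel)

/-- Left multiplication by an element of the free superalgebra, on the quotient. -/
noncomputable def bracketAux (x : FreeNonUnitalNonAssocAlgebra k X) :
    PresentedLieSuperalgebra p rel h →ₗ[k] PresentedLieSuperalgebra p rel h :=
  (relSubmodule p rel).liftQ (mk p rel h ∘ₗ LinearMap.mul k _ x) fun y hy => by
    refine ((mk_eq_mk p rel h (x := x * y) (y := 0)).2 ?_).trans (map_zero _)
    rw [sub_zero]
    exact .mul_left x hy

theorem mk_surjective : Function.Surjective (mk p rel h) :=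
  Submodule.mkQ_surjective _

theorem bracketAux_mk (x y : FreeNonUnitalNonAssocAlgebra k X) :
    bracketAux p rel h x (mk p rel h y) = mk p rel h (x * y) := rfl

/-- The bracket, induced by the multiplication of the free superalgebra. -/
noncomputable def bracket : PresentedLieSuperalgebra p rel h →ₗ[k]
    PresentedLieSuperalgebra p rel h →ₗ[k] PresentedLieSuperalgebra p rel h :=
  (relSubmodule p rel).liftQ
    { toFun := bracketAux p rel h
      map_add' := fun x y => LinearMap.ext fun z => by
        obtain ⟨z, rfl⟩ := mk_surjective p rel h z
        simp only [LinearMap.add_apply, bracketAux_mk, add_mul, map_add]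
      map_smul' := fun c x => LinearMap.ext fun z => by
        obtain ⟨z, rfl⟩ := mk_surjective p rel h z
        simp only [LinearMap.smul_apply, bracketAux_mk, smul_mul_assoc, map_smul,
          RingHom.id_apply] }
    fun x hx => LinearMap.ext fun z => by
      obtain ⟨z, rfl⟩ := mk_surjective p rel h z
      refine ((mk_eq_mk p rel h (x := x * z) (y := 0)).2 ?_).trans (map_zero _)
      rw [sub_zero]
      exact .mul_right z hx

theorem bracket_mk (x y : FreeNonUnitalNonAssocAlgebra k X) :
    bracket p rel h (mk p rel h x) (mk p rel h y) = mk p rel h (x * y) := rfl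

noncomputable instance : LieSuperalgebra k (PresentedLieSuperalgebra p rel h) where
  grade d := (freeGrade k p d).map (mk p rel h)
  isCompl_grade := by
    constructor
    · rw [Submodule.disjoint_def]
      rintro _ ⟨x, hx, rfl⟩ ⟨y, hy, hxy⟩
      obtain ⟨z₀, hz0, z₁, hz1, gz0, gz1, hz⟩ :=
        graded_relSubmodule p rel h ((mk_eq_mk p rel h).1 hxy)
      have h1 : x + z₀ = y - z₁ := by
        rw [eq_sub_iff_add_eq, add_assoc, hz]; abel
      have h2 : x + z₀ = 0 := Submodule.disjoint_def.1 (isCompl_freeGrade p).disjoint _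
        (add_mem hx gz0) (h1 ▸ sub_mem hy gz1)
      have h3 : RelIdeal p rel (x - 0) := by
        rw [sub_zero, eq_neg_of_add_eq_zero_left h2]
        exact (relSubmodule p rel).neg_mem hz0
      exact ((mk_eq_mk p rel h).2 h3).trans (map_zero _)
    · rw [codisjoint_iff, ← Submodule.map_sup, (isCompl_freeGrade p).sup_eq_top,
        Submodule.map_top, LinearMap.range_eq_top]
      exact mk_surjective p rel h
  bracket := bracket p rel h
  bracket_mem := by
    rintro d e _ _ ⟨x, hx, rfl⟩ ⟨y, hy, rfl⟩
    exact ⟨x * y, mul_mem_freeGrade hx hy, rfl⟩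
  bracket_skew := by
    rintro d e _ _ ⟨x, hx, rfl⟩ ⟨y, hy, rfl⟩
    rw [bracket_mk, bracket_mk, Units.smul_def, ← map_zsmul, ← map_neg, mk_eq_mk, sub_neg_eq_add]
    exact .skew hx hy
  jacobi := by
    rintro d e f _ _ _ ⟨x, hx, rfl⟩ ⟨y, hy, rfl⟩ ⟨z, hz, rfl⟩
    simp only [bracket_mk]
    rw [Units.smul_def, ← map_zsmul, ← map_add, mk_eq_mk]
    exact .jacobi hx hy hz

end PresentedLieSuperalgebra

end Presentation

/-! ### The Steinberg periplectic Lie superalgebra -/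

section Steinberg

variable {k : Type u} {R : Type v} [CommRing k] [Ring R] [Algebra k R]

/-- The generators `𝐭_{ij}(a)`, `𝐟_{ij}(a)`, `𝐠_{ij}(a)` for `i ≠ j` and homogeneous `a ∈ R`. -/
inductive StpGen (𝒜 : ZMod 2 → Submodule k R) (m : ℕ) : Type v
  | t (i j : Fin m) (hij : i ≠ j) (d : ZMod 2) (a : 𝒜 d)
  | f (i j : Fin m) (hij : i ≠ j) (d : ZMod 2) (a : 𝒜 d)
  | g (i j : Fin m) (hij : i ≠ j) (d : ZMod 2) (a : 𝒜 d)

/-- The parities of `𝐭_{ij}(a)`, `𝐟_{ij}(a)`, `𝐠_{ij}(a)` are `|a|`, `|a| + 1`, `|a| + 1`. -/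
def StpGen.parity {𝒜 : ZMod 2 → Submodule k R} {m : ℕ} : StpGen 𝒜 m → ZMod 2
  | .t _ _ _ d _ => d
  | .f _ _ _ d _ => d + 1
  | .g _ _ _ d _ => d + 1

variable {𝒜 : ZMod 2 → Submodule k R} {m : ℕ}

/-- `𝐭_{ij}(a)` in the free superalgebra. -/
noncomputable def freeT {i j : Fin m} (hij : i ≠ j) {d : ZMod 2} (a : 𝒜 d) :
    FreeNonUnitalNonAssocAlgebra k (StpGen 𝒜 m) := .of k (.t i j hij d a)

/-- `𝐟_{ij}(a)` in the free superalgebra. -/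
noncomputable def freeF {i j : Fin m} (hij : i ≠ j) {d : ZMod 2} (a : 𝒜 d) :
    FreeNonUnitalNonAssocAlgebra k (StpGen 𝒜 m) := .of k (.f i j hij d a)

/-- `𝐠_{ij}(a)` in the free superalgebra. -/
noncomputable def freeG {i j : Fin m} (hij : i ≠ j) {d : ZMod 2} (a : 𝒜 d) :
    FreeNonUnitalNonAssocAlgebra k (StpGen 𝒜 m) := .of k (.g i j hij d a)

variable [GradedAlgebra 𝒜]

/-- The product of homogeneous elements. -/
def hMul {d e : ZMod 2} (a : 𝒜 d) (b : 𝒜 e) : 𝒜 (d + e) :=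
  ⟨a * b, SetLike.mul_mem_graded a.2 b.2⟩

/-- `ā` for homogeneous `a`. -/
def hBar (σ : Superinvolution 𝒜) {d : ZMod 2} (a : 𝒜 d) : 𝒜 d :=
  ⟨σ.toLinearMap a, σ.map_mem a.2⟩

/-- `ρ(a)` for homogeneous `a`. -/
noncomputable def hRho {d : ZMod 2} (a : 𝒜 d) : 𝒜 d :=
  ⟨parityMap 𝒜 a, by
    rw [parityMap_of_mem 𝒜 a.2, Units.smul_def]; exact zsmul_mem a.2 _⟩

/-- The defining relators of the Steinberg periplectic Lie superalgebra. -/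
inductive StpRel (σ : Superinvolution 𝒜) (m : ℕ) :
    FreeNonUnitalNonAssocAlgebra k (StpGen 𝒜 m) → Prop
  | t_add {i j : Fin m} (hij : i ≠ j) {d : ZMod 2} (a b : 𝒜 d) :
      StpRel σ m (freeT hij (a + b) - (freeT hij a + freeT hij b))
  | t_smul {i j : Fin m} (hij : i ≠ j) {d : ZMod 2} (c : k) (a : 𝒜 d) :
      StpRel σ m (freeT hij (c • a) - c • freeT hij a)
  | f_add {i j : Fin m} (hij : i ≠ j) {d : ZMod 2} (a b : 𝒜 d) :
      StpRel σ m (freeF hij (a + b) - (freeF hij a + freeF hij b))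
  | f_smul {i j : Fin m} (hij : i ≠ j) {d : ZMod 2} (c : k) (a : 𝒜 d) :
      StpRel σ m (freeF hij (c • a) - c • freeF hij a)
  | g_add {i j : Fin m} (hij : i ≠ j) {d : ZMod 2} (a b : 𝒜 d) :
      StpRel σ m (freeG hij (a + b) - (freeG hij a + freeG hij b))
  | g_smul {i j : Fin m} (hij : i ≠ j) {d : ZMod 2} (c : k) (a : 𝒜 d) :
      StpRel σ m (freeG hij (c • a) - c • freeG hij a)
  | f_bar {i j : Fin m} (hij : i ≠ j) {d : ZMod 2} (a : 𝒜 d) :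
      StpRel σ m (freeF hij (hBar σ a) - freeF hij.symm (hRho a))
  | g_bar {i j : Fin m} (hij : i ≠ j) {d : ZMod 2} (a : 𝒜 d) :
      StpRel σ m (freeG hij (hBar σ a) + freeG hij.symm (hRho a))
  | t_t {i j l : Fin m} (hij : i ≠ j) (hjl : j ≠ l) (hil : i ≠ l) {d e : ZMod 2}
      (a : 𝒜 d) (b : 𝒜 e) :
      StpRel σ m (freeT hij a * freeT hjl b - freeT hil (hMul a b))
  | t_t_zero {i j l n : Fin m} (hij : i ≠ j) (_ : j ≠ l) (hln : l ≠ n) (_ : n ≠ i)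
      {d e : ZMod 2} (a : 𝒜 d) (b : 𝒜 e) :
      StpRel σ m (freeT hij a * freeT hln b)
  | t_f {i j l : Fin m} (hij : i ≠ j) (hjl : j ≠ l) (hil : i ≠ l) {d e : ZMod 2}
      (a : 𝒜 d) (b : 𝒜 e) :
      StpRel σ m (freeT hij a * freeF hjl b - freeF hil (hMul a b))
  | t_f_zero {i j l n : Fin m} (hij : i ≠ j) (_ : j ≠ l) (hln : l ≠ n) (_ : n ≠ j)
      {d e : ZMod 2} (a : 𝒜 d) (b : 𝒜 e) :
      StpRel σ m (freeT hij a * freeF hln b)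
  | g_t {i j l : Fin m} (hij : i ≠ j) (hjl : j ≠ l) (hil : i ≠ l) {d e : ZMod 2}
      (a : 𝒜 d) (b : 𝒜 e) :
      StpRel σ m (freeG hij a * freeT hjl b - freeG hil (hMul a b))
  | g_t_zero {i j l n : Fin m} (hij : i ≠ j) (_ : i ≠ l) (_ : l ≠ j) (hln : l ≠ n)
      {d e : ZMod 2} (a : 𝒜 d) (b : 𝒜 e) :
      StpRel σ m (freeG hij a * freeT hln b)
  | f_f {i j l n : Fin m} (hij : i ≠ j) (hln : l ≠ n) {d e : ZMod 2} (a : 𝒜 d) (b : 𝒜 e) :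
      StpRel σ m (freeF hij a * freeF hln b)
  | g_g {i j l n : Fin m} (hij : i ≠ j) (hln : l ≠ n) {d e : ZMod 2} (a : 𝒜 d) (b : 𝒜 e) :
      StpRel σ m (freeG hij a * freeG hln b)
  | f_g {i j l : Fin m} (hij : i ≠ j) (hjl : j ≠ l) (hil : i ≠ l) {d e : ZMod 2}
      (a : 𝒜 d) (b : 𝒜 e) :
      StpRel σ m (freeF hij a * freeG hjl b - freeT hil (hMul a b))
  | f_g_zero {i j l n : Fin m} (hij : i ≠ j) (_ : i ≠ l) (_ : i ≠ n) (_ : j ≠ l) (_ : j ≠ n)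
      (hln : l ≠ n) {d e : ZMod 2} (a : 𝒜 d) (b : 𝒜 e) :
      StpRel σ m (freeF hij a * freeG hln b)

theorem homogeneous_stpRel (σ : Superinvolution 𝒜) (m : ℕ) :
    HomogeneousRel (StpGen.parity (𝒜 := 𝒜) (m := m)) (StpRel σ m) := by
  have hT : ∀ {i j : Fin m} (hij : i ≠ j) {d : ZMod 2} (a : 𝒜 d),
      freeT hij a ∈ freeGrade k StpGen.parity d := fun hij d a =>
    of_mem_freeGrade StpGen.parity (.t _ _ hij d a)
  have hF : ∀ {i j : Fin m} (hij : i ≠ j) {d : ZMod 2} (a : 𝒜 d),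
      freeF hij a ∈ freeGrade k StpGen.parity (d + 1) := fun hij d a =>
    of_mem_freeGrade StpGen.parity (.f _ _ hij d a)
  have hG : ∀ {i j : Fin m} (hij : i ≠ j) {d : ZMod 2} (a : 𝒜 d),
      freeG hij a ∈ freeGrade k StpGen.parity (d + 1) := fun hij d a =>
    of_mem_freeGrade StpGen.parity (.g _ _ hij d a)
  intro x hx
  cases hx with
  | t_add hij a b => exact ⟨_, sub_mem (hT _ _) (add_mem (hT _ _) (hT _ _))⟩
  | t_smul hij c a => exact ⟨_, sub_mem (hT _ _) (Submodule.smul_mem _ _ (hT _ _))⟩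
  | f_add hij a b => exact ⟨_, sub_mem (hF _ _) (add_mem (hF _ _) (hF _ _))⟩
  | f_smul hij c a => exact ⟨_, sub_mem (hF _ _) (Submodule.smul_mem _ _ (hF _ _))⟩
  | g_add hij a b => exact ⟨_, sub_mem (hG _ _) (add_mem (hG _ _) (hG _ _))⟩
  | g_smul hij c a => exact ⟨_, sub_mem (hG _ _) (Submodule.smul_mem _ _ (hG _ _))⟩
  | f_bar hij a => exact ⟨_, sub_mem (hF _ _) (hF _ _)⟩
  | g_bar hij a => exact ⟨_, add_mem (hG _ _) (hG _ _)⟩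
  | t_t hij hjl hil a b =>
    exact ⟨_, sub_mem (mul_mem_freeGrade (hT _ _) (hT _ _)) (hT _ _)⟩
  | t_t_zero hij _ hln _ a b => exact ⟨_, mul_mem_freeGrade (hT _ _) (hT _ _)⟩
  | @t_f i j l hij hjl hil d e a b =>
    refine ⟨_, sub_mem (mul_mem_freeGrade (hT _ _) (hF _ _)) ?_⟩
    exact add_assoc d e 1 ▸ hF _ _
  | t_f_zero hij _ hln _ a b => exact ⟨_, mul_mem_freeGrade (hT _ _) (hF _ _)⟩
  | @g_t i j l hij hjl hil d e a b =>
    refine ⟨_, sub_mem (mul_mem_freeGrade (hG _ _) (hT _ _)) ?_⟩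
    exact add_right_comm d e 1 ▸ hG _ _
  | g_t_zero hij _ _ hln a b => exact ⟨_, mul_mem_freeGrade (hG _ _) (hT _ _)⟩
  | f_f hij hln a b => exact ⟨_, mul_mem_freeGrade (hF _ _) (hF _ _)⟩
  | g_g hij hln a b => exact ⟨_, mul_mem_freeGrade (hG _ _) (hG _ _)⟩
  | @f_g i j l hij hjl hil d e a b =>
    refine ⟨_, sub_mem (mul_mem_freeGrade (hF _ _) (hG _ _)) ?_⟩
    have h : d + 1 + (e + 1) = d + e := by
      linear_combination CharTwo.add_self_eq_zero (1 : ZMod 2)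
    rw [h]
    exact hT _ _
  | f_g_zero hij _ _ _ _ hln a b => exact ⟨_, mul_mem_freeGrade (hF _ _) (hG _ _)⟩

/-- The Steinberg periplectic Lie superalgebra `𝔰𝔱𝔭_m(R, ⁻)`. -/
abbrev Stp (σ : Superinvolution 𝒜) (m : ℕ) : Type (max u v) :=
  PresentedLieSuperalgebra (k := k) StpGen.parity (StpRel σ m) (homogeneous_stpRel σ m)

/-- The generator `𝐭_{ij}(a)`. -/
noncomputable def Stp.t (σ : Superinvolution 𝒜) {i j : Fin m} (hij : i ≠ j) {d : ZMod 2}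
    (a : 𝒜 d) : Stp σ m := PresentedLieSuperalgebra.gen _ _ _ (.t i j hij d a)

/-- The generator `𝐟_{ij}(a)`. -/
noncomputable def Stp.f (σ : Superinvolution 𝒜) {i j : Fin m} (hij : i ≠ j) {d : ZMod 2}
    (a : 𝒜 d) : Stp σ m := PresentedLieSuperalgebra.gen _ _ _ (.f i j hij d a)

/-- The generator `𝐠_{ij}(a)`. -/
noncomputable def Stp.g (σ : Superinvolution 𝒜) {i j : Fin m} (hij : i ≠ j) {d : ZMod 2}
    (a : 𝒜 d) : Stp σ m := PresentedLieSuperalgebra.gen _ _ _ (.g i j hij d a)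

/-- A homomorphism `ψ : 𝔰𝔱𝔭_m(R, ⁻) → 𝔭_m(R, ⁻)` is canonical if `ψ(𝐭_{ij}(a)) = t_{ij}(a)`,
`ψ(𝐟_{ij}(a)) = f_{ij}(a)` and `ψ(𝐠_{ij}(a)) = g_{ij}(a)` for all `i ≠ j` and homogeneous `a`. -/
structure IsCanonicalHom (σ : Superinvolution 𝒜) (m : ℕ)
    (ψ : LieSuperalgebra.Hom k (Stp σ m) (periplectic σ m).toSubmodule) : Prop where
  map_t : ∀ {i j : Fin m} (hij : i ≠ j) {d : ZMod 2} (a : 𝒜 d),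
    (ψ (Stp.t σ hij a) : SuperMatrix 𝒜 m) = matT σ i j a
  map_f : ∀ {i j : Fin m} (hij : i ≠ j) {d : ZMod 2} (a : 𝒜 d),
    (ψ (Stp.f σ hij a) : SuperMatrix 𝒜 m) = matF σ i j a
  map_g : ∀ {i j : Fin m} (hij : i ≠ j) {d : ZMod 2} (a : 𝒜 d),
    (ψ (Stp.g σ hij a) : SuperMatrix 𝒜 m) = matG σ i j a

end Steinberg

/-! The three families of generators are the blocks of one family `u p q a`, indexed by pairs of
matrix indices with different residues mod `m`. It models `e_pq(a) - e_pq(a)^prp`, so `u p q` and `u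
q.swap p.swap` determine each other, `[u p q a, u q r b] = u p r (a * b)` for three different
residues, and the bracket vanishes if no indices match. A `SteinbergSystem` is such a family. The
presentation makes `Stp` the universal Lie superalgebra with a system (`SteinbergSystem.exists_hom`,
`Stp.hom_ext`), and the matrices `matX` form a system in the periplectic algebra
(`periplecticSystem`); this gives `ψ` and its uniqueness.

Lifting. The bracket of a central extension `E` depends only on images, so it is a bilinear map `B`
on the periplectic algebra with values in `E` that still satisfies antisymmetry and Jacobi
(`IsCentralExtension.isBracketLike`). Put `ũ p r a = B (u p q 1) (u q r a)` for an auxiliary index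
`q`. Factoring `u p q (a * a')` through a fresh index and applying Jacobi shows that `q` is
irrelevant and that the `ũ` form a system in `E` (`bracketLike_shift`, `bracketLike_zero`,
`SteinbergSystem.lift`); the arguments avoid up to four residues at a time, whence `m ≥ 5`. The
system yields the lift. It is unique because each `u p q a` is a bracket, and two lifts differ by
central elements.

Central kernel. Every element of `Stp` is a sum of loops `[u x v a, u v x b]` and of off-diagonal
elements (`exists_add_offDiagSum`). Loops map to diagonal matrices. If the sum lies in the kernel,
the off-diagonal coefficients are fixed by the transposition `(p, q) ↦ (q.swap, p.swap)`, under
which the off-diagonal sum changes sign; as `2` is invertible, it is zero (`offDiagSum_eq_zero`).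
The remaining loop part sends `u p q a` to some `u p q b` (`loopSpan_bracket_mem`), and applying `ψ`
gives `b = 0`. So the kernel kills a generating set, hence everything.

Surjectivity. Since `2` is invertible, the `matX` span `{X | X^prp = -X}`; brackets of diagonal ones
are combinations of loops (`matX_diag_mem`), so the off-diagonal ones generate the derived algebra
(`periplectic_le`). -/

namespace LieSuperalgebra

/-! ### Homomorphisms, bracket-like bilinear maps and central extensions -/

section General

variable {k : Type u} {L : Type v} {E : Type w} [CommRing k]
  [AddCommGroup L] [Module k L] [LieSuperalgebra k L] [AddCommGroup E] [Module k E]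

instance Hom.instLinearMapClass [LieSuperalgebra k E] : LinearMapClass (Hom k L E) k L E where
  map_add φ := φ.toLinearMap.map_add
  map_smulₛₗ φ := φ.toLinearMap.map_smul

theorem Hom.map_mem [LieSuperalgebra k E] (φ : Hom k L E) {d : ZMod 2} {x : L}
    (hx : x ∈ grade (k := k) d) : φ x ∈ grade (k := k) d := φ.map_grade d x hx

theorem Hom.map_bracket_apply [LieSuperalgebra k E] (φ : Hom k L E) (x y : L) :
    φ (bracket (k := k) x y) = bracket (k := k) (φ x) (φ y) := φ.map_bracket x y

theorem Hom.ext [LieSuperalgebra k E] {φ φ' : Hom k L E} (h : ∀ x, φ x = φ' x) : φ = φ' :=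
  DFunLike.coe_injective (funext h)

/-- The composition of homomorphisms. -/
def Hom.comp {E' : Type*} [AddCommGroup E'] [Module k E'] [LieSuperalgebra k E]
    [LieSuperalgebra k E'] (φ : Hom k E E') (θ : Hom k L E) : Hom k L E' where
  toLinearMap := φ.toLinearMap ∘ₗ θ.toLinearMap
  map_grade d x hx := φ.map_grade d _ (θ.map_grade d x hx)
  map_bracket x y := (congrArg φ (θ.map_bracket x y)).trans (φ.map_bracket _ _)

theorem Hom.comp_apply {E' : Type*} [AddCommGroup E'] [Module k E'] [LieSuperalgebra k E]
    [LieSuperalgebra k E'] (φ : Hom k E E') (θ : Hom k L E) (x : L) : φ.comp θ x = φ (θ x) := rfl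

variable (k) in
/-- A property that is closed under sums and holds for homogeneous elements holds everywhere. -/
theorem homogeneous_induction {P : L → Prop} (hadd : ∀ x y, P x → P y → P (x + y))
    (h : ∀ (d : ZMod 2) (x : L), x ∈ grade (k := k) d → P x) (x : L) : P x := by
  obtain ⟨x₀, h0, x₁, h1, rfl⟩ := exists_add (k := k) x
  exact hadd _ _ (h _ _ h0) (h _ _ h1)

/-- A bilinear map on a Lie superalgebra that satisfies the same identities as a bracket: it is
super-antisymmetric and satisfies the super-Jacobi identity. -/
structure IsBracketLike (B : L →ₗ[k] L →ₗ[k] E) : Prop where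
  skew : ∀ {d e : ZMod 2} {x y : L}, x ∈ grade (k := k) d → y ∈ grade (k := k) e →
    B x y = -((-1 : ℤˣ) ^ (d * e) • B y x)
  jacobi : ∀ {d e : ZMod 2} {x y : L}, x ∈ grade (k := k) d → y ∈ grade (k := k) e → ∀ z : L,
    B (bracket (k := k) x y) z =
      B x (bracket (k := k) y z) - (-1 : ℤˣ) ^ (d * e) • B y (bracket (k := k) x z)

theorem isBracketLike_bracket : IsBracketLike (bracket (k := k) (L := L)) where
  skew := bracket_skew
  jacobi {d e x y} hx hy z := by
    revert z
    refine homogeneous_induction k (fun z z' hz hz' => ?_) (fun f z hz => ?_)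
    · simp only [map_add, smul_add, hz, hz']; abel
    · rw [LieSuperalgebra.jacobi hx hy hz, add_sub_cancel_right]

/-- Left multiplication by a homogeneous element is a derivation. -/
theorem bracket_bracket {d e : ZMod 2} {x y : L} (hx : x ∈ grade (k := k) d)
    (hy : y ∈ grade (k := k) e) (z : L) :
    bracket (k := k) x (bracket (k := k) y z) = bracket (k := k) (bracket (k := k) x y) z +
      (-1 : ℤˣ) ^ (d * e) • bracket (k := k) y (bracket (k := k) x z) := by
  rw [isBracketLike_bracket.jacobi hx hy, sub_add_cancel]

variable [LieSuperalgebra k E] {φ : Hom k E L}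

/-- The homogeneous components of an element of the kernel of a homomorphism lie in the kernel. -/
theorem Hom.exists_add_of_map_eq_zero (φ : Hom k E L) {x : E} (hx : φ x = 0) :
    ∃ x₀ ∈ grade (k := k) (L := E) 0, ∃ x₁ ∈ grade (k := k) (L := E) 1,
      φ x₀ = 0 ∧ φ x₁ = 0 ∧ x₀ + x₁ = x := by
  obtain ⟨x₀, h0, x₁, h1, rfl⟩ := exists_add (k := k) x
  rw [map_add] at hx
  have h : φ x₀ = 0 := by
    refine Submodule.disjoint_def.1 (isCompl_grade (k := k) (L := L)).disjoint _
      (φ.map_mem h0) ?_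
    rw [eq_neg_of_add_eq_zero_left hx]
    exact neg_mem (φ.map_mem h1)
  exact ⟨x₀, h0, x₁, h1, h, by rwa [h, zero_add] at hx, rfl⟩

/-- A surjective homomorphism is surjective in each degree. -/
theorem Hom.exists_mem_grade (φ : Hom k E L) (hφ : Function.Surjective φ) {d : ZMod 2} {y : L}
    (hy : y ∈ grade (k := k) d) : ∃ x ∈ grade (k := k) (L := E) d, φ x = y := by
  obtain ⟨x, rfl⟩ := hφ y
  obtain ⟨x₀, h0, x₁, h1, rfl⟩ := exists_add (k := k) x
  rw [map_add] at hy
  obtain rfl | rfl : d = 0 ∨ d = 1 := by clear hy; revert d; decide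
  · refine ⟨x₀, h0, ?_⟩
    have h : φ x₁ = 0 := Submodule.disjoint_def.1 (isCompl_grade (k := k) (L := L)).disjoint _
      (by simpa using sub_mem hy (φ.map_mem h0)) (φ.map_mem h1)
    rw [map_add, h, add_zero]
  · refine ⟨x₁, h1, ?_⟩
    have h : φ x₀ = 0 := Submodule.disjoint_def.1 (isCompl_grade (k := k) (L := L)).disjoint _
      (φ.map_mem h0) (by simpa using sub_mem hy (φ.map_mem h1))
    rw [map_add, h, zero_add]

/-- Antisymmetry is available only for homogeneous elements; it applies because the kernel of an
even map contains the homogeneous components of its elements. -/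
theorem IsCentralExtension.bracket_right (hφ : IsCentralExtension φ) {x : E} (hx : φ x = 0)
    (y : E) : bracket (k := k) y x = 0 := by
  obtain ⟨x₀, h0, x₁, h1, k0, k1, rfl⟩ := φ.exists_add_of_map_eq_zero hx
  revert y
  refine homogeneous_induction k (fun y z hy hz => ?_) (fun e y hy => ?_)
  · rw [map_add (bracket (k := k)), LinearMap.add_apply, hy, hz, add_zero]
  · rw [map_add, bracket_skew hy h0, bracket_skew hy h1, hφ.central _ k0, hφ.central _ k1]
    simp

/-- Changing an argument by a kernel element changes the bracket by zero, on either side. This is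
what makes `liftedBracket` well defined and lifts unique. -/
theorem IsCentralExtension.bracket_congr (hφ : IsCentralExtension φ) {x x' y y' : E}
    (hx : φ x = φ x') (hy : φ y = φ y') : bracket (k := k) x y = bracket (k := k) x' y' := by
  have h1 : bracket (k := k) (x - x') y = 0 := hφ.central _ (by rw [map_sub, hx, sub_self]) _
  have h2 : bracket (k := k) x' (y - y') = 0 := hφ.bracket_right (by rw [map_sub, hy, sub_self]) _
  rw [map_sub, LinearMap.sub_apply, sub_eq_zero] at h1
  rw [map_sub, sub_eq_zero] at h2
  rw [h1, h2]

/-- The bracket of a central extension of `L`, as a bilinear map on `L`. -/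
noncomputable def IsCentralExtension.liftedBracket (hφ : IsCentralExtension φ) :
    L →ₗ[k] L →ₗ[k] E :=
  LinearMap.mk₂ k (fun x y => bracket (k := k) (Function.surjInv hφ.surjective x)
      (Function.surjInv hφ.surjective y))
    (fun x y z => by
      rw [← LinearMap.add_apply, ← map_add]
      exact hφ.bracket_congr (by simp only [map_add, Function.surjInv_eq]) rfl)
    (fun c x y => by
      rw [← LinearMap.smul_apply, ← map_smul]
      exact hφ.bracket_congr (by simp only [map_smul, Function.surjInv_eq]) rfl)
    (fun x y z => by
      rw [← map_add]
      exact hφ.bracket_congr rfl (by simp only [map_add, Function.surjInv_eq]))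
    (fun c x y => by
      rw [← map_smul]
      exact hφ.bracket_congr rfl (by simp only [map_smul, Function.surjInv_eq]))

theorem IsCentralExtension.liftedBracket_map (hφ : IsCentralExtension φ) (x y : E) :
    hφ.liftedBracket (φ x) (φ y) = bracket (k := k) x y :=
  hφ.bracket_congr (Function.surjInv_eq _ _) (Function.surjInv_eq _ _)

theorem IsCentralExtension.map_liftedBracket (hφ : IsCentralExtension φ) (x y : L) :
    φ (hφ.liftedBracket x y) = bracket (k := k) x y := by
  obtain ⟨x, rfl⟩ := hφ.surjective x
  obtain ⟨y, rfl⟩ := hφ.surjective y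
  rw [liftedBracket_map, φ.map_bracket_apply]

theorem IsCentralExtension.liftedBracket_mem (hφ : IsCentralExtension φ) {d e : ZMod 2} {x y : L}
    (hx : x ∈ grade (k := k) d) (hy : y ∈ grade (k := k) e) :
    hφ.liftedBracket x y ∈ grade (k := k) (L := E) (d + e) := by
  obtain ⟨x, hx', rfl⟩ := φ.exists_mem_grade hφ.surjective hx
  obtain ⟨y, hy', rfl⟩ := φ.exists_mem_grade hφ.surjective hy
  rw [liftedBracket_map]
  exact bracket_mem hx' hy'

/-- Homogeneous elements have homogeneous preimages, so the identities transfer from the bracket of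
`E`. -/
theorem IsCentralExtension.isBracketLike (hφ : IsCentralExtension φ) :
    IsBracketLike hφ.liftedBracket where
  skew hx hy := by
    obtain ⟨x, hx', rfl⟩ := φ.exists_mem_grade hφ.surjective hx
    obtain ⟨y, hy', rfl⟩ := φ.exists_mem_grade hφ.surjective hy
    rw [liftedBracket_map, liftedBracket_map]
    exact bracket_skew hx' hy'
  jacobi hx hy z := by
    obtain ⟨x, hx', rfl⟩ := φ.exists_mem_grade hφ.surjective hx
    obtain ⟨y, hy', rfl⟩ := φ.exists_mem_grade hφ.surjective hy
    obtain ⟨z, rfl⟩ := hφ.surjective z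
    simp only [← φ.map_bracket_apply, liftedBracket_map]
    exact isBracketLike_bracket.jacobi hx' hy' z

end General

end LieSuperalgebra

/-! ### Residues of matrix indices -/

section Indices

variable {m : ℕ}

/-- The residue of a row or column index: both `i` and `m + i` have residue `i`. -/
def indexClass : Fin m ⊕ Fin m → Fin m := Sum.elim id id

@[simp]
theorem indexClass_swap (p : Fin m ⊕ Fin m) : indexClass p.swap = indexClass p := by
  rcases p with i | i <;> rfl

@[simp]
theorem indexClass_inl (i : Fin m) : indexClass (.inl i) = i := rfl

@[simp]
theorem indexClass_inr (i : Fin m) : indexClass (.inr i) = i := rfl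

theorem ne_of_indexClass_ne {p q : Fin m ⊕ Fin m} (h : indexClass p ≠ indexClass q) : p ≠ q :=
  fun e => h (congrArg indexClass e)

theorem ne_swap_of_indexClass_ne {p q : Fin m ⊕ Fin m} (h : indexClass p ≠ indexClass q) :
    p ≠ q.swap :=
  fun e => h ((congrArg indexClass e).trans (indexClass_swap q))

/-- The source of the bound `5 ≤ m`: a fresh index must avoid the residues of two given pairs. When
fewer residues matter, an argument is repeated. -/
theorem exists_indexClass_ne (hm : 5 ≤ m) (a b c d : Fin m) : ∃ v : Fin m ⊕ Fin m,
    indexClass v ≠ a ∧ indexClass v ≠ b ∧ indexClass v ≠ c ∧ indexClass v ≠ d := by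
  have h : ({a, b, c, d} : Finset (Fin m)).card < (Finset.univ : Finset (Fin m)).card := by
    rw [Finset.card_fin]
    exact Finset.card_le_four.trans_lt (by omega)
  obtain ⟨v, -, hv⟩ := Finset.exists_mem_notMem_of_card_lt_card h
  simp only [Finset.mem_insert, Finset.mem_singleton, not_or] at hv
  exact ⟨.inl v, hv⟩

end Indices

/-! ### The action of `prp` on matrix entries -/

section EntryConj

variable {k : Type u} {R : Type v} [CommRing k] [Ring R] [Algebra k R]

theorem graded_induction (𝒜 : ZMod 2 → Submodule k R) [GradedAlgebra 𝒜] {P : R → Prop}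
    (hadd : ∀ a b, P a → P b → P (a + b)) (h : ∀ (d : ZMod 2) (a : R), a ∈ 𝒜 d → P a) (a : R) :
    P a := by
  obtain ⟨x, hx, y, hy, rfl⟩ := Submodule.mem_sup.1
    ((isCompl_of_gradedAlgebra 𝒜).sup_eq_top ▸ Submodule.mem_top (x := a))
  exact hadd _ _ (h _ _ hx) (h _ _ hy)

variable {𝒜 : ZMod 2 → Submodule k R} [GradedAlgebra 𝒜] (σ : Superinvolution 𝒜) {m : ℕ}

/-- The map that `prp` induces on the `(p, q)`-entries: `prp (e_{p,q}(a))` is the matrix with this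
map applied to `a` in position `(q.swap, p.swap)`. -/
noncomputable def entryConj : Fin m ⊕ Fin m → Fin m ⊕ Fin m → R →ₗ[k] R
  | .inl _, .inl _ => σ.toLinearMap
  | .inl _, .inr _ => -(σ.toLinearMap ∘ₗ parityMap 𝒜)
  | .inr _, .inl _ => σ.toLinearMap ∘ₗ parityMap 𝒜
  | .inr _, .inr _ => σ.toLinearMap

/-- One sign formula for all four blocks, so that later sign identities become finite checks over
`ZMod 2`. -/
theorem entryConj_of_mem (p q : Fin m ⊕ Fin m) {d : ZMod 2} {a : R} (ha : a ∈ 𝒜 d) :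
    entryConj σ p q a = (-1 : ℤˣ) ^ ((indexParity p + indexParity q) * d +
      (indexParity p + 1) * indexParity q) • σ.toLinearMap a := by
  have h1 : (1 : ZMod 2) + 1 = 0 := CharTwo.add_self_eq_zero 1
  rcases p with i | i <;> rcases q with j | j <;>
    rcases Int.units_eq_one_or ((-1 : ℤˣ) ^ d) with h | h <;>
    simp [entryConj, parityMap_of_mem 𝒜 ha, indexParity, h1, uzpow_add, h]

theorem entryConj_mem (p q : Fin m ⊕ Fin m) {d : ZMod 2} {a : R} (ha : a ∈ 𝒜 d) :
    entryConj σ p q a ∈ 𝒜 d := by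
  rw [entryConj_of_mem σ p q ha, Units.smul_def]
  exact zsmul_mem (σ.map_mem ha) _

omit [GradedAlgebra 𝒜] in
theorem Superinvolution.apply_apply (a : R) : σ.toLinearMap (σ.toLinearMap a) = a :=
  σ.involutive a

theorem entryConj_swap (p q : Fin m ⊕ Fin m) (a : R) :
    entryConj σ q.swap p.swap (entryConj σ p q a) = a := by
  revert a
  refine graded_induction 𝒜 (fun a b ha hb => by rw [map_add, map_add, ha, hb]) fun d a ha => ?_
  rw [entryConj_of_mem σ _ _ (entryConj_mem σ p q ha), entryConj_of_mem σ p q ha, Units.smul_def,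
    Units.smul_def, map_zsmul, ← Units.smul_def, ← Units.smul_def, smul_smul, σ.apply_apply,
    ← uzpow_add, indexParity_swap, indexParity_swap]
  generalize indexParity p = x
  generalize indexParity q = y
  -- The total exponent is a polynomial in three parities that vanishes on `ZMod 2`.
  convert one_smul ℤˣ a
  clear ha
  revert x y d
  decide

/-- The sign is that of exchanging `e_pq(a)` and `e_qr(b)`, exactly the sign of super-antisymmetry.
Hence antisymmetry of the bracket matches the symmetry `(p, q) ↦ (q.swap, p.swap)` of a system. -/
theorem entryConj_mul (p q r : Fin m ⊕ Fin m) {d e : ZMod 2} {a b : R} (ha : a ∈ 𝒜 d)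
    (hb : b ∈ 𝒜 e) : entryConj σ p r (a * b) =
      (-1 : ℤˣ) ^ ((indexParity p + indexParity q + d) * (indexParity q + indexParity r + e)) •
        (entryConj σ q r b * entryConj σ p q a) := by
  have h : σ.toLinearMap (a * b) = (-1 : ℤˣ) ^ (d * e) • (σ.toLinearMap b * σ.toLinearMap a) :=
    σ.map_mul ha hb
  rw [entryConj_of_mem σ p r (SetLike.mul_mem_graded ha hb), entryConj_of_mem σ p q ha,
    entryConj_of_mem σ q r hb, h, smul_mul_smul_comm, smul_smul, smul_smul, ← uzpow_add,
    ← uzpow_add, ← uzpow_add]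
  congr 2
  generalize indexParity p = x
  generalize indexParity q = y
  generalize indexParity r = z
  clear ha hb h
  revert x y z d e
  decide

end EntryConj

/-! ### Systems of root elements and their transport along bracket-like maps -/

section System

open LieSuperalgebra

variable {k : Type u} {R : Type v} [CommRing k] [Ring R] [Algebra k R]
  {𝒜 : ZMod 2 → Submodule k R} [GradedAlgebra 𝒜]

/-- Elements `u_{pq}(a)` of a Lie superalgebra, where `p` and `q` are indices of a `2m × 2m` matrix
with different residues, that satisfy the relations of the matrices
`e_{pq}(a) - (e_{pq}(a))^prp`. -/
structure SteinbergSystem (σ : Superinvolution 𝒜) (m : ℕ) (E : Type w) [AddCommGroup E]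
    [Module k E] [LieSuperalgebra k E] where
  /-- the elements `u_{pq}(a)` -/
  u : Fin m ⊕ Fin m → Fin m ⊕ Fin m → R →ₗ[k] E
  mem : ∀ {p q : Fin m ⊕ Fin m} {d : ZMod 2} {a : R}, indexClass p ≠ indexClass q → a ∈ 𝒜 d →
    u p q a ∈ grade (k := k) (indexParity p + indexParity q + d)
  symm : ∀ {p q : Fin m ⊕ Fin m}, indexClass p ≠ indexClass q → ∀ a : R,
    u p q a = -u q.swap p.swap (entryConj σ p q a)
  mul : ∀ {p q r : Fin m ⊕ Fin m}, indexClass p ≠ indexClass q → indexClass q ≠ indexClass r →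
    indexClass p ≠ indexClass r → ∀ a b : R,
    bracket (k := k) (u p q a) (u q r b) = u p r (a * b)
  zero : ∀ {p q r s : Fin m ⊕ Fin m}, indexClass p ≠ indexClass q → indexClass r ≠ indexClass s →
    q ≠ r → p ≠ s → p ≠ r.swap → q ≠ s.swap → ∀ a b : R,
    bracket (k := k) (u p q a) (u r s b) = 0

namespace SteinbergSystem

variable {σ : Superinvolution 𝒜} {m : ℕ} {L : Type w} [AddCommGroup L] [Module k L]
  [LieSuperalgebra k L] (S : SteinbergSystem σ m L)
  {E : Type*} [AddCommGroup E] [Module k E] {B : L →ₗ[k] L →ₗ[k] E}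

/-- Write `u p q a = [u p v 1, u v q a]` with `v` away from all four residues. In the Jacobi
expansion both inner brackets with `u r s b` are taken in `L`, where they vanish. -/
theorem bracketLike_zero (hm : 5 ≤ m) (hB : IsBracketLike B) {p q r s : Fin m ⊕ Fin m}
    (hpq : indexClass p ≠ indexClass q) (hrs : indexClass r ≠ indexClass s) (hqr : q ≠ r)
    (hps : p ≠ s) (hpr : p ≠ r.swap) (hqs : q ≠ s.swap) (a b : R) :
    B (S.u p q a) (S.u r s b) = 0 := by
  obtain ⟨v, hvp, hvq, hvr, hvs⟩ :=
    exists_indexClass_ne hm (indexClass p) (indexClass q) (indexClass r) (indexClass s)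
  revert a
  refine graded_induction 𝒜 (fun a a' ha ha' => ?_) fun d a ha => ?_
  · rw [map_add, map_add, LinearMap.add_apply, ha, ha', add_zero]
  · rw [← one_mul a, ← S.mul hvp.symm hvq hpq,
      hB.jacobi (S.mem hvp.symm (SetLike.one_mem_graded 𝒜)) (S.mem hvq ha),
      S.zero hvq hrs hqr (ne_of_indexClass_ne hvs) (ne_swap_of_indexClass_ne hvr) hqs,
      S.zero hvp.symm hrs (ne_of_indexClass_ne hvr) hps hpr (ne_swap_of_indexClass_ne hvs)]
    simp

/-- Jacobi for `u p q (a * a') = [u p v a, u v q a']`: one of the two terms contains `[u p v a, u q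
r b] = 0`. Only `p ≠ r` is needed, so `r = p.swap` is allowed; this reaches positions where `u`
itself has no relations. -/
theorem bracketLike_shift (hB : IsBracketLike B) {p q r v : Fin m ⊕ Fin m}
    (hpq : indexClass p ≠ indexClass q) (hqr : indexClass q ≠ indexClass r) (hpr : p ≠ r)
    (hvp : indexClass v ≠ indexClass p) (hvq : indexClass v ≠ indexClass q)
    (hvr : indexClass v ≠ indexClass r) {d e : ZMod 2} {a a' : R} (ha : a ∈ 𝒜 d) (ha' : a' ∈ 𝒜 e)
    (b : R) : B (S.u p q (a * a')) (S.u q r b) = B (S.u p v a) (S.u v r (a' * b)) := by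
  rw [← S.mul hvp.symm hvq hpq, hB.jacobi (S.mem hvp.symm ha) (S.mem hvq ha'),
    S.mul hvq hqr hvr, S.zero hvp.symm hqr (ne_of_indexClass_ne hvq) hpr
      (ne_swap_of_indexClass_ne hpq) (ne_swap_of_indexClass_ne hvr)]
  simp

/-- The elements `B(u_{pq}(1), u_{qr}(a))`, where the residue of `q` is not that of `p` or `r`. -/
noncomputable def extend (S : SteinbergSystem σ m L) (hm : 5 ≤ m) (B : L →ₗ[k] L →ₗ[k] E)
    (p r : Fin m ⊕ Fin m) : R →ₗ[k] E :=
  let q := (exists_indexClass_ne hm (indexClass p) (indexClass r) (indexClass r)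
    (indexClass r)).choose
  B (S.u p q 1) ∘ₗ S.u q r

theorem extend_eq (hm : 5 ≤ m) (hB : IsBracketLike B) {p q r : Fin m ⊕ Fin m} (hpr : p ≠ r)
    (hpq : indexClass p ≠ indexClass q) (hqr : indexClass q ≠ indexClass r) (a : R) :
    B (S.u p q 1) (S.u q r a) = S.extend hm B p r a := by
  have h := (exists_indexClass_ne hm (indexClass p) (indexClass r) (indexClass r)
    (indexClass r)).choose_spec
  change _ = B (S.u p _ 1) (S.u _ r a)
  generalize (exists_indexClass_ne hm (indexClass p) (indexClass r) (indexClass r)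
    (indexClass r)).choose = v at h
  obtain ⟨hvp, hvr, -, -⟩ := h
  -- The chosen index `v` may have the same residue as `q`, so the shift goes from `q` to `v`
  -- through a third index `w`.
  obtain ⟨w, hwp, hwq, hwr, hwv⟩ :=
    exists_indexClass_ne hm (indexClass p) (indexClass q) (indexClass r) (indexClass v)
  have h1 := SetLike.one_mem_graded 𝒜
  rw [← one_mul (1 : R), S.bracketLike_shift hB hpq hqr hpr hwp hwq hwr h1 h1,
    S.bracketLike_shift hB hvp.symm hvr hpr hwp hwv hwr h1 h1]

theorem bracketLike_mul (hm : 5 ≤ m) (hB : IsBracketLike B) {p q r : Fin m ⊕ Fin m} (hpr : p ≠ r)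
    (hpq : indexClass p ≠ indexClass q) (hqr : indexClass q ≠ indexClass r) (a b : R) :
    B (S.u p q a) (S.u q r b) = S.extend hm B p r (a * b) := by
  obtain ⟨v, hvp, hvq, hvr, -⟩ :=
    exists_indexClass_ne hm (indexClass p) (indexClass q) (indexClass r) (indexClass r)
  revert a
  refine graded_induction 𝒜 (fun a a' ha ha' => ?_) fun d a ha => ?_
  · rw [map_add, map_add, LinearMap.add_apply, ha, ha', add_mul, map_add]
  · rw [← S.extend_eq hm hB hpr hvp.symm hvr, ← S.bracketLike_shift hB hpq hqr hpr hvp hvq hvr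
      (SetLike.one_mem_graded 𝒜) ha, one_mul]

/-- Exchange the two factors by antisymmetry and transpose each of them: the sign from the exchange
is the one in `entryConj_mul`. -/
theorem extend_symm (hm : 5 ≤ m) (hB : IsBracketLike B) {p r : Fin m ⊕ Fin m} (hpr : p ≠ r)
    (a : R) : S.extend hm B p r a = -S.extend hm B r.swap p.swap (entryConj σ p r a) := by
  obtain ⟨q, hqp, hqr, -, -⟩ :=
    exists_indexClass_ne hm (indexClass p) (indexClass r) (indexClass r) (indexClass r)
  have h1 := SetLike.one_mem_graded 𝒜
  revert a
  refine graded_induction 𝒜 (fun a a' ha ha' => ?_) fun d a ha => ?_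
  · rw [map_add, map_add, map_add, ha, ha', neg_add]
  · have hrp : r.swap ≠ p.swap := fun h => hpr (Sum.swap_leftInverse.injective h).symm
    have h := entryConj_mul σ p q r h1 ha
    rw [one_mul] at h
    rw [← S.extend_eq hm hB hpr hqp.symm hqr, hB.skew (S.mem hqp.symm h1) (S.mem hqr ha), h,
      S.symm hqp.symm, S.symm hqr, map_neg, map_neg, LinearMap.neg_apply, neg_neg,
      S.bracketLike_mul hm hB hrp (by simpa using hqr.symm) (by simpa using hqp), Units.smul_def,
      Units.smul_def, map_zsmul]

/-- By `hbr` the bracket of two values of `B` is `B` of the two inner brackets in `L`, and these are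
`u p q a` and `u r s b`. So relations in `E` reduce to `bracketLike_mul` and `bracketLike_zero`. -/
theorem bracket_extend [LieSuperalgebra k E] (hm : 5 ≤ m) (hB : IsBracketLike B)
    (hbr : ∀ x x' y y' : L, bracket (k := k) (B x x') (B y y') =
      B (bracket (k := k) x x') (bracket (k := k) y y')) {p q r s : Fin m ⊕ Fin m}
    (hpq : indexClass p ≠ indexClass q) (hrs : indexClass r ≠ indexClass s) (a b : R) :
    bracket (k := k) (S.extend hm B p q a) (S.extend hm B r s b) =
      B (S.u p q a) (S.u r s b) := by
  obtain ⟨v, hvp, hvq, hvr, hvs⟩ :=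
    exists_indexClass_ne hm (indexClass p) (indexClass q) (indexClass r) (indexClass s)
  rw [← S.extend_eq hm hB (ne_of_indexClass_ne hpq) hvp.symm hvq,
    ← S.extend_eq hm hB (ne_of_indexClass_ne hrs) hvr.symm hvs, hbr, S.mul hvp.symm hvq hpq,
    S.mul hvr.symm hvs hrs, one_mul, one_mul]

/-- A bracket-like map with values in a Lie superalgebra turns a system into a system. -/
noncomputable def lift [LieSuperalgebra k E] (hm : 5 ≤ m) (hB : IsBracketLike B)
    (hmem : ∀ {d e : ZMod 2} {x y : L}, x ∈ grade (k := k) d → y ∈ grade (k := k) e →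
      B x y ∈ grade (k := k) (d + e))
    (hbr : ∀ x x' y y' : L, bracket (k := k) (B x x') (B y y') =
      B (bracket (k := k) x x') (bracket (k := k) y y')) : SteinbergSystem σ m E where
  u := S.extend hm B
  mem {p r d a} hpr ha := by
    obtain ⟨q, hqp, hqr, -, -⟩ :=
      exists_indexClass_ne hm (indexClass p) (indexClass r) (indexClass r) (indexClass r)
    rw [← S.extend_eq hm hB (ne_of_indexClass_ne hpr) hqp.symm hqr]
    convert hmem (S.mem hqp.symm (SetLike.one_mem_graded 𝒜)) (S.mem hqr ha) using 2
    -- The parity of the intermediate index enters twice and cancels.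
    linear_combination (-1 : ZMod 2) * CharTwo.add_self_eq_zero (indexParity q)
  symm hpq a := S.extend_symm hm hB (ne_of_indexClass_ne hpq) a
  mul {p q r} hpq hqr hpr a b := by
    rw [S.bracket_extend hm hB hbr hpq hqr,
      S.bracketLike_mul hm hB (ne_of_indexClass_ne hpr) hpq hqr]
  zero {p q r s} hpq hrs hqr hps hpr hqs a b := by
    rw [S.bracket_extend hm hB hbr hpq hrs, S.bracketLike_zero hm hB hpq hrs hqr hps hpr hqs]

end SteinbergSystem

end System

/-! ### The universal property of a presented Lie superalgebra -/

section Presentation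

open LieSuperalgebra

variable {k : Type u} {X : Type v} [CommRing k]

/-- A non-associative word, as an element of the free non-associative algebra. -/
noncomputable def freeWord (k : Type u) [CommRing k] (w : FreeMagma X) :
    FreeNonUnitalNonAssocAlgebra k X :=
  MonoidAlgebra.single w 1

theorem freeWord_mul (v w : FreeMagma X) :
    freeWord k (v * w) = freeWord k v * freeWord k w := by
  simp only [freeWord, MonoidAlgebra.single_mul_single, one_mul]

theorem freeWord_mem_freeGrade (p : X → ZMod 2) (w : FreeMagma X) :
    freeWord k w ∈ freeGrade k p (wordParity p w) := by
  classical
  intro v hv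
  rw [freeWord, MonoidAlgebra.coeff_single, Finsupp.single_apply, if_neg]
  rintro rfl
  exact hv rfl

/-- Reduces statements about homogeneous polynomials to words, where induction on `FreeMagma`
applies. -/
theorem freeGrade_eq_span (p : X → ZMod 2) (d : ZMod 2) :
    freeGrade k p d ≤ Submodule.span k {x | ∃ w, wordParity p w = d ∧ freeWord k w = x} := by
  intro x hx
  rw [← x.sum_coeff_single]
  refine sum_mem fun w hw => ?_
  have h : MonoidAlgebra.single w (x.coeff w) = x.coeff w • freeWord k w := by
    rw [freeWord, MonoidAlgebra.smul_single, smul_eq_mul, mul_one]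
  change MonoidAlgebra.single w (x.coeff w) ∈ _
  rw [h]
  refine Submodule.smul_mem _ _ (Submodule.subset_span ⟨w, ?_, rfl⟩)
  by_contra hne
  exact Finsupp.mem_support_iff.1 hw (hx w hne)

theorem span_freeWord :
    Submodule.span k (Set.range (freeWord (X := X) k)) = ⊤ := by
  rw [eq_top_iff, ← (isCompl_freeGrade (k := k) (fun _ : X => 0)).sup_eq_top, sup_le_iff]
  constructor <;>
  · refine (freeGrade_eq_span _ _).trans (Submodule.span_mono ?_)
    rintro _ ⟨w, -, rfl⟩
    exact ⟨w, rfl⟩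

variable {E : Type w} [AddCommGroup E] [Module k E] [LieSuperalgebra k E]

/-- Evaluation of non-associative polynomials in a Lie superalgebra. -/
theorem exists_evaluation (g : X → E) : ∃ f : FreeNonUnitalNonAssocAlgebra k X →ₗ[k] E,
    (∀ x, f (.of k x) = g x) ∧ ∀ x y, f (x * y) = bracket (k := k) (f x) (f y) := by
  -- With the bracket as multiplication, `E` is a target for the universal property of the free
  -- non-associative algebra.
  let _ : NonUnitalNonAssocRing E :=
    { (inferInstance : AddCommGroup E) with
      mul := fun x y => bracket (k := k) x y
      left_distrib := fun x y z => map_add _ _ _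
      right_distrib := fun x y z => LinearMap.map_add₂ _ _ _ _
      zero_mul := fun x => LinearMap.map_zero₂ _ _
      mul_zero := fun x => map_zero _ }
  have : IsScalarTower k E E := ⟨fun c x y => LinearMap.map_smul₂ (bracket (k := k)) c x y⟩
  have : SMulCommClass k E E := ⟨fun c x y => ((bracket (k := k) x).map_smul c y).symm⟩
  let F := FreeNonUnitalNonAssocAlgebra.lift k g
  exact ⟨{ toFun := F, map_add' := map_add F, map_smul' := map_smul F },
    FreeNonUnitalNonAssocAlgebra.lift_of_apply k g, map_mul F⟩

namespace PresentedLieSuperalgebra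

variable {p : X → ZMod 2} {rel : FreeNonUnitalNonAssocAlgebra k X → Prop}
  {h : HomogeneousRel p rel}

theorem mk_freeWord_mem (w : FreeMagma X) :
    mk p rel h (freeWord k w) ∈ grade (k := k) (wordParity p w) :=
  ⟨_, freeWord_mem_freeGrade p w, rfl⟩

theorem mk_freeWord_mul (v w : FreeMagma X) : mk p rel h (freeWord k (v * w)) =
    LieSuperalgebra.bracket (k := k) (mk p rel h (freeWord k v)) (mk p rel h (freeWord k w)) := by
  rw [freeWord_mul]; rfl

theorem mk_eq_zero_of_rel {x : FreeNonUnitalNonAssocAlgebra k X} (hx : rel x) :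
    mk p rel h x = 0 := by
  rw [← map_zero (mk p rel h), mk_eq_mk, sub_zero]
  exact .rel hx

/-- A submodule that contains the generators and is closed under brackets of homogeneous elements
is the whole Lie superalgebra. -/
theorem mem_of_gen_mem (N : Submodule k (PresentedLieSuperalgebra p rel h))
    (hgen : ∀ x, gen p rel h x ∈ N)
    (hmul : ∀ {d e : ZMod 2} {x y : PresentedLieSuperalgebra p rel h}, x ∈ grade (k := k) d →
      y ∈ grade (k := k) e → x ∈ N → y ∈ N → LieSuperalgebra.bracket (k := k) x y ∈ N)
    (x : PresentedLieSuperalgebra p rel h) : x ∈ N := by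
  have hword : ∀ w : FreeMagma X, mk p rel h (freeWord k w) ∈ N := fun w => by
    induction w using FreeMagma.recOnMul with
    | ih1 x => exact hgen x
    | ih2 v w hv hw =>
      rw [mk_freeWord_mul]
      exact hmul (mk_freeWord_mem v) (mk_freeWord_mem w) hv hw
  obtain ⟨x, rfl⟩ := mk_surjective p rel h x
  have hx : x ∈ Submodule.span k (Set.range (freeWord (X := X) k)) :=
    span_freeWord (k := k) (X := X) ▸ Submodule.mem_top
  change x ∈ N.comap (mk p rel h)
  refine Submodule.span_le.2 ?_ hx
  rintro _ ⟨w, rfl⟩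
  exact hword w

/-- Two homomorphisms that agree on the generators are equal. -/
theorem hom_eq {φ φ' : Hom k (PresentedLieSuperalgebra p rel h) E}
    (hgen : ∀ x, φ (gen p rel h x) = φ' (gen p rel h x)) : φ = φ' := by
  refine Hom.ext fun x => ?_
  refine mem_of_gen_mem (LinearMap.eqLocus φ.toLinearMap φ'.toLinearMap) hgen
    (fun {d e x y} _ _ hx hy => ?_) x
  change φ x = φ' x at hx
  change φ y = φ' y at hy
  change φ _ = φ' _
  rw [Hom.map_bracket_apply, Hom.map_bracket_apply, hx, hy]

/-- The universal property: homogeneous elements that satisfy the relations define a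
homomorphism. -/
theorem exists_hom (g : X → E) (hg : ∀ x, g x ∈ grade (k := k) (p x))
    (hrel : ∀ f : FreeNonUnitalNonAssocAlgebra k X →ₗ[k] E, (∀ x, f (.of k x) = g x) →
      (∀ x y, f (x * y) = LieSuperalgebra.bracket (k := k) (f x) (f y)) → ∀ x, rel x → f x = 0) :
    ∃ φ : Hom k (PresentedLieSuperalgebra p rel h) E, ∀ x, φ (gen p rel h x) = g x := by
  obtain ⟨f, hf, hmul⟩ := exists_evaluation (k := k) g
  have hword : ∀ w, f (freeWord k w) ∈ grade (k := k) (wordParity p w) := fun w => by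
    induction w using FreeMagma.recOnMul with
    | ih1 x =>
      have h1 : f (freeWord k (.of x)) = g x := hf x
      rw [h1]
      exact hg x
    | ih2 v w hv hw =>
      rw [freeWord_mul, hmul]
      exact bracket_mem hv hw
  have hmem : ∀ {d x}, x ∈ freeGrade k p d → f x ∈ grade (k := k) d := fun {d x} hx => by
    change x ∈ (grade (k := k) d).comap f
    refine Submodule.span_le.2 ?_ (freeGrade_eq_span p d hx)
    rintro _ ⟨w, rfl, rfl⟩
    exact hword w
  -- The antisymmetry and Jacobi relators vanish in `E` because `f` preserves degrees; this is why
  -- homogeneity of the `g x` is required.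
  have hzero : ∀ x, RelIdeal p rel x → f x = 0 := fun x hx => by
    induction hx with
    | rel hx => exact hrel f hf hmul _ hx
    | skew hx hy =>
      rw [map_add, Units.smul_def, map_zsmul, hmul, hmul, bracket_skew (hmem hx) (hmem hy),
        Units.smul_def, neg_add_cancel]
    | jacobi hx hy hz =>
      rw [map_sub, map_add, Units.smul_def, map_zsmul]
      simp only [hmul]
      rw [LieSuperalgebra.jacobi (hmem hx) (hmem hy) (hmem hz), Units.smul_def, sub_self]
    | zero => exact map_zero f
    | add _ _ hx hy => rw [map_add, hx, hy, add_zero]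
    | smul c _ hx => rw [map_smul, hx, smul_zero]
    | mul_left y _ hx => rw [hmul, hx, map_zero]
    | mul_right y _ hx => rw [hmul, hx, map_zero, LinearMap.zero_apply]
  refine ⟨{ toLinearMap := (relSubmodule p rel).liftQ f hzero
            map_grade := ?_
            map_bracket := ?_ }, hf⟩
  · rintro d _ ⟨x, hx, rfl⟩
    exact hmem hx
  · intro x y
    obtain ⟨x, rfl⟩ := mk_surjective p rel h x
    obtain ⟨y, rfl⟩ := mk_surjective p rel h y
    exact hmul x y

end PresentedLieSuperalgebra

end Presentation

/-! ### Recognising a system from the relations of the generators -/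

section Steinberg

open LieSuperalgebra

variable {k : Type u} {R : Type v} [CommRing k] [Ring R] [Algebra k R]

/-- A family of linear maps on the homogeneous parts of `R` defines a linear map on `R`. -/
noncomputable def gradedSum (𝒜 : ZMod 2 → Submodule k R) [GradedAlgebra 𝒜] {E : Type*}
    [AddCommGroup E] [Module k E] (f : ∀ d, 𝒜 d →ₗ[k] E) : R →ₗ[k] E :=
  DirectSum.toModule k (ZMod 2) E f ∘ₗ (DirectSum.decomposeLinearEquiv 𝒜).toLinearMap

theorem gradedSum_of_mem (𝒜 : ZMod 2 → Submodule k R) [GradedAlgebra 𝒜] {E : Type*}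
    [AddCommGroup E] [Module k E] (f : ∀ d, 𝒜 d →ₗ[k] E) {d : ZMod 2} {a : R} (ha : a ∈ 𝒜 d) :
    gradedSum 𝒜 f a = f d ⟨a, ha⟩ := by
  change DirectSum.toModule k (ZMod 2) E f (DirectSum.decompose 𝒜 a) = _
  rw [DirectSum.decompose_of_mem 𝒜 ha]
  exact DirectSum.toModule_lof k d _

theorem bilinear_ext_of_homogeneous (𝒜 : ZMod 2 → Submodule k R) [GradedAlgebra 𝒜] {E : Type*}
    [AddCommGroup E] [Module k E] {F G : R →ₗ[k] R →ₗ[k] E}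
    (h : ∀ (d e : ZMod 2) (a b : R), a ∈ 𝒜 d → b ∈ 𝒜 e → F a b = G a b) (a b : R) :
    F a b = G a b := by
  revert a
  refine graded_induction 𝒜 (fun a a' ha ha' => ?_) fun d a ha => ?_
  · rw [map_add, map_add, LinearMap.add_apply, LinearMap.add_apply, ha, ha']
  · revert b
    refine graded_induction 𝒜 (fun b b' hb hb' => ?_) fun e b hb => h d e a b ha hb
    rw [map_add, map_add, hb, hb']

variable {𝒜 : ZMod 2 → Submodule k R} [GradedAlgebra 𝒜] {σ : Superinvolution 𝒜} {m : ℕ}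

section Criterion

variable {E : Type w} [AddCommGroup E] [Module k E] [LieSuperalgebra k E]
  {u : Fin m ⊕ Fin m → Fin m ⊕ Fin m → R →ₗ[k] E}

theorem bracket_eq_of_homogeneous {F G H : R →ₗ[k] E}
    (h : ∀ (d e : ZMod 2) (a : 𝒜 d) (b : 𝒜 e), bracket (k := k) (F a) (G b) = H (a * b))
    (a b : R) : bracket (k := k) (F a) (G b) = H (a * b) :=
  bilinear_ext_of_homogeneous 𝒜 (F := (bracket (k := k)).compl₁₂ F G)
    (G := (LinearMap.mul k R).compr₂ H) (fun d e a b ha hb => h d e ⟨a, ha⟩ ⟨b, hb⟩) a b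

theorem bracket_eq_zero_of_homogeneous {F G : R →ₗ[k] E}
    (h : ∀ (d e : ZMod 2) (a : 𝒜 d) (b : 𝒜 e), bracket (k := k) (F a) (G b) = 0)
    (a b : R) : bracket (k := k) (F a) (G b) = 0 :=
  bracket_eq_of_homogeneous (H := 0) h a b

/-- If the bracket relation for `u_{pq}` and `u_{qr}` holds, so does its transpose. -/
theorem bracket_mul_transpose
    (hmem : ∀ {p q : Fin m ⊕ Fin m} {d : ZMod 2} {a : R}, indexClass p ≠ indexClass q →
      a ∈ 𝒜 d → u p q a ∈ grade (k := k) (indexParity p + indexParity q + d))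
    (hsymm : ∀ {p q : Fin m ⊕ Fin m}, indexClass p ≠ indexClass q → ∀ a : R,
      u p q a = -u q.swap p.swap (entryConj σ p q a))
    {p q r : Fin m ⊕ Fin m} (hpq : indexClass p ≠ indexClass q)
    (hqr : indexClass q ≠ indexClass r) (hpr : indexClass p ≠ indexClass r)
    (h : ∀ a b : R, bracket (k := k) (u r.swap q.swap a) (u q.swap p.swap b) =
      u r.swap p.swap (a * b)) (a b : R) :
    bracket (k := k) (u p q a) (u q r b) = u p r (a * b) := by
  revert a b
  refine bracket_eq_of_homogeneous (𝒜 := 𝒜) fun d e a b => ?_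
  rw [bracket_skew (hmem hpq a.2) (hmem hqr b.2), hsymm hpq, hsymm hqr, hsymm hpr,
    entryConj_mul σ p q r a.2 b.2, map_neg, map_neg, LinearMap.neg_apply, neg_neg, h,
    Units.smul_def, Units.smul_def, map_zsmul]

/-- A criterion for a family of maps to be a system: it is enough to consider indices that
correspond to the generators `𝐭`, `𝐟` and `𝐠`. -/
noncomputable def SteinbergSystem.ofRelations
    (u : Fin m ⊕ Fin m → Fin m ⊕ Fin m → R →ₗ[k] E)
    (hmem : ∀ {p q : Fin m ⊕ Fin m} {d : ZMod 2} {a : R}, indexClass p ≠ indexClass q →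
      a ∈ 𝒜 d → u p q a ∈ grade (k := k) (indexParity p + indexParity q + d))
    (hsymm : ∀ {p q : Fin m ⊕ Fin m}, indexClass p ≠ indexClass q → ∀ a : R,
      u p q a = -u q.swap p.swap (entryConj σ p q a))
    (htt : ∀ {i j l : Fin m}, i ≠ j → j ≠ l → i ≠ l → ∀ a b : R,
      bracket (k := k) (u (.inl i) (.inl j) a) (u (.inl j) (.inl l) b) =
        u (.inl i) (.inl l) (a * b))
    (htf : ∀ {i j l : Fin m}, i ≠ j → j ≠ l → i ≠ l → ∀ a b : R,
      bracket (k := k) (u (.inl i) (.inl j) a) (u (.inl j) (.inr l) b) =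
        u (.inl i) (.inr l) (a * b))
    (hgt : ∀ {i j l : Fin m}, i ≠ j → j ≠ l → i ≠ l → ∀ a b : R,
      bracket (k := k) (u (.inr i) (.inl j) a) (u (.inl j) (.inl l) b) =
        u (.inr i) (.inl l) (a * b))
    (hfg : ∀ {i j l : Fin m}, i ≠ j → j ≠ l → i ≠ l → ∀ a b : R,
      bracket (k := k) (u (.inl i) (.inr j) a) (u (.inr j) (.inl l) b) =
        u (.inl i) (.inl l) (a * b))
    (htt0 : ∀ {i j l n : Fin m}, i ≠ j → j ≠ l → l ≠ n → n ≠ i → ∀ a b : R,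
      bracket (k := k) (u (.inl i) (.inl j) a) (u (.inl l) (.inl n) b) = 0)
    (htf0 : ∀ {i j l n : Fin m}, i ≠ j → j ≠ l → l ≠ n → n ≠ j → ∀ a b : R,
      bracket (k := k) (u (.inl i) (.inl j) a) (u (.inl l) (.inr n) b) = 0)
    (hgt0 : ∀ {i j l n : Fin m}, i ≠ j → i ≠ l → l ≠ j → l ≠ n → ∀ a b : R,
      bracket (k := k) (u (.inr i) (.inl j) a) (u (.inl l) (.inl n) b) = 0)
    (hff0 : ∀ {i j l n : Fin m}, i ≠ j → l ≠ n → ∀ a b : R,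
      bracket (k := k) (u (.inl i) (.inr j) a) (u (.inl l) (.inr n) b) = 0)
    (hgg0 : ∀ {i j l n : Fin m}, i ≠ j → l ≠ n → ∀ a b : R,
      bracket (k := k) (u (.inr i) (.inl j) a) (u (.inr l) (.inl n) b) = 0)
    (hfg0 : ∀ {i j l n : Fin m}, i ≠ j → i ≠ l → i ≠ n → j ≠ l → j ≠ n → l ≠ n → ∀ a b : R,
      bracket (k := k) (u (.inl i) (.inr j) a) (u (.inr l) (.inl n) b) = 0) :
    SteinbergSystem σ m E where
  u := u
  mem := hmem
  symm := hsymm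
  mul {p q r} hpq hqr hpr a b := by
    -- Of the eight block patterns four are relations of the presentation; the other four are their
    -- transposes.
    have ht := bracket_mul_transpose (σ := σ) hmem hsymm hpq hqr hpr
    rcases p with p | p <;> rcases q with q | q <;> rcases r with r | r <;>
      simp only [indexClass_inl, indexClass_inr] at hpq hqr hpr
    · exact htt hpq hqr hpr a b
    · exact htf hpq hqr hpr a b
    · exact hfg hpq hqr hpr a b
    · exact ht (htf hqr.symm hpq.symm hpr.symm) a b
    · exact hgt hpq hqr hpr a b
    · exact ht (hfg hqr.symm hpq.symm hpr.symm) a b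
    · exact ht (hgt hqr.symm hpq.symm hpr.symm) a b
    · exact ht (htt hqr.symm hpq.symm hpr.symm) a b
  zero {p q r s} hpq hrs hqr hps hpr hqs a b := by
    have hskew : ∀ {p q r s : Fin m ⊕ Fin m}, indexClass p ≠ indexClass q →
        indexClass r ≠ indexClass s →
        (∀ a b : R, bracket (k := k) (u r s a) (u p q b) = 0) →
        ∀ a b : R, bracket (k := k) (u p q a) (u r s b) = 0 := fun hpq hrs h =>
      bracket_eq_zero_of_homogeneous (𝒜 := 𝒜) fun d e a b => by
        rw [bracket_skew (hmem hpq a.2) (hmem hrs b.2), h, smul_zero, neg_zero]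
    revert a b
    -- An element of the lower right block is minus one of the upper left block, so each factor may
    -- be assumed to be of type `𝐭`, `𝐟` or `𝐠`. The hypotheses on the indices are invariant under
    -- this change.
    wlog hp : ∀ i j, p = .inr i → q ≠ .inr j generalizing p q with H
    · push Not at hp
      obtain ⟨i, j, rfl, rfl⟩ := hp
      intro a b
      have := H (p := .inl j) (q := .inl i) hpq.symm (fun h => hpr (by rw [← h]; rfl))
        (fun h => hqs (by rw [← h]; rfl)) (fun h => hqr (by rw [← r.swap_swap, ← h]; rfl))
        (fun h => hps (by rw [← s.swap_swap, ← h]; rfl)) (fun _ _ h => nomatch h) (entryConj σ (.inr i) (.inr j) a) b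
      rw [hsymm hpq, map_neg, LinearMap.neg_apply]
      exact neg_eq_zero.2 this
    wlog hr : ∀ i j, r = .inr i → s ≠ .inr j generalizing r s with H
    · push Not at hr
      obtain ⟨i, j, rfl, rfl⟩ := hr
      intro a b
      have := H (r := .inl j) (s := .inl i) hrs.symm hqs hpr hps hqr (fun _ _ h => nomatch h) a
        (entryConj σ (.inr i) (.inr j) b)
      rw [hsymm hrs, map_neg]
      exact neg_eq_zero.2 this
    -- Nine pairs of types remain: six are relations of the presentation, three are their reversals.
    rcases p with i | i <;> rcases q with j | j <;> rcases r with l | l <;> rcases s with n | n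
    all_goals first
      | exact absurd rfl (hp _ _ rfl)
      | exact absurd rfl (hr _ _ rfl)
      | skip
    all_goals
      simp only [indexClass_inl, indexClass_inr, Sum.swap_inl, Sum.swap_inr, ne_eq,
        Sum.inl.injEq, Sum.inr.injEq, reduceCtorEq, not_false_eq_true] at hpq hrs hqr hps hpr hqs
    · exact htt0 hpq hqr hrs (Ne.symm hps)
    · exact htf0 hpq hqr hrs (Ne.symm hqs)
    · exact hskew hpq hrs (hgt0 hrs (Ne.symm hpr) hps (by assumption))
    · exact hskew hpq hrs (htf0 hrs (Ne.symm hps) hpq hqs)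
    · exact hff0 hpq hrs
    · exact hfg0 hpq hpr hps hqr hqs hrs
    · exact hgt0 hpq hpr (Ne.symm hqr) hrs
    · exact hskew hpq hrs (hfg0 hrs (Ne.symm hpr) (Ne.symm hqr) (Ne.symm hps) (Ne.symm hqs) hpq)
    · exact hgg0 hpq hrs

end Criterion

end Steinberg

/-! ### The Steinberg algebra carries the universal system -/

section Steinberg

open LieSuperalgebra

variable {k : Type u} {R : Type v} [CommRing k] [Ring R] [Algebra k R]
  {𝒜 : ZMod 2 → Submodule k R} [GradedAlgebra 𝒜] (σ : Superinvolution 𝒜) {m : ℕ}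

namespace Stp

/-- The quotient map from the free superalgebra. -/
noncomputable def mk (m : ℕ) : FreeNonUnitalNonAssocAlgebra k (StpGen 𝒜 m) →ₗ[k] Stp σ m :=
  PresentedLieSuperalgebra.mk StpGen.parity (StpRel σ m) (homogeneous_stpRel σ m)

theorem mk_eq_zero {x : FreeNonUnitalNonAssocAlgebra k (StpGen 𝒜 m)} (hx : StpRel σ m x) :
    mk σ m x = 0 :=
  PresentedLieSuperalgebra.mk_eq_zero_of_rel hx

theorem mk_mul (x y : FreeNonUnitalNonAssocAlgebra k (StpGen 𝒜 m)) :
    mk σ m (x * y) = bracket (k := k) (mk σ m x) (mk σ m y) := rfl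

/-- The map `a ↦ 𝐭_{ij}(a)`. -/
noncomputable def tMap {i j : Fin m} (hij : i ≠ j) : R →ₗ[k] Stp σ m :=
  gradedSum 𝒜 fun d =>
    { toFun := fun a : 𝒜 d => Stp.t σ hij a
      map_add' := fun a b => by
        have := mk_eq_zero σ (.t_add hij a b)
        rwa [map_sub, map_add, sub_eq_zero] at this
      map_smul' := fun c a => by
        have := mk_eq_zero σ (.t_smul hij c a)
        rwa [map_sub, map_smul, sub_eq_zero] at this }

/-- The map `a ↦ 𝐟_{ij}(a)`. -/
noncomputable def fMap {i j : Fin m} (hij : i ≠ j) : R →ₗ[k] Stp σ m :=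
  gradedSum 𝒜 fun d =>
    { toFun := fun a : 𝒜 d => Stp.f σ hij a
      map_add' := fun a b => by
        have := mk_eq_zero σ (.f_add hij a b)
        rwa [map_sub, map_add, sub_eq_zero] at this
      map_smul' := fun c a => by
        have := mk_eq_zero σ (.f_smul hij c a)
        rwa [map_sub, map_smul, sub_eq_zero] at this }

/-- The map `a ↦ 𝐠_{ij}(a)`. -/
noncomputable def gMap {i j : Fin m} (hij : i ≠ j) : R →ₗ[k] Stp σ m :=
  gradedSum 𝒜 fun d =>
    { toFun := fun a : 𝒜 d => Stp.g σ hij a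
      map_add' := fun a b => by
        have := mk_eq_zero σ (.g_add hij a b)
        rwa [map_sub, map_add, sub_eq_zero] at this
      map_smul' := fun c a => by
        have := mk_eq_zero σ (.g_smul hij c a)
        rwa [map_sub, map_smul, sub_eq_zero] at this }

theorem tMap_coe {i j : Fin m} (hij : i ≠ j) {d : ZMod 2} (a : 𝒜 d) :
    tMap σ hij (a : R) = mk σ m (freeT hij a) := gradedSum_of_mem 𝒜 _ a.2

theorem fMap_coe {i j : Fin m} (hij : i ≠ j) {d : ZMod 2} (a : 𝒜 d) :
    fMap σ hij (a : R) = mk σ m (freeF hij a) := gradedSum_of_mem 𝒜 _ a.2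

theorem gMap_coe {i j : Fin m} (hij : i ≠ j) {d : ZMod 2} (a : 𝒜 d) :
    gMap σ hij (a : R) = mk σ m (freeG hij a) := gradedSum_of_mem 𝒜 _ a.2

theorem fMap_bar {i j : Fin m} (hij : i ≠ j) (a : R) :
    fMap σ hij (σ.toLinearMap a) = fMap σ hij.symm (parityMap 𝒜 a) := by
  revert a
  refine graded_induction 𝒜 (fun a b ha hb => by simp only [map_add, ha, hb]) fun d a ha => ?_
  have := mk_eq_zero σ (.f_bar hij ⟨a, ha⟩)
  rw [map_sub, sub_eq_zero, ← fMap_coe, ← fMap_coe] at this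
  exact this

theorem gMap_bar {i j : Fin m} (hij : i ≠ j) (a : R) :
    gMap σ hij (σ.toLinearMap a) = -gMap σ hij.symm (parityMap 𝒜 a) := by
  revert a
  refine graded_induction 𝒜 (fun a b ha hb => by simp only [map_add, ha, hb, neg_add])
    fun d a ha => ?_
  have := mk_eq_zero σ (.g_bar hij ⟨a, ha⟩)
  rw [map_add, ← gMap_coe, ← gMap_coe] at this
  exact eq_neg_of_add_eq_zero_left this

theorem _root_.Superinvolution.apply_parityMap (a : R) :
    σ.toLinearMap (parityMap 𝒜 a) = parityMap 𝒜 (σ.toLinearMap a) := by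
  revert a
  refine graded_induction 𝒜 (fun a b ha hb => by simp only [map_add, ha, hb]) fun d a ha => ?_
  have h : σ.toLinearMap a ∈ 𝒜 d := σ.map_mem ha
  rw [parityMap_of_mem 𝒜 ha, parityMap_of_mem 𝒜 h, Units.smul_def, Units.smul_def, map_zsmul]

/-- The elements `u_{pq}(a)` of the Steinberg periplectic Lie superalgebra. -/
noncomputable def root : Fin m ⊕ Fin m → Fin m ⊕ Fin m → R →ₗ[k] Stp σ m
  | .inl i, .inl j => if h : i ≠ j then tMap σ h else 0
  | .inl i, .inr j => if h : i ≠ j then fMap σ h else 0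
  | .inr i, .inl j => if h : i ≠ j then gMap σ h else 0
  | .inr i, .inr j => if h : j ≠ i then -(tMap σ h ∘ₗ σ.toLinearMap) else 0

theorem root_inl_inl {i j : Fin m} (hij : i ≠ j) : root σ (.inl i) (.inl j) = tMap σ hij :=
  dif_pos hij

theorem root_inl_inr {i j : Fin m} (hij : i ≠ j) : root σ (.inl i) (.inr j) = fMap σ hij :=
  dif_pos hij

theorem root_inr_inl {i j : Fin m} (hij : i ≠ j) : root σ (.inr i) (.inl j) = gMap σ hij :=
  dif_pos hij

theorem root_inr_inr {i j : Fin m} (hji : j ≠ i) :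
    root σ (.inr i) (.inr j) = -(tMap σ hji ∘ₗ σ.toLinearMap) :=
  dif_pos hji

theorem mk_of_mem (x : StpGen 𝒜 m) :
    mk σ m (.of k x) ∈ grade (k := k) (L := Stp σ m) (StpGen.parity x) :=
  ⟨_, of_mem_freeGrade StpGen.parity x, rfl⟩

theorem root_mem {p q : Fin m ⊕ Fin m} {d : ZMod 2} {a : R} (hpq : indexClass p ≠ indexClass q)
    (ha : a ∈ 𝒜 d) : root σ p q a ∈ grade (k := k) (indexParity p + indexParity q + d) := by
  have ht : ∀ {i j : Fin m} (hij : i ≠ j) {a : R}, a ∈ 𝒜 d → tMap σ hij a ∈ grade (k := k) d :=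
    fun hij a ha => tMap_coe σ hij ⟨a, ha⟩ ▸ mk_of_mem σ (.t _ _ hij d ⟨a, ha⟩)
  rcases p with i | i <;> rcases q with j | j <;> simp only [indexParity, Sum.elim_inl,
    Sum.elim_inr, zero_add, add_zero, CharTwo.add_self_eq_zero, indexClass_inl,
    indexClass_inr] at hpq ⊢
  · rw [root_inl_inl σ hpq]
    exact ht hpq ha
  · rw [root_inl_inr σ hpq, add_comm]
    exact fMap_coe σ hpq ⟨a, ha⟩ ▸ mk_of_mem σ (.f _ _ hpq d ⟨a, ha⟩)
  · rw [root_inr_inl σ hpq, add_comm]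
    exact gMap_coe σ hpq ⟨a, ha⟩ ▸ mk_of_mem σ (.g _ _ hpq d ⟨a, ha⟩)
  · rw [root_inr_inr σ (Ne.symm hpq), LinearMap.neg_apply]
    exact neg_mem (ht _ (σ.map_mem ha))

/-- On the diagonal blocks this is built into `root`; on the other two it is the relation `f_bar` or
`g_bar`, rewritten by means of the involutivity of `σ` and its commuting with the parity map. -/
theorem root_symm {p q : Fin m ⊕ Fin m} (hpq : indexClass p ≠ indexClass q) (a : R) :
    root σ p q a = -root σ q.swap p.swap (entryConj σ p q a) := by
  have hf : ∀ {i j : Fin m} (hij : i ≠ j) (a : R),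
      fMap σ hij a = fMap σ hij.symm (σ.toLinearMap (parityMap 𝒜 a)) := fun hij a => by
    rw [σ.apply_parityMap, ← fMap_bar, σ.apply_apply]
  have hg : ∀ {i j : Fin m} (hij : i ≠ j) (a : R),
      gMap σ hij a = -gMap σ hij.symm (σ.toLinearMap (parityMap 𝒜 a)) := fun hij a => by
    rw [σ.apply_parityMap, ← gMap_bar, σ.apply_apply]
  rcases p with i | i <;> rcases q with j | j <;> simp only [Sum.swap_inl, Sum.swap_inr, entryConj,
    LinearMap.neg_apply, map_neg, neg_neg, LinearMap.comp_apply, indexClass_inl, indexClass_inr] at hpq ⊢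
  · rw [root_inl_inl σ hpq, root_inr_inr σ hpq, LinearMap.neg_apply, neg_neg, LinearMap.comp_apply,
      σ.apply_apply]
  · rw [root_inl_inr σ hpq, root_inl_inr σ (Ne.symm hpq)]
    exact hf hpq a
  · rw [root_inr_inl σ hpq, root_inr_inl σ (Ne.symm hpq)]
    exact hg hpq a
  · rw [root_inr_inr σ (Ne.symm hpq), root_inl_inl σ (Ne.symm hpq)]
    rfl

/-- The generators of the Steinberg periplectic Lie superalgebra form a system. -/
noncomputable def system (m : ℕ) : SteinbergSystem σ m (Stp σ m) :=
  .ofRelations (root σ) (root_mem σ) (root_symm σ)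
    (fun hij hjl hil => by
      rw [root_inl_inl σ hij, root_inl_inl σ hjl, root_inl_inl σ hil]
      refine bracket_eq_of_homogeneous (𝒜 := 𝒜) fun d e a b => ?_
      have := mk_eq_zero σ (.t_t hij hjl hil a b)
      rwa [map_sub, sub_eq_zero, mk_mul, ← tMap_coe, ← tMap_coe, ← tMap_coe] at this)
    (fun hij hjl hil => by
      rw [root_inl_inl σ hij, root_inl_inr σ hjl, root_inl_inr σ hil]
      refine bracket_eq_of_homogeneous (𝒜 := 𝒜) fun d e a b => ?_
      have := mk_eq_zero σ (.t_f hij hjl hil a b)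
      rwa [map_sub, sub_eq_zero, mk_mul, ← tMap_coe, ← fMap_coe, ← fMap_coe] at this)
    (fun hij hjl hil => by
      rw [root_inr_inl σ hij, root_inl_inl σ hjl, root_inr_inl σ hil]
      refine bracket_eq_of_homogeneous (𝒜 := 𝒜) fun d e a b => ?_
      have := mk_eq_zero σ (.g_t hij hjl hil a b)
      rwa [map_sub, sub_eq_zero, mk_mul, ← tMap_coe, ← gMap_coe, ← gMap_coe] at this)
    (fun hij hjl hil => by
      rw [root_inl_inr σ hij, root_inr_inl σ hjl, root_inl_inl σ hil]
      refine bracket_eq_of_homogeneous (𝒜 := 𝒜) fun d e a b => ?_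
      have := mk_eq_zero σ (.f_g hij hjl hil a b)
      rwa [map_sub, sub_eq_zero, mk_mul, ← fMap_coe, ← gMap_coe, ← tMap_coe] at this)
    (fun hij hjl hln hni => by
      rw [root_inl_inl σ hij, root_inl_inl σ hln]
      refine bracket_eq_zero_of_homogeneous (𝒜 := 𝒜) fun d e a b => ?_
      have := mk_eq_zero σ (.t_t_zero hij hjl hln hni a b)
      rwa [mk_mul, ← tMap_coe, ← tMap_coe] at this)
    (fun hij hjl hln hnj => by
      rw [root_inl_inl σ hij, root_inl_inr σ hln]
      refine bracket_eq_zero_of_homogeneous (𝒜 := 𝒜) fun d e a b => ?_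
      have := mk_eq_zero σ (.t_f_zero hij hjl hln hnj a b)
      rwa [mk_mul, ← tMap_coe, ← fMap_coe] at this)
    (fun hij hil hlj hln => by
      rw [root_inr_inl σ hij, root_inl_inl σ hln]
      refine bracket_eq_zero_of_homogeneous (𝒜 := 𝒜) fun d e a b => ?_
      have := mk_eq_zero σ (.g_t_zero hij hil hlj hln a b)
      rwa [mk_mul, ← tMap_coe, ← gMap_coe] at this)
    (fun hij hln => by
      rw [root_inl_inr σ hij, root_inl_inr σ hln]
      refine bracket_eq_zero_of_homogeneous (𝒜 := 𝒜) fun d e a b => ?_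
      have := mk_eq_zero σ (.f_f hij hln a b)
      rwa [mk_mul, ← fMap_coe, ← fMap_coe] at this)
    (fun hij hln => by
      rw [root_inr_inl σ hij, root_inr_inl σ hln]
      refine bracket_eq_zero_of_homogeneous (𝒜 := 𝒜) fun d e a b => ?_
      have := mk_eq_zero σ (.g_g hij hln a b)
      rwa [mk_mul, ← gMap_coe, ← gMap_coe] at this)
    (fun hij hil hin hjl hjn hln => by
      rw [root_inl_inr σ hij, root_inr_inl σ hln]
      refine bracket_eq_zero_of_homogeneous (𝒜 := 𝒜) fun d e a b => ?_
      have := mk_eq_zero σ (.f_g_zero hij hil hin hjl hjn hln a b)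
      rwa [mk_mul, ← fMap_coe, ← gMap_coe] at this)

theorem system_u (m : ℕ) : (system σ m).u = root σ := rfl

end Stp

/-! ### Homomorphisms defined by systems -/

variable {σ} {E : Type w} [AddCommGroup E] [Module k E] [LieSuperalgebra k E]

/-- The images of the generators under the homomorphism that is defined by a system. -/
noncomputable def SteinbergSystem.onGen (S : SteinbergSystem σ m E) : StpGen 𝒜 m → E
  | .t i j _ _ a => S.u (.inl i) (.inl j) a
  | .f i j _ _ a => S.u (.inl i) (.inr j) a
  | .g i j _ _ a => S.u (.inr i) (.inl j) a

theorem SteinbergSystem.exists_hom_onGen (S : SteinbergSystem σ m E) :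
    ∃ φ : Hom k (Stp σ m) E, ∀ x, φ (PresentedLieSuperalgebra.gen _ _ _ x) = S.onGen x := by
  refine PresentedLieSuperalgebra.exists_hom S.onGen (fun x => ?_) fun F hF hmul x hx => ?_
  · rcases x with ⟨i, j, hij, d, a⟩ | ⟨i, j, hij, d, a⟩ | ⟨i, j, hij, d, a⟩
    · have := S.mem (p := .inl i) (q := .inl j) hij a.2
      simp only [indexParity, Sum.elim_inl, zero_add] at this
      exact this
    · have := S.mem (p := .inl i) (q := .inr j) hij a.2
      simp only [indexParity, Sum.elim_inl, Sum.elim_inr, zero_add] at this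
      rw [add_comm] at this
      exact this
    · have := S.mem (p := .inr i) (q := .inl j) hij a.2
      simp only [indexParity, Sum.elim_inl, Sum.elim_inr, add_zero] at this
      rw [add_comm] at this
      exact this
  · have ht : ∀ {i j : Fin m} (hij : i ≠ j) {d : ZMod 2} (a : 𝒜 d),
        F (freeT hij a) = S.u (.inl i) (.inl j) a := fun hij d a => hF _
    have hf : ∀ {i j : Fin m} (hij : i ≠ j) {d : ZMod 2} (a : 𝒜 d),
        F (freeF hij a) = S.u (.inl i) (.inr j) a := fun hij d a => hF _
    have hg : ∀ {i j : Fin m} (hij : i ≠ j) {d : ZMod 2} (a : 𝒜 d),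
        F (freeG hij a) = S.u (.inr i) (.inl j) a := fun hij d a => hF _
    cases hx with
    | t_add hij a b => rw [map_sub, map_add, ht, ht, ht, Submodule.coe_add, map_add, sub_self]
    | t_smul hij c a => rw [map_sub, map_smul, ht, ht, Submodule.coe_smul, map_smul, sub_self]
    | f_add hij a b => rw [map_sub, map_add, hf, hf, hf, Submodule.coe_add, map_add, sub_self]
    | f_smul hij c a => rw [map_sub, map_smul, hf, hf, Submodule.coe_smul, map_smul, sub_self]
    | g_add hij a b => rw [map_sub, map_add, hg, hg, hg, Submodule.coe_add, map_add, sub_self]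
    | g_smul hij c a => rw [map_sub, map_smul, hg, hg, Submodule.coe_smul, map_smul, sub_self]
    | @f_bar i j hij d a =>
      rw [map_sub, hf, hf, sub_eq_zero]
      -- The minus sign of `symm` cancels the one in `entryConj` on the upper right block; on the
      -- lower left block, treated next, it survives as the sign in `g_bar`.
      refine (S.symm (p := .inl i) (q := .inr j) hij (σ.toLinearMap a)).trans ?_
      simp only [entryConj, LinearMap.neg_apply, LinearMap.comp_apply, map_neg, neg_neg,
        σ.apply_parityMap, σ.apply_apply]
      rfl
    | @g_bar i j hij d a =>
      rw [map_add, hg, hg, add_eq_zero_iff_eq_neg]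
      refine (S.symm (p := .inr i) (q := .inl j) hij (σ.toLinearMap a)).trans ?_
      simp only [entryConj, LinearMap.comp_apply, σ.apply_parityMap, σ.apply_apply]
      rfl
    | t_t hij hjl hil a b =>
      rw [map_sub, hmul, ht, ht, ht, S.mul (by exact hij) (by exact hjl) (by exact hil)]
      exact sub_self _
    | t_f hij hjl hil a b =>
      rw [map_sub, hmul, ht, hf, hf, S.mul (by exact hij) (by exact hjl) (by exact hil)]
      exact sub_self _
    | g_t hij hjl hil a b =>
      rw [map_sub, hmul, hg, ht, hg, S.mul (by exact hij) (by exact hjl) (by exact hil)]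
      exact sub_self _
    | f_g hij hjl hil a b =>
      rw [map_sub, hmul, hf, hg, ht, S.mul (by exact hij) (by exact hjl) (by exact hil)]
      exact sub_self _
    | t_t_zero hij hjl hln hni a b =>
      rw [hmul, ht, ht]
      exact S.zero (by exact hij) (by exact hln) (by simpa) (by simpa using hni.symm) (by simp) (by simp) _ _
    | t_f_zero hij hjl hln hnj a b =>
      rw [hmul, ht, hf]
      exact S.zero (by exact hij) (by exact hln) (by simpa) (by simp) (by simp) (by simpa using hnj.symm) _ _
    | g_t_zero hij hil hlj hln a b =>
      rw [hmul, hg, ht]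
      exact S.zero (by exact hij) (by exact hln) (by simpa using hlj.symm) (by simp) (by simpa) (by simp) _ _
    | f_f hij hln a b =>
      rw [hmul, hf, hf]
      exact S.zero (by exact hij) (by exact hln) (by simp) (by simp) (by simp) (by simp) _ _
    | g_g hij hln a b =>
      rw [hmul, hg, hg]
      exact S.zero (by exact hij) (by exact hln) (by simp) (by simp) (by simp) (by simp) _ _
    | f_g_zero hij hil hin hjl hjn hln a b =>
      rw [hmul, hf, hg]
      exact S.zero (by exact hij) (by exact hln) (by simpa) (by simpa) (by simpa) (by simpa) _ _

/-- A system defines a homomorphism from the Steinberg periplectic Lie superalgebra. -/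
theorem SteinbergSystem.exists_hom (S : SteinbergSystem σ m E) : ∃ φ : Hom k (Stp σ m) E,
    ∀ p q, indexClass p ≠ indexClass q → ∀ a, φ ((Stp.system σ m).u p q a) = S.u p q a := by
  obtain ⟨φ, hφ⟩ := S.exists_hom_onGen
  have ht : ∀ {i j : Fin m}, i ≠ j → ∀ a, φ (Stp.root σ (.inl i) (.inl j) a) =
      S.u (.inl i) (.inl j) a := fun {i j} hij => graded_induction 𝒜
    (fun a b ha hb => by simp only [map_add, ha, hb]) fun d a ha => by
      rw [Stp.root_inl_inl σ hij]
      exact (congrArg φ (Stp.tMap_coe σ hij ⟨a, ha⟩)).trans (hφ (.t i j hij d ⟨a, ha⟩))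
  refine ⟨φ, fun p q hpq => ?_⟩
  rw [Stp.system_u]
  rcases p with i | i <;> rcases q with j | j
  · exact ht hpq
  · exact graded_induction 𝒜 (fun a b ha hb => by simp only [map_add, ha, hb]) fun d a ha => by
      rw [Stp.root_inl_inr σ (show i ≠ j from hpq)]
      exact (congrArg φ (Stp.fMap_coe σ hpq ⟨a, ha⟩)).trans (hφ (.f i j hpq d ⟨a, ha⟩))
  · exact graded_induction 𝒜 (fun a b ha hb => by simp only [map_add, ha, hb]) fun d a ha => by
      rw [Stp.root_inr_inl σ (show i ≠ j from hpq)]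
      exact (congrArg φ (Stp.gMap_coe σ hpq ⟨a, ha⟩)).trans (hφ (.g i j hpq d ⟨a, ha⟩))
  · intro a
    rw [Stp.root_symm σ hpq, S.symm hpq, map_neg, Sum.swap_inr, Sum.swap_inr, ht (show j ≠ i from Ne.symm hpq)]

/-- Every generator is one of the elements `u_{pq}(a)`. -/
theorem Stp.exists_gen_eq (x : StpGen 𝒜 m) : ∃ p q a, indexClass p ≠ indexClass q ∧
    (PresentedLieSuperalgebra.gen _ _ _ x : Stp σ m) = (Stp.system σ m).u p q a := by
  rw [Stp.system_u]
  rcases x with ⟨i, j, hij, d, a⟩ | ⟨i, j, hij, d, a⟩ | ⟨i, j, hij, d, a⟩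
  · exact ⟨.inl i, .inl j, a, hij, by rw [root_inl_inl σ hij, tMap_coe]; rfl⟩
  · exact ⟨.inl i, .inr j, a, hij, by rw [root_inl_inr σ hij, fMap_coe]; rfl⟩
  · exact ⟨.inr i, .inl j, a, hij, by rw [root_inr_inl σ hij, gMap_coe]; rfl⟩

theorem Stp.t_eq {i j : Fin m} (hij : i ≠ j) {d : ZMod 2} (a : 𝒜 d) :
    Stp.t σ hij a = (Stp.system σ m).u (.inl i) (.inl j) a := by
  rw [system_u, root_inl_inl σ hij, tMap_coe]; rfl

theorem Stp.f_eq {i j : Fin m} (hij : i ≠ j) {d : ZMod 2} (a : 𝒜 d) :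
    Stp.f σ hij a = (Stp.system σ m).u (.inl i) (.inr j) a := by
  rw [system_u, root_inl_inr σ hij, fMap_coe]; rfl

theorem Stp.g_eq {i j : Fin m} (hij : i ≠ j) {d : ZMod 2} (a : 𝒜 d) :
    Stp.g σ hij a = (Stp.system σ m).u (.inr i) (.inl j) a := by
  rw [system_u, root_inr_inl σ hij, gMap_coe]; rfl

end Steinberg

/-! ### The matrices `e_pq(a) - e_pq(a)^prp` and their brackets -/

section Periplectic

open LieSuperalgebra

variable {k : Type u} {R : Type v} [CommRing k] [Ring R] [Algebra k R]
  {𝒜 : ZMod 2 → Submodule k R} [GradedAlgebra 𝒜] (σ : Superinvolution 𝒜) {m : ℕ}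

variable (𝒜) in
/-- The map `a ↦ e_{pq}(a)`. -/
noncomputable def matELinear (p q : Fin m ⊕ Fin m) : R →ₗ[k] SuperMatrix 𝒜 m :=
  Matrix.singleLinearMap k p q

omit [GradedAlgebra 𝒜] in
theorem matE_apply (p q i j : Fin m ⊕ Fin m) (a : R) :
    matE 𝒜 p q a i j = if p = i ∧ q = j then a else 0 := Matrix.single_apply ..

omit [GradedAlgebra 𝒜] in
theorem matE_mem (p q : Fin m ⊕ Fin m) {d : ZMod 2} {a : R} (ha : a ∈ 𝒜 d) :
    matE 𝒜 p q a ∈ SuperMatrix.grade 𝒜 m (indexParity p + indexParity q + d) := by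
  intro i j
  rw [matE_apply]
  split_ifs with h
  · obtain ⟨rfl, rfl⟩ := h
    rwa [← add_assoc, CharTwo.add_self_eq_zero, zero_add]
  · exact zero_mem _

omit [GradedAlgebra 𝒜] in
theorem matE_mul (p q r s : Fin m ⊕ Fin m) (a b : R) :
    matE 𝒜 p q a * matE 𝒜 r s b = if q = r then matE 𝒜 p s (a * b) else 0 := by
  split_ifs with h
  · subst h
    exact Matrix.single_mul_single_same ..
  · exact Matrix.single_mul_single_of_ne _ _ _ _ h _

theorem prp_matE (p q : Fin m ⊕ Fin m) (a : R) :
    prp σ m (matE 𝒜 p q a) = matE 𝒜 q.swap p.swap (entryConj σ p q a) := by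
  have h11 : ∀ (X : SuperMatrix 𝒜 m) (i j : Fin m),
    prp σ m X (.inl i) (.inl j) = σ.toLinearMap (X (.inr j) (.inr i)) := fun _ _ _ => rfl
  have h12 : ∀ (X : SuperMatrix 𝒜 m) (i j : Fin m), prp σ m X (.inl i) (.inr j) =
    -σ.toLinearMap (parityMap 𝒜 (X (.inl j) (.inr i))) := fun _ _ _ => rfl
  have h21 : ∀ (X : SuperMatrix 𝒜 m) (i j : Fin m), prp σ m X (.inr i) (.inl j) =
    σ.toLinearMap (parityMap 𝒜 (X (.inr j) (.inl i))) := fun _ _ _ => rfl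
  have h22 : ∀ (X : SuperMatrix 𝒜 m) (i j : Fin m),
    prp σ m X (.inr i) (.inr j) = σ.toLinearMap (X (.inl j) (.inl i)) := fun _ _ _ => rfl
  funext i j
  rw [matE_apply]
  rcases p with p | p <;> rcases q with q | q <;> rcases i with i | i <;> rcases j with j | j <;>
    simp only [h11, h12, h21, h22, matE_apply, Sum.swap_inl, Sum.swap_inr, Sum.inl.injEq,
      Sum.inr.injEq, reduceCtorEq, false_and, and_false, if_false, map_zero, neg_zero, entryConj,
      LinearMap.neg_apply, LinearMap.comp_apply, and_comm (a := p = _)] <;>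
    split_ifs <;> simp

/-- The element `e_{pq}(a) - e_{pq}(a)^prp` of the periplectic Lie superalgebra. -/
noncomputable def matX (p q : Fin m ⊕ Fin m) : R →ₗ[k] SuperMatrix 𝒜 m :=
  (LinearMap.id - prp σ m) ∘ₗ matELinear 𝒜 p q

theorem matX_eq_sub_prp (p q : Fin m ⊕ Fin m) (a : R) :
    matX σ p q a = matE 𝒜 p q a - prp σ m (matE 𝒜 p q a) := rfl

theorem matX_eq (p q : Fin m ⊕ Fin m) (a : R) :
    matX σ p q a = matE 𝒜 p q a - matE 𝒜 q.swap p.swap (entryConj σ p q a) := by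
  rw [matX_eq_sub_prp, prp_matE]

theorem matX_symm (p q : Fin m ⊕ Fin m) (a : R) :
    matX σ p q a = -matX σ q.swap p.swap (entryConj σ p q a) := by
  rw [matX_eq, matX_eq, entryConj_swap, Sum.swap_swap, Sum.swap_swap, neg_sub]

theorem prp_matX (p q : Fin m ⊕ Fin m) (a : R) : prp σ m (matX σ p q a) = -matX σ p q a := by
  rw [matX_eq, map_sub, prp_matE, prp_matE, entryConj_swap, Sum.swap_swap, Sum.swap_swap, neg_sub]

theorem matX_mem (p q : Fin m ⊕ Fin m) {d : ZMod 2} {a : R} (ha : a ∈ 𝒜 d) :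
    matX σ p q a ∈ SuperMatrix.grade 𝒜 m (indexParity p + indexParity q + d) :=
  sub_mem (matE_mem p q ha) (prp_mem σ m (matE_mem p q ha))

theorem matX_apply (p q : Fin m ⊕ Fin m) (a : R) (i j : Fin m ⊕ Fin m) : matX σ p q a i j =
    (if p = i ∧ q = j then a else 0) -
      if q.swap = i ∧ p.swap = j then entryConj σ p q a else 0 := by
  rw [matX_eq, ← matE_apply (𝒜 := 𝒜), ← matE_apply (𝒜 := 𝒜)]
  rfl

/-- Since `prp` reverses products up to sign, the eight products in the expansion pair into four
differences `z - z^prp`. For matrix units this makes every bracket a combination of at most four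
elements `matX`. -/
theorem bracket_sub_prp {d e : ZMod 2} {x y : SuperMatrix 𝒜 m}
    (hx : x ∈ SuperMatrix.grade 𝒜 m d) (hy : y ∈ SuperMatrix.grade 𝒜 m e)
    (hy2 : prp σ m (prp σ m y) = y) :
    bracket (k := k) (x - prp σ m x) (y - prp σ m y) =
      (x * y - prp σ m (x * y)) - (-1 : ℤˣ) ^ (d * e) • (y * x - prp σ m (y * x)) -
        (x * prp σ m y - prp σ m (x * prp σ m y)) +
        (-1 : ℤˣ) ^ (d * e) • (prp σ m y * x - prp σ m (prp σ m y * x)) := by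
  have hx' := prp_mem σ m hx
  have hy' := prp_mem σ m hy
  change superCommutator (SuperMatrix.grade 𝒜 m) _ _ = _
  rw [superCommutator_of_mem _ (sub_mem hx hx') (sub_mem hy hy'), prp_mul σ m hx hy,
    prp_mul σ m hy hx, prp_mul σ m hx hy', prp_mul σ m hy' hx, hy2, mul_comm e d]
  rcases Int.units_eq_one_or ((-1 : ℤˣ) ^ (d * e)) with h | h <;> rw [h] <;>
    simp only [one_smul, Units.neg_smul] <;> noncomm_ring

/-- The brackets of the elements `matX`. -/
theorem bracket_matX (p q r s : Fin m ⊕ Fin m) {d e : ZMod 2} {a b : R} (ha : a ∈ 𝒜 d)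
    (hb : b ∈ 𝒜 e) {ε : ℤˣ} (hε : (-1 : ℤˣ) ^ ((indexParity p + indexParity q + d) *
      (indexParity r + indexParity s + e)) = ε) :
    bracket (k := k) (matX σ p q a) (matX σ r s b) =
      (if q = r then matX σ p s (a * b) else 0) - ε • (if s = p then matX σ r q (b * a) else 0) -
        (if q = s.swap then matX σ p r.swap (a * entryConj σ r s b) else 0) +
        ε • (if r.swap = p then matX σ s.swap q (entryConj σ r s b * a) else 0) := by
  have h2 : prp σ m (prp σ m (matE 𝒜 r s b)) = matE 𝒜 r s b := by
    rw [prp_matE, prp_matE, entryConj_swap, Sum.swap_swap, Sum.swap_swap]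
  have h := bracket_sub_prp σ (matE_mem p q ha) (matE_mem r s hb) h2
  rw [hε] at h
  rw [matX_eq_sub_prp, matX_eq_sub_prp, h]
  simp only [prp_matE σ r s b, matE_mul]
  congr 1
  · congr 1
    · congr 1
      · split_ifs <;> simp [matX_eq_sub_prp]
      · split_ifs <;> simp [matX_eq_sub_prp]
    · split_ifs <;> simp [matX_eq_sub_prp]
  · split_ifs <;> simp [matX_eq_sub_prp]

end Periplectic

/-! ### Generation of the periplectic algebra by off-diagonal elements -/

section Periplectic

open LieSuperalgebra

variable {k : Type u} {R : Type v} [CommRing k] [Ring R] [Algebra k R]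
  {𝒜 : ZMod 2 → Submodule k R} [GradedAlgebra 𝒜] (σ : Superinvolution 𝒜) {m : ℕ}

theorem swap_ne_swap {α β : Type*} {p q : α ⊕ β} (h : p ≠ q) : p.swap ≠ q.swap :=
  fun e => h (Sum.swap_leftInverse.injective e)

theorem swap_ne_self (p : Fin m ⊕ Fin m) : p.swap ≠ p := by
  rcases p with i | i <;> simp

theorem bracket_matX_mul {p q r : Fin m ⊕ Fin m} (hpq : indexClass p ≠ indexClass q)
    (hqr : indexClass q ≠ indexClass r) (hpr : p ≠ r) (a b : R) :
    bracket (k := k) (matX σ p q a) (matX σ q r b) = matX σ p r (a * b) := by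
  revert a b
  refine bracket_eq_of_homogeneous (𝒜 := 𝒜) fun d e a b => ?_
  rw [bracket_matX σ p q q r a.2 b.2 rfl, if_pos rfl, if_neg hpr.symm,
    if_neg (ne_swap_of_indexClass_ne hqr), if_neg (ne_swap_of_indexClass_ne hpq).symm]
  simp

theorem bracket_matX_zero {p q r s : Fin m ⊕ Fin m} (hqr : q ≠ r) (hps : p ≠ s)
    (hpr : p ≠ r.swap) (hqs : q ≠ s.swap) (a b : R) :
    bracket (k := k) (matX σ p q a) (matX σ r s b) = 0 := by
  revert a b
  refine bracket_eq_zero_of_homogeneous (𝒜 := 𝒜) fun d e a b => ?_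
  rw [bracket_matX σ p q r s a.2 b.2 rfl, if_neg hqr, if_neg hps.symm, if_neg hqs,
    if_neg hpr.symm]
  simp

/-- Membership in the derived algebra needs a bracket: factor through a fresh index. This includes
`q = p.swap`. -/
theorem matX_mem_periplectic (hm : 5 ≤ m) {p q : Fin m ⊕ Fin m} (hpq : p ≠ q) (a : R) :
    matX σ p q a ∈ (periplectic σ m).toSubmodule := by
  obtain ⟨v, hvp, hvq, -, -⟩ :=
    exists_indexClass_ne hm (indexClass p) (indexClass q) (indexClass q) (indexClass q)
  rw [← one_mul a, ← bracket_matX_mul σ hvp.symm hvq hpq]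
  exact Submodule.subset_span ⟨_, prp_matX σ p v 1, _, prp_matX σ v q a, rfl⟩

/-- If `2` is invertible, then every `X` with `X^prp = -X` is a sum of elements `matX`. -/
theorem mem_span_matX (h2 : IsUnit (2 : k)) {X : SuperMatrix 𝒜 m} (hX : prp σ m X = -X) :
    X ∈ Submodule.span k {Y | ∃ p q d a, a ∈ 𝒜 d ∧ matX σ p q a = Y} := by
  have hmem : ∀ (p q : Fin m ⊕ Fin m) (a : R), matX σ p q a ∈
      Submodule.span k {Y | ∃ p q d a, a ∈ 𝒜 d ∧ matX σ p q a = Y} := fun p q =>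
    graded_induction 𝒜 (fun a b ha hb => map_add (matX σ p q) a b ▸ add_mem ha hb)
      fun d a ha => Submodule.subset_span ⟨p, q, d, a, ha, rfl⟩
  -- If `X^prp = -X`, then `2X = X - X^prp`, which is expanded over the matrix units.
  have h : (2 : k) • X = ∑ p, ∑ q, matX σ p q (X p q) := by
    have hs : X = ∑ p, ∑ q, matE 𝒜 p q (X p q) := Matrix.matrix_eq_sum_single _
    have h1 : (2 : k) • X = X - prp σ m X := by rw [hX, two_smul, sub_neg_eq_add]
    rw [h1]
    conv_lhs => rw [hs]
    simp only [map_sum, ← Finset.sum_sub_distrib, ← matX_eq_sub_prp]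
  rw [← Submodule.smul_mem_iff_of_isUnit _ h2, h]
  exact sum_mem fun p _ => sum_mem fun q _ => hmem _ _ _

/-- The left side is `matX p p` of the supercommutator of `a` and `b`. The loops through `v` with
coefficients `(a, b)` and `(1, b * a)` have, up to sign, the same component `matX v v (b * a)`, so a
suitable combination of them cancels it and leaves the desired bracket. -/
theorem matX_diag_mem (hm : 5 ≤ m) {N : Submodule k (SuperMatrix 𝒜 m)}
    (hN : ∀ p q, p ≠ q → ∀ a, matX σ p q a ∈ N)
    (hbr : ∀ x ∈ N, ∀ y ∈ N, bracket (k := k) x y ∈ N) (p : Fin m ⊕ Fin m) {d e : ZMod 2}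
    {a b : R} (ha : a ∈ 𝒜 d) (hb : b ∈ 𝒜 e) :
    bracket (k := k) (matX σ p p a) (matX σ p p b) ∈ N := by
  obtain ⟨v, hvp, -, -, -⟩ :=
    exists_indexClass_ne hm (indexClass p) (indexClass p) (indexClass p) (indexClass p)
  have h1 := SetLike.one_mem_graded 𝒜
  have hba : b * a ∈ 𝒜 (e + d) := SetLike.mul_mem_graded hb ha
  have key : bracket (k := k) (matX σ p p a) (matX σ p p b) =
      bracket (k := k) (matX σ p v a) (matX σ v p b) - (-1 : ℤˣ) ^ (d * e) •
        bracket (k := k) (matX σ p v 1) (matX σ v p (b * a)) := by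
    rw [bracket_matX σ p p p p ha hb (ε := (-1 : ℤˣ) ^ (d * e)) (by
        rw [CharTwo.add_self_eq_zero, zero_add, zero_add]),
      bracket_matX σ p v v p ha hb rfl, bracket_matX σ p v v p h1 hba
        (ε := (-1 : ℤˣ) ^ (d * e) * (-1 : ℤˣ) ^ ((indexParity p + indexParity v + d) *
          (indexParity v + indexParity p + e))) (by
        rw [← uzpow_add]
        generalize indexParity p = x
        generalize indexParity v = y
        clear ha hb hba
        revert x y d e
        decide)]
    simp only [if_true, if_neg (swap_ne_self p).symm, if_neg (swap_ne_self p),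
      if_neg (ne_swap_of_indexClass_ne hvp), if_neg (ne_swap_of_indexClass_ne hvp.symm).symm,
      smul_zero, sub_zero, add_zero, one_mul, mul_one, smul_sub, smul_smul]
    rw [← mul_assoc, ← uzpow_add, CharTwo.add_self_eq_zero, uzpow_zero, one_mul]
    abel
  rw [key, Units.smul_def]
  have hpv := ne_of_indexClass_ne hvp
  exact sub_mem (hbr _ (hN _ _ hpv.symm _) _ (hN _ _ hpv _))
    (zsmul_mem (hbr _ (hN _ _ hpv.symm _) _ (hN _ _ hpv _)) _)

/-- Each of the four possible terms of `bracket_matX` replaces one index of `(r, s)`, or of its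
transpose, by an equal one, so it stays off the diagonal. -/
theorem bracket_matX_diag_mem {N : Submodule k (SuperMatrix 𝒜 m)}
    (hN : ∀ p q, p ≠ q → ∀ a, matX σ p q a ∈ N) {p r s : Fin m ⊕ Fin m} (hrs : r ≠ s)
    {d e : ZMod 2} {a b : R} (ha : a ∈ 𝒜 d) (hb : b ∈ 𝒜 e) :
    bracket (k := k) (matX σ p p a) (matX σ r s b) ∈ N := by
  have hu : ∀ (ε : ℤˣ) (x : SuperMatrix 𝒜 m), x ∈ N → ε • x ∈ N := fun ε x hx => by
    rw [Units.smul_def]; exact zsmul_mem hx _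
  rw [bracket_matX σ p p r s ha hb rfl]
  refine add_mem (sub_mem (sub_mem ?_ (hu _ _ ?_)) ?_) (hu _ _ ?_) <;>
    split_ifs with h <;> first | exact zero_mem _ | refine hN _ _ ?_ _
  · exact h ▸ hrs
  · exact h ▸ hrs
  · exact h ▸ (swap_ne_swap hrs).symm
  · exact h ▸ (swap_ne_swap hrs).symm

/-- The elements `matX` with two different indices generate the generalized periplectic Lie
superalgebra. -/
theorem periplectic_le (h2 : IsUnit (2 : k)) (hm : 5 ≤ m) {N : Submodule k (SuperMatrix 𝒜 m)}
    (hN : ∀ p q, p ≠ q → ∀ a, matX σ p q a ∈ N)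
    (hbr : ∀ x ∈ N, ∀ y ∈ N, bracket (k := k) x y ∈ N) : (periplectic σ m).toSubmodule ≤ N := by
  refine Submodule.span_le.2 ?_
  rintro _ ⟨x, hx, y, hy, rfl⟩
  refine LinearMap.BilinMap.apply_apply_mem_of_mem_span N _ _ _ ?_ x y (mem_span_matX σ h2 hx)
    (mem_span_matX σ h2 hy)
  rintro _ ⟨p, q, d, a, ha, rfl⟩ _ ⟨r, s, e, b, hb, rfl⟩
  by_cases hpq : p = q
  · subst hpq
    by_cases hrs : r = s
    · subst hrs
      by_cases hpr : p = r
      · subst hpr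
        exact matX_diag_mem σ hm hN hbr p ha hb
      -- Positions `(r, r)` and `(r.swap, r.swap)` carry the same elements up to sign; all other
      -- distinct diagonal positions commute.
      · by_cases hpr' : p = r.swap
        · rw [matX_symm σ r r, ← hpr', map_neg]
          exact neg_mem (matX_diag_mem σ hm hN hbr p ha (entryConj_mem σ r r hb))
        · rw [bracket_matX_zero σ hpr hpr hpr' hpr']
          exact zero_mem _
    · exact bracket_matX_diag_mem σ hN hrs ha hb
  · by_cases hrs : r = s
    · subst hrs
      rw [bracket_skew (matX_mem σ p q ha) (matX_mem σ r r hb), Units.smul_def]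
      exact neg_mem (zsmul_mem (bracket_matX_diag_mem σ hN hpq hb ha) _)
    · exact hbr _ (hN _ _ hpq _) _ (hN _ _ hrs _)

/-- The element `matX` of the generalized periplectic Lie superalgebra, for different indices. -/
noncomputable def periplecticRoot (hm : 5 ≤ m) (p q : Fin m ⊕ Fin m) :
    R →ₗ[k] (periplectic σ m).toSubmodule :=
  if h : p ≠ q then (matX σ p q).codRestrict _ (matX_mem_periplectic σ hm h) else 0

theorem coe_periplecticRoot (hm : 5 ≤ m) {p q : Fin m ⊕ Fin m} (hpq : p ≠ q) (a : R) :
    (periplecticRoot σ hm p q a : SuperMatrix 𝒜 m) = matX σ p q a := by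
  rw [periplecticRoot, dif_pos hpq]
  rfl

theorem coe_bracket_periplectic (x y : (periplectic σ m).toSubmodule) :
    ((bracket (k := k) x y : (periplectic σ m).toSubmodule) : SuperMatrix 𝒜 m) =
      bracket (k := k) (x : SuperMatrix 𝒜 m) (y : SuperMatrix 𝒜 m) := rfl

/-- The elements `matX` form a system in the generalized periplectic Lie superalgebra. -/
noncomputable def periplecticSystem (hm : 5 ≤ m) :
    SteinbergSystem σ m (periplectic σ m).toSubmodule where
  u := periplecticRoot σ hm
  mem {p q d a} hpq ha := by
    change (periplecticRoot σ hm p q a : SuperMatrix 𝒜 m) ∈ SuperMatrix.grade 𝒜 m _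
    rw [coe_periplecticRoot σ hm (ne_of_indexClass_ne hpq)]
    exact matX_mem σ p q ha
  symm {p q} hpq a := Subtype.ext <| by
    have h := ne_of_indexClass_ne hpq
    rw [Submodule.coe_neg, coe_periplecticRoot σ hm h,
      coe_periplecticRoot σ hm (swap_ne_swap h.symm), matX_symm]
  mul {p q r} hpq hqr hpr a b := Subtype.ext <| by
    rw [coe_bracket_periplectic, coe_periplecticRoot σ hm (ne_of_indexClass_ne hpq),
      coe_periplecticRoot σ hm (ne_of_indexClass_ne hqr),
      coe_periplecticRoot σ hm (ne_of_indexClass_ne hpr),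
      bracket_matX_mul σ hpq hqr (ne_of_indexClass_ne hpr)]
  zero {p q r s} hpq hrs hqr hps hpr hqs a b := Subtype.ext <| by
    rw [coe_bracket_periplectic, coe_periplecticRoot σ hm (ne_of_indexClass_ne hpq),
      coe_periplecticRoot σ hm (ne_of_indexClass_ne hrs), bracket_matX_zero σ hqr hps hpr hqs]
    rfl

end Periplectic

/-! ### Loops and off-diagonal elements in an algebra generated by a system -/

section Generation

open LieSuperalgebra

variable {k : Type u} {R : Type v} [CommRing k] [Ring R] [Algebra k R]
  {𝒜 : ZMod 2 → Submodule k R} [GradedAlgebra 𝒜] {σ : Superinvolution 𝒜} {m : ℕ}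
  {L : Type w} [AddCommGroup L] [Module k L] [LieSuperalgebra k L] (S : SteinbergSystem σ m L)

theorem entryConj_swap' (σ : Superinvolution 𝒜) (p q : Fin m ⊕ Fin m) (a : R) :
    entryConj σ p q (entryConj σ q.swap p.swap a) = a := by
  simpa using entryConj_swap σ q.swap p.swap a

namespace SteinbergSystem

/-- A system generates a Lie superalgebra. -/
def Generates : Prop :=
  ∀ N : Submodule k L, (∀ p q, indexClass p ≠ indexClass q → ∀ a, S.u p q a ∈ N) →
    (∀ {d e : ZMod 2} {x y : L}, x ∈ grade (k := k) d → y ∈ grade (k := k) e → x ∈ N → y ∈ N →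
      bracket (k := k) x y ∈ N) → ∀ x, x ∈ N

variable {S} in
theorem bracket_mem_comm {p q r s : Fin m ⊕ Fin m} (hpq : indexClass p ≠ indexClass q)
    (hrs : indexClass r ≠ indexClass s) {N : Submodule k L}
    (h : ∀ a b, bracket (k := k) (S.u p q a) (S.u r s b) ∈ N) (a b : R) :
    bracket (k := k) (S.u r s a) (S.u p q b) ∈ N := by
  revert a
  refine graded_induction 𝒜 (fun a a' ha ha' => ?_) fun d a ha => ?_
  · rw [map_add, map_add, LinearMap.add_apply]
    exact add_mem ha ha'
  · revert b
    refine graded_induction 𝒜 (fun b b' hb hb' => ?_) fun e b hb => ?_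
    · rw [map_add, map_add]
      exact add_mem hb hb'
    · rw [bracket_skew (S.mem hrs ha) (S.mem hpq hb), Units.smul_def]
      exact neg_mem (zsmul_mem (h b a) _)

/-- The span of the brackets `[u_{xv}(a), u_{vy}(b)]` for a fixed index `v`. -/
def pathSpan (v : Fin m ⊕ Fin m) : Submodule k L :=
  Submodule.span k {z | ∃ x y a b, indexClass x ≠ indexClass v ∧ indexClass v ≠ indexClass y ∧
    bracket (k := k) (S.u x v a) (S.u v y b) = z}

/-- The span of the brackets `[u_{xv}(a), u_{vx}(b)]` for a fixed index `v`. -/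
def loopSpan (v : Fin m ⊕ Fin m) : Submodule k L :=
  Submodule.span k {z | ∃ x a b, indexClass x ≠ indexClass v ∧
    bracket (k := k) (S.u x v a) (S.u v x b) = z}

theorem path_mem {x v y : Fin m ⊕ Fin m} (hxv : indexClass x ≠ indexClass v)
    (hvy : indexClass v ≠ indexClass y) (a b : R) :
    bracket (k := k) (S.u x v a) (S.u v y b) ∈ S.pathSpan v :=
  Submodule.subset_span ⟨x, y, a, b, hxv, hvy, rfl⟩

theorem loop_mem {x v : Fin m ⊕ Fin m} (hxv : indexClass x ≠ indexClass v) (a b : R) :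
    bracket (k := k) (S.u x v a) (S.u v x b) ∈ S.loopSpan v :=
  Submodule.subset_span ⟨x, a, b, hxv, rfl⟩

theorem loopSpan_le (v : Fin m ⊕ Fin m) : S.loopSpan v ≤ S.pathSpan v := by
  refine Submodule.span_le.2 ?_
  rintro _ ⟨x, a, b, hxv, rfl⟩
  exact S.path_mem hxv hxv.symm a b

/-- The middle index of a loop may be replaced. -/
theorem loop_mem_loopSpan {x w v : Fin m ⊕ Fin m} (hxw : indexClass x ≠ indexClass w)
    (hvx : indexClass v ≠ indexClass x) (hvw : indexClass v ≠ indexClass w) (a b : R) :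
    bracket (k := k) (S.u x w a) (S.u w x b) ∈ S.loopSpan v := by
  revert a
  refine graded_induction 𝒜 (fun a a' ha ha' => ?_) fun d a ha => ?_
  · rw [map_add, map_add, LinearMap.add_apply]
    exact add_mem ha ha'
  · rw [← one_mul a, ← S.mul hvx.symm hvw hxw, isBracketLike_bracket.jacobi
      (S.mem hvx.symm (SetLike.one_mem_graded 𝒜)) (S.mem hvw ha), S.mul hvw hxw.symm hvx,
      Units.smul_def]
    -- In the second Jacobi term the inner bracket `[u x v 1, u w x b]` lies in `u w v (R)`, so the
    -- whole term is again a loop through `v`, with its factors reversed.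
    refine sub_mem (S.loop_mem hvx.symm _ _) (zsmul_mem ?_ _)
    have h : bracket (k := k) (S.u x v 1) (S.u w x b) ∈ LinearMap.range (S.u w v) :=
      bracket_mem_comm hxw.symm hvx.symm
        (fun a b => S.mul hxw.symm hvx.symm hvw.symm a b ▸ ⟨_, rfl⟩) _ _
    obtain ⟨c, hc⟩ := h
    rw [← hc]
    exact bracket_mem_comm hvw.symm hvw (fun a b => S.loop_mem hvw.symm a b) _ _

/-- The middle index of a path can be moved off two prescribed residues: for a loop by Jacobi,
otherwise because `extend` does not depend on it. -/
theorem exists_mem_pathSpan (hm : 5 ≤ m) (i j : Fin m) {x w y : Fin m ⊕ Fin m}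
    (hxw : indexClass x ≠ indexClass w) (hwy : indexClass w ≠ indexClass y) (a b : R) :
    ∃ v, indexClass v ≠ i ∧ indexClass v ≠ j ∧
      bracket (k := k) (S.u x w a) (S.u w y b) ∈ S.pathSpan v := by
  by_cases hxy : x = y
  · subst hxy
    obtain ⟨v, hvx, hvw, hvi, hvj⟩ := exists_indexClass_ne hm (indexClass x) (indexClass w) i j
    exact ⟨v, hvi, hvj, S.loopSpan_le v (S.loop_mem_loopSpan hxw hvx hvw a b)⟩
  · obtain ⟨v, hvx, hvy, hvi, hvj⟩ := exists_indexClass_ne hm (indexClass x) (indexClass y) i j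
    refine ⟨v, hvi, hvj, ?_⟩
    rw [S.bracketLike_mul hm isBracketLike_bracket hxy hxw hwy,
      ← S.extend_eq hm isBracketLike_bracket hxy hvx.symm hvy]
    exact S.path_mem hvx.symm hvy _ _

/-- When `v` is unrelated to `p` and `q`, bracketing with `u p q a` can change only the end `r`:
directly if `q = r`, after transposing if `p = r.swap`, and otherwise the bracket is zero. -/
theorem bracket_eq_left {p q r v : Fin m ⊕ Fin m} (hpq : indexClass p ≠ indexClass q)
    (hvp : indexClass v ≠ indexClass p) (hvq : indexClass v ≠ indexClass q)
    (hrv : indexClass r ≠ indexClass v) (a b : R) : ∃ x c, indexClass x ≠ indexClass v ∧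
      bracket (k := k) (S.u p q a) (S.u r v b) = S.u x v c := by
  by_cases hqr : q = r
  · subst hqr
    exact ⟨p, a * b, hvp.symm, S.mul hpq hrv hvp.symm a b⟩
  by_cases hpr : p = r.swap
  · subst hpr
    rw [indexClass_swap] at hpq
    refine ⟨q.swap, -(entryConj σ r.swap q a * b), by simpa using hvq.symm, ?_⟩
    rw [S.symm (by simpa using hpq), Sum.swap_swap, map_neg, LinearMap.neg_apply,
      S.mul (by simpa using hpq.symm) hrv (by simpa using hvq.symm), map_neg]
  · refine ⟨p, 0, hvp.symm, ?_⟩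
    rw [S.zero hpq hrv hqr (ne_of_indexClass_ne hvp.symm) hpr
      (ne_swap_of_indexClass_ne hvq.symm), map_zero]

theorem bracket_eq_right {p q s v : Fin m ⊕ Fin m} (hpq : indexClass p ≠ indexClass q)
    (hvp : indexClass v ≠ indexClass p) (hvq : indexClass v ≠ indexClass q)
    (hvs : indexClass v ≠ indexClass s) (a b : R) : ∃ y c, indexClass v ≠ indexClass y ∧
      bracket (k := k) (S.u p q a) (S.u v s b) = S.u v y c := by
  obtain ⟨x, c, hx, h⟩ := S.bracket_eq_left (p := p) (q := q) (r := s.swap) (v := v.swap) hpq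
    (by simpa) (by simpa) (by simpa using hvs.symm) a (entryConj σ v s b)
  refine ⟨x.swap, entryConj σ x v.swap c, by simpa using hx.symm, ?_⟩
  rw [S.symm hvs, map_neg, h, S.symm hx, neg_neg, Sum.swap_swap]

/-- The span of all brackets `[u_{xv}(a), u_{vy}(b)]`. -/
def allPathSpan : Submodule k L := ⨆ v, S.pathSpan v

/-- After the middle index of a path is moved off `p` and `q`, bracketing with `u p q a` is a
derivation that changes one end of the path at a time and keeps the middle. -/
theorem bracket_mem_allPathSpan (hm : 5 ≤ m) {p q : Fin m ⊕ Fin m}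
    (hpq : indexClass p ≠ indexClass q) (a : R) {z : L} (hz : z ∈ S.allPathSpan) :
    bracket (k := k) (S.u p q a) z ∈ S.allPathSpan := by
  have key : ∀ v, indexClass v ≠ indexClass p → indexClass v ≠ indexClass q →
      S.pathSpan v ≤ S.allPathSpan.comap (bracket (k := k) (S.u p q a)) := fun v hvp hvq => by
    refine Submodule.span_le.2 ?_
    rintro _ ⟨x, y, b, c, hxv, hvy, rfl⟩
    change bracket (k := k) (S.u p q a) _ ∈ S.allPathSpan
    refine le_iSup S.pathSpan v ?_
    revert a
    refine graded_induction 𝒜 (fun a a' ha ha' => ?_) fun d a ha => ?_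
    · rw [map_add, map_add, LinearMap.add_apply]
      exact add_mem ha ha'
    · revert b
      refine graded_induction 𝒜 (fun b b' hb hb' => ?_) fun e b hb => ?_
      · rw [map_add, map_add, LinearMap.add_apply, map_add]
        exact add_mem hb hb'
      · rw [bracket_bracket (S.mem hpq ha) (S.mem hxv hb)]
        obtain ⟨x', b', hx', h⟩ := S.bracket_eq_left hpq hvp hvq hxv a b
        obtain ⟨y', c', hy', h'⟩ := S.bracket_eq_right hpq hvp hvq hvy a c
        rw [h, h', Units.smul_def]
        exact add_mem (S.path_mem hx' hvy _ _) (zsmul_mem (S.path_mem hxv hy' _ _) _)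
  change z ∈ S.allPathSpan.comap (bracket (k := k) (S.u p q a))
  refine (show ⨆ v, S.pathSpan v ≤ _ from iSup_le fun w => ?_) hz
  refine Submodule.span_le.2 ?_
  rintro _ ⟨x, y, b, c, hxw, hwy, rfl⟩
  obtain ⟨v, hvp, hvq, hv⟩ :=
    S.exists_mem_pathSpan hm (indexClass p) (indexClass q) hxw hwy b c
  exact key v hvp hvq hv

/-- The normaliser `N` of the path span contains the generators and is closed under brackets by
Jacobi, so it is everything. The path span is therefore stable under all brackets and, since it
contains the generators, is everything too. -/
theorem mem_allPathSpan (hm : 5 ≤ m) (hS : S.Generates) (x : L) : x ∈ S.allPathSpan := by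
  let N : Submodule k L :=
    { carrier := {x | ∀ y ∈ S.allPathSpan, bracket (k := k) x y ∈ S.allPathSpan}
      zero_mem' := fun y _ => by rw [map_zero, LinearMap.zero_apply]; exact zero_mem _
      add_mem' := fun {x x'} hx hx' y hy => by
        rw [map_add, LinearMap.add_apply]; exact add_mem (hx y hy) (hx' y hy)
      smul_mem' := fun c x hx y hy => by
        rw [map_smul, LinearMap.smul_apply]; exact Submodule.smul_mem _ _ (hx y hy) }
  have hN : ∀ x, x ∈ N := hS N (fun p q hpq a y hy => S.bracket_mem_allPathSpan hm hpq a hy)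
    fun {d e x x'} gx gx' hx hx' y hy => by
      rw [isBracketLike_bracket.jacobi gx gx', Units.smul_def]
      exact sub_mem (hx _ (hx' y hy)) (zsmul_mem (hx' _ (hx y hy)) _)
  refine hS _ (fun p q hpq a => ?_) (fun {d e x y} _ _ _ hy => hN x y hy) x
  obtain ⟨v, hvp, hvq, -, -⟩ :=
    exists_indexClass_ne hm (indexClass p) (indexClass q) (indexClass q) (indexClass q)
  rw [← one_mul a, ← S.mul hvp.symm hvq hpq]
  exact le_iSup S.pathSpan v (S.path_mem hvp.symm hvq _ _)

/-- The sum of the elements `u_{pq}(A_{pq})` for the off-diagonal entries of a matrix. -/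
noncomputable def offDiagSum (hm : 5 ≤ m) :
    (Fin m ⊕ Fin m → Fin m ⊕ Fin m → R) →ₗ[k] L :=
  -- `extend` replaces `u` because the positions `(p, p.swap)` are off the diagonal, yet a system
  -- has no relations for `u` there.
  ∑ p, ∑ q, (if p = q then 0 else S.extend hm (bracket (k := k)) p q) ∘ₗ
    LinearMap.proj q ∘ₗ LinearMap.proj p

theorem offDiagSum_apply (hm : 5 ≤ m) (A : Fin m ⊕ Fin m → Fin m ⊕ Fin m → R) :
    S.offDiagSum hm A =
      ∑ p, ∑ q, if p = q then 0 else S.extend hm (bracket (k := k)) p q (A p q) := by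
  simp only [offDiagSum, LinearMap.sum_apply, LinearMap.comp_apply, LinearMap.proj_apply]
  refine Finset.sum_congr rfl fun p _ => Finset.sum_congr rfl fun q _ => ?_
  split_ifs <;> rfl

/-- A Lie superalgebra generated by a system is the sum of its loops and of the off-diagonal
elements. -/
theorem exists_add_offDiagSum (hm : 5 ≤ m) (hS : S.Generates) (x : L) :
    ∃ h ∈ ⨆ v, S.loopSpan v, ∃ A, h + S.offDiagSum hm A = x := by
  suffices hx : x ∈ (⨆ v, S.loopSpan v) ⊔ LinearMap.range (S.offDiagSum hm) by
    obtain ⟨h, hh, _, ⟨A, rfl⟩, e⟩ := Submodule.mem_sup.1 hx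
    exact ⟨h, hh, A, e⟩
  refine (show ⨆ v, S.pathSpan v ≤ _ from iSup_le fun w => ?_) (S.mem_allPathSpan hm hS x)
  refine Submodule.span_le.2 ?_
  rintro _ ⟨x, y, a, b, hxw, hwy, rfl⟩
  by_cases hxy : x = y
  · subst hxy
    exact Submodule.mem_sup_left (le_iSup S.loopSpan w (S.loop_mem hxw a b))
  -- A path with different ends depends only on its ends and on the product `a * b`: the matrix has
  -- a single nonzero entry.
  · refine Submodule.mem_sup_right ⟨Pi.single x (Pi.single y (a * b)), ?_⟩
    rw [S.bracketLike_mul hm isBracketLike_bracket hxy hxw hwy, offDiagSum_apply,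
      Finset.sum_eq_single x, Finset.sum_eq_single y, if_neg hxy, Pi.single_eq_same,
      Pi.single_eq_same]
    · intro q _ hq
      rw [Pi.single_eq_same, Pi.single_eq_of_ne hq, map_zero, ite_self]
    · simp
    · intro p _ hp
      refine Finset.sum_eq_zero fun q _ => ?_
      rw [Pi.single_eq_of_ne hp, Pi.zero_apply, map_zero, ite_self]
    · simp

/-- As `v` has a residue different from those of `p` and `q`, the inner bracket is nonzero only if
`x = p` or, after transposing, `x = q.swap`. Then one end moves from `x` to `v` and back. -/
theorem loop_bracket_mem_left {x v p q : Fin m ⊕ Fin m} (hpq : indexClass p ≠ indexClass q)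
    (hvp : indexClass v ≠ indexClass p) (hvq : indexClass v ≠ indexClass q)
    (hxv : indexClass x ≠ indexClass v) (a b c : R) :
    bracket (k := k) (S.u x v a) (bracket (k := k) (S.u v x b) (S.u p q c)) ∈
      LinearMap.range (S.u p q) := by
  have key : ∀ q, indexClass x ≠ indexClass q → indexClass v ≠ indexClass q → ∀ c,
      bracket (k := k) (S.u x v a) (bracket (k := k) (S.u v x b) (S.u x q c)) =
        S.u x q (a * (b * c)) := fun q hxq hvq c => by
    rw [S.mul hxv.symm hxq hvq, S.mul hxv hvq hxq]
  by_cases hp : x = p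
  · subst hp
    exact key q hpq hvq c ▸ ⟨_, rfl⟩
  by_cases hq : x = q.swap
  · subst hq
    rw [S.symm hpq, map_neg, map_neg, key p.swap (by simpa using hpq.symm) (by simpa using hvp)]
    refine ⟨entryConj σ q.swap p.swap (a * (b * entryConj σ p q c)), ?_⟩
    rw [S.symm hpq, entryConj_swap' σ]
  · rw [S.zero hxv.symm hpq hp (ne_of_indexClass_ne hvq) (ne_swap_of_indexClass_ne hvp) hq,
      map_zero]
    exact zero_mem _

theorem loop_bracket_mem_right {x v p q : Fin m ⊕ Fin m} (hpq : indexClass p ≠ indexClass q)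
    (hvp : indexClass v ≠ indexClass p) (hvq : indexClass v ≠ indexClass q)
    (hxv : indexClass x ≠ indexClass v) (a b c : R) :
    bracket (k := k) (S.u v x b) (bracket (k := k) (S.u x v a) (S.u p q c)) ∈
      LinearMap.range (S.u p q) := by
  have key : ∀ p, indexClass p ≠ indexClass x → indexClass p ≠ indexClass v → ∀ c,
      bracket (k := k) (S.u v x b) (bracket (k := k) (S.u x v a) (S.u p x c)) ∈
        LinearMap.range (S.u p x) := fun p hpx hpv c => by
    have h : bracket (k := k) (S.u x v a) (S.u p x c) ∈ LinearMap.range (S.u p v) :=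
      bracket_mem_comm hpx hxv (fun a b => S.mul hpx hxv hpv a b ▸ ⟨_, rfl⟩) _ _
    obtain ⟨e, he⟩ := h
    rw [← he]
    exact bracket_mem_comm hpv hxv.symm (fun a b => S.mul hpv hxv.symm hpx a b ▸ ⟨_, rfl⟩) _ _
  by_cases hq : x = q
  · subst hq
    exact key p hpq hvp.symm c
  by_cases hp : x = p.swap
  · subst hp
    obtain ⟨e, he⟩ := key q.swap (by simpa using hpq.symm) (by simpa using hvq.symm)
      (entryConj σ p q c)
    rw [S.symm hpq, map_neg, map_neg, ← he]
    refine ⟨entryConj σ q.swap p.swap e, ?_⟩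
    rw [S.symm hpq, entryConj_swap' σ]
  · rw [S.zero hxv hpq (ne_of_indexClass_ne hvp) hq hp (ne_swap_of_indexClass_ne hvq), map_zero]
    exact zero_mem _

/-- Loops act on the elements `u_{pq}(a)` for fixed `p` and `q`. -/
theorem loopSpan_bracket_mem (hm : 5 ≤ m) {p q : Fin m ⊕ Fin m}
    (hpq : indexClass p ≠ indexClass q) {h : L} (hh : h ∈ ⨆ v, S.loopSpan v) (a : R) :
    bracket (k := k) h (S.u p q a) ∈ LinearMap.range (S.u p q) := by
  have key : ∀ v, indexClass v ≠ indexClass p → indexClass v ≠ indexClass q → S.loopSpan v ≤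
      (LinearMap.range (S.u p q)).comap ((bracket (k := k)).flip (S.u p q a)) :=
      fun v hvp hvq => by
    refine Submodule.span_le.2 ?_
    rintro _ ⟨x, b, c, hxv, rfl⟩
    change bracket (k := k) _ (S.u p q a) ∈ LinearMap.range (S.u p q)
    revert b
    refine graded_induction 𝒜 (fun b b' hb hb' => ?_) fun d b hb => ?_
    · simp only [map_add, LinearMap.add_apply]
      exact add_mem hb hb'
    · revert c
      refine graded_induction 𝒜 (fun c c' hc hc' => ?_) fun e c hc => ?_
      · simp only [map_add, LinearMap.add_apply]
        exact add_mem hc hc'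
      · rw [isBracketLike_bracket.jacobi (S.mem hxv hb) (S.mem hxv.symm hc), Units.smul_def]
        exact sub_mem (S.loop_bracket_mem_left hpq hvp hvq hxv b c a)
          (zsmul_mem (S.loop_bracket_mem_right hpq hvp hvq hxv b c a) _)
  change h ∈ (LinearMap.range (S.u p q)).comap ((bracket (k := k)).flip (S.u p q a))
  refine (show ⨆ v, S.loopSpan v ≤ _ from iSup_le fun w => ?_) hh
  refine Submodule.span_le.2 ?_
  rintro _ ⟨x, b, c, hxw, rfl⟩
  -- A loop through `w` is first rewritten as loops through an index away from `p` and `q`.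
  obtain ⟨v, hvx, hvw, hvp, hvq⟩ :=
    exists_indexClass_ne hm (indexClass x) (indexClass w) (indexClass p) (indexClass q)
  exact key v hvp hvq (S.loop_mem_loopSpan hxw hvx hvw b c)

end SteinbergSystem

end Generation

/-! ### The kernel and the image of the canonical homomorphism -/

section Kernel

open LieSuperalgebra

variable {k : Type u} {R : Type v} [CommRing k] [Ring R] [Algebra k R]
  {𝒜 : ZMod 2 → Submodule k R} [GradedAlgebra 𝒜] {σ : Superinvolution 𝒜} {m : ℕ}
  {L : Type w} [AddCommGroup L] [Module k L] [LieSuperalgebra k L] (S : SteinbergSystem σ m L)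

theorem prp_apply (X : SuperMatrix 𝒜 m) (p q : Fin m ⊕ Fin m) :
    prp σ m X p q = entryConj σ q.swap p.swap (X q.swap p.swap) := by
  rcases p with i | i <;> rcases q with j | j <;> rfl

theorem coe_periplecticSystem_u (hm : 5 ≤ m) {p q : Fin m ⊕ Fin m} (hpq : p ≠ q) (a : R) :
    ((periplecticSystem σ hm).u p q a : SuperMatrix 𝒜 m) = matX σ p q a :=
  coe_periplecticRoot σ hm hpq a

namespace SteinbergSystem

variable {S} {hm : 5 ≤ m} {φ : Hom k L (periplectic σ m).toSubmodule}
  (hφ : ∀ p q, indexClass p ≠ indexClass q → ∀ a, φ (S.u p q a) = (periplecticSystem σ hm).u p q a)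

include hφ

theorem coe_map_extend {p q : Fin m ⊕ Fin m} (hpq : p ≠ q) (a : R) :
    (φ (S.extend hm (bracket (k := k)) p q a) : SuperMatrix 𝒜 m) = matX σ p q a := by
  obtain ⟨v, hvp, hvq, -, -⟩ :=
    exists_indexClass_ne hm (indexClass p) (indexClass q) (indexClass q) (indexClass q)
  rw [← S.extend_eq hm isBracketLike_bracket hpq hvp.symm hvq, φ.map_bracket_apply,
    coe_bracket_periplectic, hφ _ _ hvp.symm, hφ _ _ hvq,
    coe_periplecticSystem_u hm (ne_of_indexClass_ne hvp.symm),
    coe_periplecticSystem_u hm (ne_of_indexClass_ne hvq), bracket_matX_mul σ hvp.symm hvq hpq,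
    one_mul]

/-- A loop maps to a combination of `matX x x` and `matX v v`, which are diagonal. -/
theorem map_loop_apply_of_ne {h : L} (hh : h ∈ ⨆ v, S.loopSpan v) {i j : Fin m ⊕ Fin m}
    (hij : i ≠ j) : (φ h : SuperMatrix 𝒜 m) i j = 0 := by
  let D : Submodule k L :=
    { carrier := {x | (φ x : SuperMatrix 𝒜 m) i j = 0}
      zero_mem' := by rw [Set.mem_ofPred_eq, map_zero]; rfl
      add_mem' := fun {x y} hx hy => by
        rw [Set.mem_ofPred_eq] at *
        rw [map_add]
        exact (congrArg₂ (· + ·) hx hy).trans (add_zero 0)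
      smul_mem' := fun c x hx => by
        rw [Set.mem_ofPred_eq] at *
        rw [map_smul]
        exact (congrArg (c • ·) hx).trans (smul_zero c) }
  have hdiag : ∀ p a, matX σ p p a i j = 0 := fun p a => by
    rw [matX_apply, if_neg (fun h => hij (h.1.symm.trans h.2)),
      if_neg (fun h => hij (h.1.symm.trans h.2)), sub_zero]
  refine (show ⨆ v, S.loopSpan v ≤ D from iSup_le fun v => Submodule.span_le.2 ?_) hh
  rintro _ ⟨x, a, b, hxv, rfl⟩
  revert a
  refine graded_induction 𝒜 (fun a a' ha ha' => ?_) fun d a ha => ?_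
  · rw [map_add, map_add, LinearMap.add_apply]
    exact add_mem (S := Submodule k L) ha ha'
  · revert b
    refine graded_induction 𝒜 (fun b b' hb hb' => ?_) fun e b hb => ?_
    · rw [map_add, map_add]
      exact add_mem (S := Submodule k L) hb hb'
    · change (φ (bracket (k := k) _ _) : SuperMatrix 𝒜 m) i j = 0
      rw [φ.map_bracket_apply, coe_bracket_periplectic, hφ _ _ hxv, hφ _ _ hxv.symm,
        coe_periplecticSystem_u hm (ne_of_indexClass_ne hxv),
        coe_periplecticSystem_u hm (ne_of_indexClass_ne hxv.symm),
        bracket_matX σ x v v x ha hb rfl, if_pos rfl, if_pos rfl,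
        if_neg (ne_swap_of_indexClass_ne hxv.symm), if_neg (ne_swap_of_indexClass_ne hxv).symm,
        smul_zero, sub_zero, add_zero, Units.smul_def]
      change matX σ x x (a * b) i j - (_ • matX σ v v (b * a)) i j = 0
      rw [hdiag, zero_sub, neg_eq_zero]
      change ((_ : ℤˣ) : ℤ) • (matX σ v v (b * a) i j) = 0
      rw [hdiag, smul_zero]

/-- The coefficients `A` are not unique, so they need not vanish. They are only forced to be
invariant under `prp` off the diagonal, while the elements they multiply change sign; this makes the
sum its own negative. -/
theorem offDiagSum_eq_zero (h2 : IsUnit (2 : k)) {h : L} (hh : h ∈ ⨆ v, S.loopSpan v)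
    {A : Fin m ⊕ Fin m → Fin m ⊕ Fin m → R} (h0 : φ (h + S.offDiagSum hm A) = 0) :
    S.offDiagSum hm A = 0 := by
  let A' : SuperMatrix 𝒜 m := fun p q => if p = q then 0 else A p q
  have h1 : (φ (S.offDiagSum hm A) : SuperMatrix 𝒜 m) = A' - prp σ m A' := by
    have hs : A' = ∑ p, ∑ q, matE 𝒜 p q (A' p q) := Matrix.matrix_eq_sum_single _
    conv_rhs => rw [hs]
    simp only [map_sum, ← Finset.sum_sub_distrib, ← matX_eq_sub_prp, offDiagSum_apply,
      Submodule.coe_sum]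
    refine Finset.sum_congr rfl fun p _ => Finset.sum_congr rfl fun q _ => ?_
    by_cases hpq : p = q
    · simp only [A', if_pos hpq, map_zero]
      rfl
    · simp only [A', if_neg hpq]
      exact coe_map_extend hφ hpq _
  have hA : ∀ p q, p ≠ q → A p q = entryConj σ q.swap p.swap (A q.swap p.swap) :=
      fun p q hpq => by
    have h3 : (φ h : SuperMatrix 𝒜 m) + (A' - prp σ m A') = 0 := by
      rw [← h1, ← Submodule.coe_add, ← map_add, h0]; rfl
    have h4 : (φ h : SuperMatrix 𝒜 m) p q + (A' p q - prp σ m A' p q) = 0 :=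
      congrFun (congrFun h3 p) q
    rw [map_loop_apply_of_ne hφ hh hpq, zero_add, sub_eq_zero, prp_apply] at h4
    simpa only [A', if_neg hpq, if_neg (swap_ne_swap (Ne.symm hpq))] using h4
  -- Reindex the double sum by `(p, q) ↦ (q.swap, p.swap)`, then use `extend_symm` and the
  -- invariance `hA`.
  have hneg : S.offDiagSum hm A = -S.offDiagSum hm A := by
    conv_lhs => rw [offDiagSum_apply, Finset.sum_comm]
    rw [offDiagSum_apply, ← Finset.sum_neg_distrib,
      ← Equiv.sum_comp (Equiv.sumComm (Fin m) (Fin m))]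
    refine Finset.sum_congr rfl fun q _ => ?_
    rw [← Finset.sum_neg_distrib, ← Equiv.sum_comp (Equiv.sumComm (Fin m) (Fin m))]
    refine Finset.sum_congr rfl fun p _ => ?_
    simp only [Equiv.sumComm_apply]
    by_cases hpq : q = p
    · rw [if_pos (by rw [hpq]), if_pos hpq, neg_zero]
    · rw [if_neg (swap_ne_swap (Ne.symm hpq)), if_neg hpq,
        S.extend_symm hm isBracketLike_bracket (swap_ne_swap (Ne.symm hpq)), Sum.swap_swap,
        Sum.swap_swap, ← hA q p hpq]
  have h5 : (2 : k) • S.offDiagSum hm A = 0 := by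
    rw [two_smul]
    exact add_eq_zero_iff_eq_neg.2 hneg
  exact (h2.smul_eq_zero).1 h5

/-- The kernel of the homomorphism to the generalized periplectic Lie superalgebra is central. -/
theorem central_of_generates (h2 : IsUnit (2 : k)) (hS : S.Generates) {x : L} (hx : φ x = 0)
    (y : L) : bracket (k := k) x y = 0 := by
  let N : Submodule k L :=
    { carrier := {y | ∀ x, φ x = 0 → bracket (k := k) x y = 0}
      zero_mem' := fun x _ => map_zero _
      add_mem' := fun hy hy' x hx => by rw [map_add, hy x hx, hy' x hx, add_zero]
      smul_mem' := fun c y hy x hx => by rw [map_smul, hy x hx, smul_zero] }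
  refine hS N (fun p q hpq a x hx => ?_) (fun {d e y z} gy gz hy hz x hx => ?_) y x hx
  · obtain ⟨h, hh, A, rfl⟩ := S.exists_add_offDiagSum hm hS x
    have hA := offDiagSum_eq_zero hφ h2 hh hx
    rw [hA, add_zero] at hx ⊢
    -- The bracket is some `u p q b` that lies in the kernel; the `(p, q)` entry of its image is
    -- `b`, so `b = 0`.
    obtain ⟨b, hb⟩ := S.loopSpan_bracket_mem hm hpq hh a
    have h1 : φ (S.u p q b) = 0 := by
      rw [hb, φ.map_bracket_apply, hx, map_zero, LinearMap.zero_apply]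
    have hne := ne_of_indexClass_ne hpq
    have h3 : matX σ p q b = 0 := by
      rw [← coe_periplecticSystem_u hm hne, ← hφ _ _ hpq, h1]; rfl
    have h4 : matX σ p q b p q = 0 := congrFun (congrFun h3 p) q
    rw [matX_apply, if_pos ⟨rfl, rfl⟩,
      if_neg (fun h => ne_swap_of_indexClass_ne hpq h.1.symm), sub_zero] at h4
    rw [← hb, h4, map_zero]
  -- The derivation rule needs homogeneous elements, and the homogeneous components of `x` are again
  -- in the kernel.
  · obtain ⟨x₀, g0, x₁, g1, k0, k1, rfl⟩ := φ.exists_add_of_map_eq_zero hx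
    rw [map_add, LinearMap.add_apply, bracket_bracket g0 gy, bracket_bracket g1 gy, hy _ k0,
      hy _ k1, hz _ k0, hz _ k1]
    simp

theorem surjective_of_map_u (h2 : IsUnit (2 : k)) : Function.Surjective φ := by
  have h := periplectic_le σ h2 hm
    (N := LinearMap.range ((periplectic σ m).toSubmodule.subtype ∘ₗ φ.toLinearMap))
    (fun p q hpq a => ⟨_, coe_map_extend hφ hpq a⟩) (by
      rintro _ ⟨x, rfl⟩ _ ⟨y, rfl⟩
      refine ⟨bracket (k := k) x y, ?_⟩
      exact congrArg Subtype.val (φ.map_bracket_apply x y))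
  rintro ⟨y, hy⟩
  obtain ⟨x, hx⟩ := h hy
  exact ⟨x, Subtype.ext hx⟩

end SteinbergSystem

theorem Stp.generates (σ : Superinvolution 𝒜) (m : ℕ) : (Stp.system σ m).Generates := by
  intro N hN hbr
  refine PresentedLieSuperalgebra.mem_of_gen_mem N (fun x => ?_) hbr
  obtain ⟨p, q, a, hpq, h⟩ := Stp.exists_gen_eq x
  rw [h]
  exact hN p q hpq a

theorem Stp.hom_ext {E : Type*} [AddCommGroup E] [Module k E] [LieSuperalgebra k E]
    {θ θ' : Hom k (Stp σ m) E} (h : ∀ p q, indexClass p ≠ indexClass q → ∀ a,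
      θ ((Stp.system σ m).u p q a) = θ' ((Stp.system σ m).u p q a)) : θ = θ' := by
  refine PresentedLieSuperalgebra.hom_eq fun x => ?_
  obtain ⟨p, q, a, hpq, e⟩ := Stp.exists_gen_eq x
  rw [e, h p q hpq]

/-- The matrices `matT`, `matF`, `matG` are `matX` in three of the blocks. The fourth block follows,
since both systems satisfy the same symmetry. -/
theorem isCanonicalHom_iff (hm : 5 ≤ m) (ψ : Hom k (Stp σ m) (periplectic σ m).toSubmodule) :
    IsCanonicalHom σ m ψ ↔ ∀ p q, indexClass p ≠ indexClass q → ∀ a,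
      ψ ((Stp.system σ m).u p q a) = (periplecticSystem σ hm).u p q a := by
  have hX : ∀ {i j : Fin m} (a : R), i ≠ j →
      (((periplecticSystem σ hm).u (.inl i) (.inl j) a : SuperMatrix 𝒜 m) = matT σ i j a) ∧
      (((periplecticSystem σ hm).u (.inl i) (.inr j) a : SuperMatrix 𝒜 m) = matF σ i j a) ∧
      (((periplecticSystem σ hm).u (.inr i) (.inl j) a : SuperMatrix 𝒜 m) = matG σ i j a) :=
      fun {i j} a hij => by
    rw [coe_periplecticSystem_u hm (by simpa), coe_periplecticSystem_u hm (by simp),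
      coe_periplecticSystem_u hm (by simp), matX_eq, matX_eq, matX_eq]
    refine ⟨rfl, ?_, ?_⟩
    · rw [matF, ← σ.apply_parityMap, sub_eq_add_neg]
      refine congrArg _ (?_ : -matE 𝒜 _ _ (-_) = _)
      exact (map_neg (matELinear 𝒜 _ _) _ ▸ neg_neg _ :)
    · rw [matG, ← σ.apply_parityMap]
      rfl
  constructor
  · intro h p q hpq a
    have ht : ∀ {i j : Fin m}, i ≠ j → ∀ a, ψ ((Stp.system σ m).u (.inl i) (.inl j) a) =
        (periplecticSystem σ hm).u (.inl i) (.inl j) a := fun {i j} hij => graded_induction 𝒜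
      (fun a b ha hb => by simp only [map_add, ha, hb]) fun d a ha => Subtype.ext <| by
        rw [(hX a hij).1, ← h.map_t hij ⟨a, ha⟩, Stp.t_eq]
    rcases p with i | i <;> rcases q with j | j
    · exact ht hpq a
    · revert a
      exact graded_induction 𝒜
        (fun a b ha hb => by simp only [map_add, ha, hb]) fun d a ha => Subtype.ext <| by
          rw [(hX a (show i ≠ j from hpq)).2.1, ← h.map_f (show i ≠ j from hpq) ⟨a, ha⟩, Stp.f_eq]
    · revert a
      exact graded_induction 𝒜
        (fun a b ha hb => by simp only [map_add, ha, hb]) fun d a ha => Subtype.ext <| by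
          rw [(hX a (show i ≠ j from hpq)).2.2, ← h.map_g (show i ≠ j from hpq) ⟨a, ha⟩, Stp.g_eq]
    · rw [SteinbergSystem.symm _ hpq, SteinbergSystem.symm _ hpq, map_neg]
      exact congrArg _ (ht (Ne.symm hpq) _)
  · intro h
    refine ⟨fun hij d a => ?_, fun hij d a => ?_, fun hij d a => ?_⟩
    · rw [Stp.t_eq, h _ _ (by exact hij), (hX _ hij).1]
    · rw [Stp.f_eq, h _ _ (by exact hij), (hX _ hij).2.1]
    · rw [Stp.g_eq, h _ _ (by exact hij), (hX _ hij).2.2]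

end Kernel

/-! ### The universal central extension -/

theorem mainTheorem5 {k : Type u} [CommRing k] (h2 : IsUnit (2 : k))
    {R : Type v} [Ring R] [Algebra k R] (𝒜 : ZMod 2 → Submodule k R) [GradedAlgebra 𝒜]
    (σ : Superinvolution 𝒜) (m : ℕ) (hm : 5 ≤ m) :
    ∃ ψ : LieSuperalgebra.Hom k (Stp σ m) (periplectic σ m).toSubmodule,
      IsCanonicalHom σ m ψ ∧ (∀ ψ', IsCanonicalHom σ m ψ' → ψ' = ψ) ∧
        LieSuperalgebra.IsUniversalCentralExtension.{w} ψ := by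
  obtain ⟨ψ, hψ⟩ := (periplecticSystem σ hm).exists_hom
  refine ⟨ψ, (isCanonicalHom_iff hm ψ).2 hψ, fun ψ' h' => Stp.hom_ext fun p q hpq a => ?_, ⟨?_, ?_⟩⟩
  · rw [(isCanonicalHom_iff hm ψ').1 h' p q hpq, hψ p q hpq]
  · exact ⟨SteinbergSystem.surjective_of_map_u hψ h2, fun x hx y =>
      SteinbergSystem.central_of_generates hψ h2 (Stp.generates σ m) hx y⟩
  · intro E _ _ _ φ hφ
    -- A bracket in `E` depends only on the images of its arguments, and `liftedBracket x x'` lies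
    -- over the bracket of `x` and `x'`.
    have hbr : ∀ x x' y y', LieSuperalgebra.bracket (k := k) (hφ.liftedBracket x x')
        (hφ.liftedBracket y y') = hφ.liftedBracket (LieSuperalgebra.bracket (k := k) x x')
          (LieSuperalgebra.bracket (k := k) y y') := fun x x' y y' => by
      rw [← hφ.liftedBracket_map, hφ.map_liftedBracket, hφ.map_liftedBracket]
    have hfresh : ∀ p q : Fin m ⊕ Fin m, ∃ v : Fin m ⊕ Fin m,
        indexClass p ≠ indexClass v ∧ indexClass v ≠ indexClass q := fun p q => by
      obtain ⟨v, hvp, hvq, -, -⟩ :=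
        exists_indexClass_ne hm (indexClass p) (indexClass q) (indexClass q) (indexClass q)
      exact ⟨v, hvp.symm, hvq⟩
    obtain ⟨θ, hθ⟩ := ((periplecticSystem σ hm).lift hm hφ.isBracketLike
      hφ.liftedBracket_mem hbr).exists_hom
    -- The lifted root element lies over `[u p v 1, u v q a] = u p q a`.
    have hcomp : φ.comp θ = ψ := Stp.hom_ext fun p q hpq a => by
      obtain ⟨v, hpv, hvq⟩ := hfresh p q
      rw [LieSuperalgebra.Hom.comp_apply, hθ p q hpq, hψ p q hpq]
      change φ ((periplecticSystem σ hm).extend hm hφ.liftedBracket p q a) = _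
      rw [← (periplecticSystem σ hm).extend_eq hm hφ.isBracketLike (ne_of_indexClass_ne hpq) hpv
        hvq, hφ.map_liftedBracket, (periplecticSystem σ hm).mul hpv hvq hpq, one_mul]
    refine ⟨θ, fun x => by rw [← hcomp]; rfl, fun θ' hθ' => Stp.hom_ext fun p q hpq a => ?_⟩
    obtain ⟨v, hpv, hvq⟩ := hfresh p q
    -- Each generator is a bracket, and brackets in `E` do not see the kernel elements by which two
    -- lifts may differ.
    rw [← one_mul a, ← (Stp.system σ m).mul hpv hvq hpq, θ.map_bracket_apply,
      θ'.map_bracket_apply]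
    refine hφ.bracket_congr ?_ ?_ <;> rw [hθ', ← hcomp] <;> rfl
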